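/- Let $K$ be a number field and $m\ge 0$. For every (nonzero) prime $\mathfrak p$ of $K$ let $b_{\mathfrak p},c_{\mathfrak p,1},\dots,c_{\mathfrak p,m}$ be complex numbers such that $b_{\mathfrak p}=1$ for all but finitely many $\mathfrak p$ and the $c_{\mathfrak p,i}$ are bounded. Let $N(\mathfrak p)$ denote the norm of $\mathfrak p$, and formally expand $$\prod_{\mathfrak p}\Bigl(b_{\mathfrak p}+\sum_{i=1}^m c_{\mathfrak p,i}N(\mathfrak p)^{-s_i}\Bigr)=\sum_{x_1,\dots,x_m\ge 1}a_{x_1,\dots,x_m}x_1^{-s_1}\cdots x_m^{-s_m}.$$ Put $D_{\mathfrak p,i}(s)=1+c_{\mathfrak p,i}N(\mathfrak p)^{-s}$, and let $E_0$ be a real number such that for all $\mathfrak p$ with $N(\mathfrak p)>E_0$ we have $b_{\mathfrak p}=1$ and $D_{\mathfrak p,i}(s)\ne 0$ for all $i$ and all $s$ with $\operatorname{Re}(s)=1$. For each $i$, assume that $(s-1)\prod_{N(\mathfrak p)>E_0}D_{\mathfrak p,i}(s)$ can be holomorphically continued from $\{\operatorname{Re}(s)>1\}$ to (a neighbourhood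 of) $\{\operatorname{Re}(s)\ge 1\}$, with value $r_i$ at $s=1$. Assume moreover that there are bounded real numbers $c'_{\mathfrak p,i}\ge|c_{\mathfrak p,i}|$ such that for each $i$ the function $(s-1)\prod_{N(\mathfrak p)>E_0}\bigl(1+c'_{\mathfrak p,i}N(\mathfrak p)^{-s}\bigr)$ can also be holomorphically continued to $\{\operatorname{Re}(s)\ge 1\}$. Let $T\subseteq\{1,\dots,m\}$ and fix an integer $x_i\ge 1$ for each $i\in T$. Then there is a constant $C'\in\mathbb C$ such that, as the real numbers $X_i$ for $i\notin T$ all go to $\infty$, $$\sum_{\substack{(x_i)_{i\notin T}\\ 1\le x_i\le X_i\ \forall i\notin T}}a_{x_1,\dots,x_m}=C'\prod_{i\notin T}X_i+o\Bigl(\prod_{i\notin T}X_i\Bigr).$$ If all $b_{\mathfrak p}$ and $c_{\mathfrak p,i}$ are nonnegative real numbers, then $C'$ is a nonnegative real number; if in addition $C'=0$ and $r_1\cdots r_m\ne 0$, then the sum on the left-hand side is $0$ for all $X_i$. -/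

import Mathlib

open Filter Asymptotics IsDedekindDomain
open scoped NumberField ComplexOrder

namespace MultiDirichlet

noncomputable section

/-- The norm of a (nonzero) prime `p` of the number field `K`. -/
def primeNorm {K : Type*} [Field K] [NumberField K] (p : HeightOneSpectrum (𝓞 K)) : ℕ :=
  Ideal.absNorm p.asIdeal

/-- `∏_{p : N(p) > E} (1 + u_p N(p)^{-s})`. For bounded `u` the product converges absolutely when
`1 < re s`; only these values are used below. -/
def eulerProduct {K : Type*} [Field K] [NumberField K] (E : ℝ)
    (u : HeightOneSpectrum (𝓞 K) → ℂ) (s : ℂ) : ℂ :=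
  ∏' p : {p : HeightOneSpectrum (𝓞 K) // E < (primeNorm p : ℝ)},
    (1 + u p.1 * (primeNorm p.1 : ℂ) ^ (-s))

/-- `f`, a function on `{re s > 1}`, can be holomorphically continued to (an open neighbourhood of)
`{re s ≥ 1}`, with value `r` at `s = 1`. -/
def ContinuesWithValue (f : ℂ → ℂ) (r : ℂ) : Prop :=
  ∃ g : ℂ → ℂ, AnalyticOnNhd ℂ g {s | 1 ≤ s.re} ∧ (∀ s : ℂ, 1 < s.re → g s = f s) ∧ g 1 = r

/-- The ways to obtain the monomial `∏ x_i^{-s_i}` when multiplying out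
`∏_p (b_p + ∑_i c_{p,i} N(p)^{-s_i})`: `φ p = none` selects the summand `b_p` in the factor at `p`,
and `φ p = some i` selects the summand `c_{p,i} N(p)^{-s_i}`; all but finitely many factors
contribute `b_p`. -/
def selections (K : Type*) [Field K] [NumberField K] {m : ℕ} (x : Fin m → ℕ) :
    Set (HeightOneSpectrum (𝓞 K) → Option (Fin m)) :=
  {φ | {p | φ p ≠ none}.Finite ∧ ∀ i, ∏ᶠ p ∈ {p | φ p = some i}, primeNorm p = x i}

/-- The coefficient `a_x` of `∏ x_i^{-s_i}` in the formal expansion of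
`∏_p (b_p + ∑_i c_{p,i} N(p)^{-s_i})`, where `b_p = 1` for all but finitely many `p`. There are
only finitely many selections for each `x`, and the product of the selected coefficients has only
finitely many factors different from `1`. -/
def coeff {K : Type*} [Field K] [NumberField K] {m : ℕ} (b : HeightOneSpectrum (𝓞 K) → ℂ)
    (c : HeightOneSpectrum (𝓞 K) → Fin m → ℂ) (x : Fin m → ℕ) : ℂ :=
  ∑ᶠ φ ∈ selections K x, ∏ᶠ p, (φ p).elim (b p) (c p)

/-- The tuple indexed by `Fin m` with entries `x` on `T` and `y` off `T`. -/
def glue {m : ℕ} {T : Finset (Fin m)} (x : {i // i ∈ T} → ℕ) (y : {i // i ∉ T} → ℕ) :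
    Fin m → ℕ :=
  fun i => if h : i ∈ T then x ⟨i, h⟩ else y ⟨i, h⟩

/-- The sum of `a_x` over all integers `1 ≤ x_i ≤ X_i`, `i ∉ T`, where `x_i` is fixed for
`i ∈ T`. -/
def boundarySum {K : Type*} [Field K] [NumberField K] {m : ℕ} (b : HeightOneSpectrum (𝓞 K) → ℂ)
    (c : HeightOneSpectrum (𝓞 K) → Fin m → ℂ) {T : Finset (Fin m)} (x : {i // i ∈ T} → ℕ)
    (X : {i // i ∉ T} → ℝ) : ℂ :=
  ∑ y ∈ Fintype.piFinset (fun i => Finset.Icc 1 ⌊X i⌋₊), coeff b c (glue x y)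

end

end MultiDirichlet

/-!
The sum of the coefficients of the product over a box is compared with sums that split into
one-variable sums, whose asymptotics come from the Wiener–Ikehara theorem.

*One variable.* For a finite set `U` of primes containing those with `N(p) ≤ E₀`, the Dirichlet
series `∏_{p ∉ U} (1 + c_{p,i} N(p)^{-s})` differs from `∏_{N(p) > E₀} D_{p,i}(s)` by finitely
many factors, and those that have to be divided out do not vanish on `re s = 1`. Hence it
continues to `re s ≥ 1` apart from at most a simple pole at `1` (`exists_extendsToLine`). It is
dominated by the series with coefficients `c'`, which has the same property, so its partial sums
up to `y` are `ρ y + o(y)` (`tendsto_partialSum_div`). The proof of this Tauberian theorem smooths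
the partial sums with Fejér kernels: the smoothed sums are integrals over a segment of the line
`re s = 1`, to which the Riemann–Lebesgue lemma applies, and monotonicity, obtained by adding the
majorant, allows the smoothing to be undone.

*Several variables.* A monomial in the expansion corresponds to a tuple `(J_i)` of finite sets of
primes, `J_i` being the set of primes where the `i`-th summand is selected; the sets must be
pairwise disjoint. If disjointness is only required at the primes of a finite set `S`, then the
sum over a box is a finite linear combination, obtained by splitting off the primes of `S` one at
a time (`boxSum_insert`), of products of one-variable sums, so it has a mean value
(`exists_tendsto_boxSum_div`). The error is bounded by the sum over the tuples with a collision,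
that is, a prime `p ∉ S` lying in two of the sets. Fixing `p` costs a factor `N(p)^{-2}`, as two
coordinates are divided by `N(p)` (`collision_le`). Since `∑_p N(p)^{-2}` converges, the error is
small compared with the volume of the box once `S` is large, uniformly in the box; so the mean
value exists (`exists_tendsto_fullSum_div`). Prescribed coordinates are treated in the same way,
by letting the corner of the box tend to infinity in the other directions only.

*Positivity.* Suppose that everything is nonnegative, all `r_i` are nonzero and some coefficient
`a_z` with the prescribed coordinates does not vanish. Choose a selection contributing to `a_z`
and keep it fixed at the primes of a large finite set `S`. The primes outside `S` then contribute
at least the product of the one-variable sums over these primes, which has positive mean value,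
minus the sum over collisions outside `S`, which is at most half of it by the estimate above,
applied to the limits of the one-variable sums (`exists_tendsto_collisions`). Hence the mean value
is positive (`limit_ne_zero`).
-/

namespace MultiDirichlet

open MeasureTheory Topology

noncomputable section

/-! ### The Fejér kernel -/

section FejerKernel

/-- The Fejér kernel `2 (1 - cos v) / v²`, the Fourier transform of the triangle function
`max (1 - |t|) 0`, with its removable singularity filled in. -/
def fejer (v : ℝ) : ℝ := if v = 0 then 1 else 2 * (1 - Real.cos v) / v ^ 2

lemma fejer_nonneg (v : ℝ) : 0 ≤ fejer v := by
  unfold fejer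
  split_ifs
  · exact zero_le_one
  · have := Real.cos_le_one v
    have : 0 ≤ 1 - Real.cos v := by linarith
    positivity

lemma fejer_le (v : ℝ) : fejer v ≤ 5 * (1 + v ^ 2)⁻¹ := by
  unfold fejer
  split_ifs with h
  · simp [h]
  · have h2 : 0 < v ^ 2 := by positivity
    rw [← div_eq_mul_inv, div_le_div_iff₀ h2 (by positivity)]
    nlinarith [Real.one_sub_sq_div_two_le_cos (x := v), Real.neg_one_le_cos v]

lemma le_fejer {v : ℝ} (hv : |v| ≤ 1) : 4 / Real.pi ^ 2 ≤ fejer v := by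
  have hpi := Real.pi_gt_three
  unfold fejer
  split_ifs with h
  · rw [div_le_one (by positivity)]
    nlinarith
  · have h2 : 0 < v ^ 2 := by positivity
    rw [le_div_iff₀ h2]
    have := Real.cos_le_one_sub_mul_cos_sq (x := v) (by linarith)
    have e : 4 / Real.pi ^ 2 * v ^ 2 = 2 * (2 / Real.pi ^ 2 * v ^ 2) := by ring
    rw [e]
    linarith

lemma measurable_fejer : Measurable fejer := by
  unfold fejer
  exact Measurable.ite (measurableSet_singleton 0) measurable_const (by fun_prop)

lemma integrable_fejer : Integrable fejer := by
  refine (integrable_inv_one_add_sq.const_mul 5).mono' measurable_fejer.aestronglyMeasurable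
    (ae_of_all _ fun v => ?_)
  rw [Real.norm_of_nonneg (fejer_nonneg v)]
  exact fejer_le v

lemma integral_fejer_pos : 0 < ∫ v, fejer v := by
  have h : ∫ v in Set.Icc (-1 : ℝ) 1, (4 / Real.pi ^ 2 : ℝ) ≤ ∫ v in Set.Icc (-1 : ℝ) 1, fejer v :=
    setIntegral_mono_on (by simp) integrable_fejer.integrableOn measurableSet_Icc
      fun v hv => le_fejer (abs_le.2 hv)
  have h2 := setIntegral_le_integral (s := Set.Icc (-1 : ℝ) 1) integrable_fejer
    (ae_of_all _ fejer_nonneg)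
  refine lt_of_lt_of_le ?_ (h.trans h2)
  simp only [integral_const, MeasurableSet.univ, measureReal_restrict_apply, Set.univ_inter,
    Real.volume_real_Icc, smul_eq_mul]
  norm_num
  positivity

/-- The Fejér kernel is the Fourier transform of the triangle function; away from `v = 0` this is
read off from explicit antiderivatives on `[-1, 0]` and `[0, 1]`. -/
lemma integral_triangle_mul_exp (v : ℝ) :
    ∫ t in (-1 : ℝ)..1, ((1 - |t| : ℝ) : ℂ) * Complex.exp (Complex.I * t * v) = fejer v := by
  have hi (a b : ℝ) : IntervalIntegrable
      (fun t : ℝ => ((1 - |t| : ℝ) : ℂ) * Complex.exp (Complex.I * t * v)) volume a b :=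
    Continuous.intervalIntegrable (by fun_prop) _ _
  rw [← intervalIntegral.integral_add_adjacent_intervals (hi (-1) 0) (hi 0 1)]
  have e1 : ∫ t in (-1 : ℝ)..0, ((1 - |t| : ℝ) : ℂ) * Complex.exp (Complex.I * t * v) =
      ∫ t in (-1 : ℝ)..0, (1 + t : ℂ) * Complex.exp (Complex.I * t * v) := by
    refine intervalIntegral.integral_congr fun t ht => ?_
    rw [Set.uIcc_of_le (by norm_num)] at ht
    simp [abs_of_nonpos ht.2]
  have e2 : ∫ t in (0 : ℝ)..1, ((1 - |t| : ℝ) : ℂ) * Complex.exp (Complex.I * t * v) =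
      ∫ t in (0 : ℝ)..1, (1 - t : ℂ) * Complex.exp (Complex.I * t * v) := by
    refine intervalIntegral.integral_congr fun t ht => ?_
    rw [Set.uIcc_of_le (by norm_num)] at ht
    simp [abs_of_nonneg ht.1]
  rw [e1, e2]
  rcases eq_or_ne v 0 with rfl | hv
  · have a1 : ∫ t in (-1 : ℝ)..0, (1 + t : ℂ) = ((∫ t in (-1 : ℝ)..0, (1 + t) : ℝ) : ℂ) := by
      rw [← intervalIntegral.integral_ofReal]; simp
    have a2 : ∫ t in (0 : ℝ)..1, (1 - t : ℂ) = ((∫ t in (0 : ℝ)..1, (1 - t) : ℝ) : ℂ) := by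
      rw [← intervalIntegral.integral_ofReal]; simp
    simp only [Complex.ofReal_zero, mul_zero, Complex.exp_zero, mul_one, fejer, if_true]
    rw [a1, a2, ← Complex.ofReal_add]
    congr 1
    rw [intervalIntegral.integral_add (by simp) (by simp),
      intervalIntegral.integral_sub (by simp) (by simp)]
    norm_num [integral_id]
  have hc : Complex.I * v ≠ 0 := by simp [hv]
  set c : ℂ := Complex.I * v with hcdef
  have hexp (t : ℝ) : HasDerivAt (fun t : ℝ => Complex.exp (Complex.I * t * v))
      (c * Complex.exp (Complex.I * t * v)) t := by
    have h0 : HasDerivAt (fun t : ℂ => Complex.I * t * v) c (t : ℂ) := by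
      have := ((hasDerivAt_id (t : ℂ)).const_mul Complex.I).mul_const (v : ℂ)
      simpa [hcdef] using this
    have := (h0.cexp).comp_ofReal
    simpa [mul_comm] using this
  have hid (t : ℝ) : HasDerivAt (fun t : ℝ => (t : ℂ)) 1 t := Complex.ofRealCLM.hasDerivAt
  have i1 : ∫ t in (-1 : ℝ)..0, (1 + t : ℂ) * Complex.exp (Complex.I * t * v) = _ :=
    intervalIntegral.integral_eq_sub_of_hasDerivAt
      (f := fun t : ℝ => (1 + t : ℂ) * Complex.exp (Complex.I * t * v) / c
        - Complex.exp (Complex.I * t * v) / c ^ 2) (fun t _ => by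
        refine HasDerivAt.congr_deriv (((((hid t).const_add 1).mul (hexp t)).div_const c).sub
          ((hexp t).div_const (c ^ 2))) ?_
        field_simp
        ring) (Continuous.intervalIntegrable (by fun_prop) _ _)
  have i2 : ∫ t in (0 : ℝ)..1, (1 - t : ℂ) * Complex.exp (Complex.I * t * v) = _ :=
    intervalIntegral.integral_eq_sub_of_hasDerivAt
      (f := fun t : ℝ => (1 - t : ℂ) * Complex.exp (Complex.I * t * v) / c
        + Complex.exp (Complex.I * t * v) / c ^ 2) (fun t _ => by
        refine HasDerivAt.congr_deriv (((((hid t).const_sub 1).mul (hexp t)).div_const c).add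
          ((hexp t).div_const (c ^ 2))) ?_
        field_simp
        ring) (Continuous.intervalIntegrable (by fun_prop) _ _)
  rw [i1, i2]
  have hcos : Complex.exp (Complex.I * v) + Complex.exp (-(Complex.I * v)) =
      2 * Complex.cos v := by
    rw [Complex.two_cos, mul_comm Complex.I, neg_mul]
  have hv' : (v : ℂ) ≠ 0 := by exact_mod_cast hv
  have c2 : c ^ 2 = -(v : ℂ) ^ 2 := by rw [hcdef, mul_pow, Complex.I_sq]; ring
  simp only [fejer, hv, if_false]
  push_cast
  rw [show (2 * (1 - Complex.cos v) / (v : ℂ) ^ 2) =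
    (2 - 2 * Complex.cos v) / (v : ℂ) ^ 2 by ring, ← hcos]
  simp only [mul_neg, mul_one, neg_mul, mul_zero, zero_mul, Complex.exp_zero]
  rw [← hcdef]
  have : (v : ℂ) ^ 2 = - c ^ 2 := by rw [c2]; ring
  rw [this]
  field_simp
  ring

end FejerKernel

/-! ### Partial sums of Dirichlet series and their Laplace transform -/

section PartialSums

/-- Fubini for the Fejér kernel: smoothing `h(u) e^{-εu}` by the kernel at scale `lam⁻¹` amounts to
integrating the Laplace transform of `h` over the segment `ε + i [-lam, lam]`. -/
lemma integral_mul_fejer (h : ℝ → ℂ) (lam y ε : ℝ)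
    (hint : Integrable fun u : ℝ => h u * Complex.exp (-(ε * u))) :
    ∫ u, h u * Complex.exp (-(ε * u)) * (fejer (lam * (y - u)) : ℂ) =
      ∫ t in (-1 : ℝ)..1, ((1 - |t| : ℝ) : ℂ) * Complex.exp (Complex.I * (t * (lam * y))) *
        ∫ u, h u * Complex.exp (-((ε + Complex.I * (lam * t)) * u)) := by
  have hle : (-1 : ℝ) ≤ 1 := by norm_num
  simp only [← integral_triangle_mul_exp, intervalIntegral.integral_of_le hle,
    ← integral_const_mul]
  have htri : Integrable (fun t : ℝ => ((1 - |t| : ℝ) : ℂ))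
      (volume.restrict (Set.Ioc (-1 : ℝ) 1)) :=
    (Continuous.integrableOn_Icc (by fun_prop)).mono_set Set.Ioc_subset_Icc_self
  rw [integral_integral_swap]
  · refine integral_congr_ae (ae_of_all _ fun t => integral_congr_ae (ae_of_all _ fun u => ?_))
    simp only
    have e : Complex.exp (-((ε + Complex.I * (lam * t)) * u)) * Complex.exp
        (Complex.I * (t * (lam * y))) = Complex.exp (-(ε * u)) *
        Complex.exp (Complex.I * t * ((lam * (y - u) : ℝ) : ℂ)) := by
      rw [← Complex.exp_add, ← Complex.exp_add]
      congr 1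
      push_cast
      ring
    linear_combination -(h u * ((1 - |t| : ℝ) : ℂ)) * e
  · have := (hint.mul_prod htri).mul_bdd (c := 1)
      (g := fun z : ℝ × ℝ => Complex.exp (Complex.I * z.2 * ((lam * (y - z.1) : ℝ) : ℂ)))
      (Continuous.aestronglyMeasurable (by fun_prop)) (ae_of_all _ fun z => by
        rw [mul_assoc, ← Complex.ofReal_mul, mul_comm, Complex.norm_exp_ofReal_mul_I])
    refine this.congr (ae_of_all _ fun z => ?_)
    simp only [Function.uncurry]
    ring

/-- The sum of the coefficients of the generalized Dirichlet series `∑ w_i n_i^{-s}` over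
`n_i ≤ y`. -/
def partialSum {ι E : Type*} [NormedAddCommGroup E] (w : ι → E) (n : ι → ℝ) (y : ℝ) : E :=
  ∑' i, if n i ≤ y then w i else 0

/-- The sum of the generalized Dirichlet series `∑ w_i n_i^{-s}`. -/
def dirichletSum {ι : Type*} (w : ι → ℂ) (n : ι → ℝ) (s : ℂ) : ℂ := ∑' i, w i * (n i : ℂ) ^ (-s)

variable {ι : Type*} {w : ι → ℂ} {w' : ι → ℝ} {n : ι → ℝ}

lemma summable_ite_le {w' : ι → ℝ} (hn : ∀ i, 1 ≤ n i) (hw' : ∀ i, 0 ≤ w' i)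
    (hs : ∀ σ : ℝ, 1 < σ → Summable fun i => w' i * n i ^ (-σ)) (y : ℝ) :
    Summable fun i => if n i ≤ y then w' i else 0 := by
  refine ((hs 2 (by norm_num)).mul_left (y ^ (2 : ℝ))).of_nonneg_of_le
    (fun i => by split_ifs <;> simp [hw']) fun i => ?_
  have h0 : 0 < n i := lt_of_lt_of_le one_pos (hn i)
  split_ifs with h
  · have : 1 ≤ y ^ (2 : ℝ) * n i ^ (-(2 : ℝ)) := by
      rw [Real.rpow_neg h0.le, ← div_eq_mul_inv, one_le_div (by positivity)]
      exact Real.rpow_le_rpow h0.le h (by norm_num)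
    nlinarith [hw' i]
  · have : 0 ≤ y ^ (2 : ℝ) := by rw [Real.rpow_two]; positivity
    have := hw' i
    positivity

lemma partialSum_le_rpow (hn : ∀ i, 1 ≤ n i) (hw' : ∀ i, 0 ≤ w' i)
    (hs : ∀ σ : ℝ, 1 < σ → Summable fun i => w' i * n i ^ (-σ)) {σ : ℝ} (hσ : 1 < σ) {y : ℝ}
    (hy : 0 ≤ y) : partialSum w' n y ≤ y ^ σ * ∑' i, w' i * n i ^ (-σ) := by
  rw [← tsum_mul_left]
  refine (summable_ite_le hn hw' hs y).tsum_le_tsum (fun i => ?_) ((hs σ hσ).mul_left _)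
  have h0 : 0 < n i := lt_of_lt_of_le one_pos (hn i)
  split_ifs with h
  · have : 1 ≤ y ^ σ * n i ^ (-σ) := by
      rw [Real.rpow_neg h0.le, ← div_eq_mul_inv, one_le_div (by positivity)]
      exact Real.rpow_le_rpow h0.le h (by linarith)
    nlinarith [hw' i]
  · have := hw' i
    positivity

lemma partialSum_eq_zero {E : Type*} [NormedAddCommGroup E] {w : ι → E} (hn : ∀ i, 1 ≤ n i)
    {y : ℝ} (hy : y < 1) : partialSum w n y = 0 := by
  simp [partialSum, fun i => not_le.2 (hy.trans_le (hn i))]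

lemma partialSum_nonneg (hw' : ∀ i, 0 ≤ w' i) (y : ℝ) : 0 ≤ partialSum w' n y :=
  tsum_nonneg fun i => by split_ifs <;> simp [hw']

lemma partialSum_mono (hn : ∀ i, 1 ≤ n i) (hw' : ∀ i, 0 ≤ w' i)
    (hs : ∀ σ : ℝ, 1 < σ → Summable fun i => w' i * n i ^ (-σ)) : Monotone (partialSum w' n) := by
  intro y z hyz
  refine (summable_ite_le hn hw' hs y).tsum_le_tsum (fun i => ?_) (summable_ite_le hn hw' hs z)
  split_ifs with h1 h2
  · rfl
  · exact absurd (h1.trans hyz) h2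
  · exact hw' i
  · rfl

lemma summable_ite_le_of_norm_le (hn : ∀ i, 1 ≤ n i) (hw : ∀ i, ‖w i‖ ≤ w' i)
    (hs : ∀ σ : ℝ, 1 < σ → Summable fun i => w' i * n i ^ (-σ)) (y : ℝ) :
    Summable fun i => if n i ≤ y then w i else 0 :=
  (summable_ite_le hn (fun i => (norm_nonneg _).trans (hw i)) hs y).of_norm_bounded
    fun i => by split_ifs <;> simp [hw]

lemma norm_partialSum_le (hn : ∀ i, 1 ≤ n i) (hw : ∀ i, ‖w i‖ ≤ w' i)
    (hs : ∀ σ : ℝ, 1 < σ → Summable fun i => w' i * n i ^ (-σ)) (y : ℝ) :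
    ‖partialSum w n y‖ ≤ partialSum w' n y :=
  tsum_of_norm_bounded
    (summable_ite_le hn (fun i => (norm_nonneg _).trans (hw i)) hs y).hasSum
    fun i => by split_ifs <;> simp [hw]

lemma measurable_partialSum [Countable ι] (hn : ∀ i, 1 ≤ n i) (hw : ∀ i, ‖w i‖ ≤ w' i)
    (hs : ∀ σ : ℝ, 1 < σ → Summable fun i => w' i * n i ^ (-σ)) :
    Measurable (partialSum w n) := by
  refine measurable_of_tendsto_metrizable' (u := (atTop : Filter (Finset ι)))
    (f := fun s y => ∑ i ∈ s, if n i ≤ y then w i else 0) (fun s => ?_) ?_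
  · exact Finset.measurable_fun_sum s fun i _ =>
      Measurable.ite measurableSet_Ici measurable_const measurable_const
  · rw [tendsto_pi_nhds]
    exact fun y => (summable_ite_le_of_norm_le hn hw hs y).hasSum

/-- The partial sums of a generalized Dirichlet series up to `e^u`, divided by `e^u`. -/
def normalizedSum {ι : Type*} (w : ι → ℂ) (n : ι → ℝ) (u : ℝ) : ℂ :=
  partialSum w n (Real.exp u) * Complex.exp (-u)

lemma measurable_normalizedSum [Countable ι] (hn : ∀ i, 1 ≤ n i) (hw : ∀ i, ‖w i‖ ≤ w' i)
    (hs : ∀ σ : ℝ, 1 < σ → Summable fun i => w' i * n i ^ (-σ)) :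
    Measurable (normalizedSum w n) :=
  ((measurable_partialSum hn hw hs).comp Real.measurable_exp).mul (by fun_prop)

lemma norm_normalizedSum_le (hn : ∀ i, 1 ≤ n i) (hw : ∀ i, ‖w i‖ ≤ w' i)
    (hs : ∀ σ : ℝ, 1 < σ → Summable fun i => w' i * n i ^ (-σ)) (u : ℝ) :
    ‖normalizedSum w n u‖ ≤ partialSum w' n (Real.exp u) * Real.exp (-u) := by
  rw [normalizedSum, norm_mul, Complex.norm_exp]
  simp only [Complex.neg_re, Complex.ofReal_re]
  exact mul_le_mul_of_nonneg_right (norm_partialSum_le hn hw hs _) (Real.exp_nonneg _)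

lemma integrable_indicator_exp {a : ℝ} {z : ℂ} (hz : 0 < z.re) :
    Integrable ((Set.Ici a).indicator fun u : ℝ => Complex.exp (-(z * u))) := by
  rw [integrable_indicator_iff measurableSet_Ici, integrableOn_Ici_iff_integrableOn_Ioi]
  have := integrableOn_exp_mul_complex_Ioi (a := -z) (by simpa using hz) a
  simpa only [neg_mul] using this

lemma integral_indicator_exp {a : ℝ} {z : ℂ} (hz : 0 < z.re) :
    ∫ u, (Set.Ici a).indicator (fun u : ℝ => Complex.exp (-(z * u))) u =
      Complex.exp (-(z * a)) / z := by
  rw [integral_indicator measurableSet_Ici, integral_Ici_eq_integral_Ioi]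
  have := integral_exp_mul_complex_Ioi (a := -z) (by simpa using hz) a
  simpa only [neg_mul, neg_div_neg_eq] using this

/-- An integrable majorant: the partial sums up to `e^u` vanish for `u < 0` and are at most a
constant times `e^{(1 + ε/2) u}` for `u ≥ 0`. -/
lemma norm_normalizedSum_mul_exp_le (hn : ∀ i, 1 ≤ n i) (hw : ∀ i, ‖w i‖ ≤ w' i)
    (hs : ∀ σ : ℝ, 1 < σ → Summable fun i => w' i * n i ^ (-σ)) {ε : ℝ} (hε : 0 < ε) (u : ℝ) :
    ‖normalizedSum w n u * Complex.exp (-(ε * u))‖ ≤ (∑' i, w' i * n i ^ (-(1 + ε / 2))) *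
      ‖(Set.Ici (0 : ℝ)).indicator (fun u : ℝ => Complex.exp (-((ε / 2 : ℝ) * u))) u‖ := by
  have hw' i : 0 ≤ w' i := (norm_nonneg _).trans (hw i)
  rw [norm_mul, Complex.norm_exp]
  rcases lt_or_ge u 0 with hu | hu
  · have h0 := norm_normalizedSum_le hn hw hs u
    rw [partialSum_eq_zero hn ((by simpa using hu)), zero_mul] at h0
    have h1 := le_antisymm h0 (norm_nonneg _)
    rw [h1]
    simp [hu]
  · have h1 := (norm_normalizedSum_le hn hw hs u).trans (mul_le_mul_of_nonneg_right
      (partialSum_le_rpow hn hw' hs (σ := 1 + ε / 2) (by linarith) (Real.exp_nonneg u))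
      (Real.exp_nonneg _))
    rw [Set.indicator_of_mem (by simpa using hu), Complex.norm_exp]
    refine (mul_le_mul_of_nonneg_right h1 (Real.exp_nonneg _)).trans (le_of_eq ?_)
    rw [← Real.exp_mul, mul_comm (Real.exp _), mul_assoc, mul_assoc, ← Real.exp_add,
      ← Real.exp_add]
    congr 2
    rw [← Complex.ofReal_mul, ← Complex.ofReal_mul, ← Complex.ofReal_neg, ← Complex.ofReal_neg,
      Complex.ofReal_re, Complex.ofReal_re]
    ring

lemma integrable_normalizedSum [Countable ι] (hn : ∀ i, 1 ≤ n i) (hw : ∀ i, ‖w i‖ ≤ w' i)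
    (hs : ∀ σ : ℝ, 1 < σ → Summable fun i => w' i * n i ^ (-σ)) {ε : ℝ} (hε : 0 < ε) :
    Integrable fun u : ℝ => normalizedSum w n u * Complex.exp (-(ε * u)) := by
  refine ((integrable_indicator_exp (a := 0) (z := ((ε / 2 : ℝ) : ℂ))
    (by simpa using half_pos hε)).norm.const_mul _).mono' ?_
    (ae_of_all _ (norm_normalizedSum_mul_exp_le hn hw hs hε))
  exact ((measurable_normalizedSum hn hw hs).mul (by fun_prop)).aestronglyMeasurable

/-- The Laplace transform of the normalized partial sums of a Dirichlet series `F` is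
`F(1 + z) / (1 + z)`. -/
lemma integral_normalizedSum [Countable ι] (hn : ∀ i, 1 ≤ n i) (hw : ∀ i, ‖w i‖ ≤ w' i)
    (hs : ∀ σ : ℝ, 1 < σ → Summable fun i => w' i * n i ^ (-σ)) {z : ℂ} (hz : 0 < z.re) :
    ∫ u : ℝ, normalizedSum w n u * Complex.exp (-(z * u)) = dirichletSum w n (1 + z) / (1 + z) := by
  have hz1 : 0 < (1 + z).re := by simp; linarith
  have h0 i : 0 < n i := lt_of_lt_of_le one_pos (hn i)
  set F : ι → ℝ → ℂ := fun i u =>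
    w i * (Set.Ici (Real.log (n i))).indicator (fun u : ℝ => Complex.exp (-((1 + z) * u))) u
  have hF : ∀ i, Integrable (F i) := fun i => (integrable_indicator_exp hz1).const_mul _
  have hnorm : ∀ i, ∫ u, ‖F i u‖ = ‖w i‖ * n i ^ (-(1 + z.re)) / (1 + z.re) := fun i => by
    simp only [F, norm_mul, integral_const_mul, mul_div_assoc]
    congr 1
    have h1 := integral_indicator_exp (a := Real.log (n i)) (z := ((1 + z.re : ℝ) : ℂ))
      (by simp; linarith)
    have h2 : ∀ u : ℝ, (Set.Ici (Real.log (n i))).indicator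
        (fun u : ℝ => Complex.exp (-(((1 + z.re : ℝ) : ℂ) * u))) u =
        ((‖(Set.Ici (Real.log (n i))).indicator
          (fun u : ℝ => Complex.exp (-((1 + z) * u))) u‖ : ℝ) : ℂ) := fun u => by
      by_cases hu : u ∈ Set.Ici (Real.log (n i))
      · rw [Set.indicator_of_mem hu, Set.indicator_of_mem hu, Complex.norm_exp,
          Complex.ofReal_exp]
        congr 1
        simp
      · rw [Set.indicator_of_notMem hu, Set.indicator_of_notMem hu]; simp
    simp only [h2] at h1
    rw [integral_complex_ofReal] at h1
    rw [← Complex.ofReal_inj, h1, Real.rpow_def_of_pos (h0 i)]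
    push_cast
    ring_nf
  have hsum : Summable fun i => ∫ u, ‖F i u‖ := by
    simp only [hnorm]
    refine Summable.div_const ((hs (1 + z.re) (by linarith)).of_nonneg_of_le
      (fun i => mul_nonneg (norm_nonneg _) (Real.rpow_nonneg (h0 i).le _)) fun i => ?_) _
    exact mul_le_mul_of_nonneg_right (hw i) (Real.rpow_nonneg (h0 i).le _)
  have := integral_tsum_of_summable_integral_norm hF hsum
  have hterm : ∀ i, ∫ u, F i u = w i * (n i : ℂ) ^ (-(1 + z)) / (1 + z) := fun i => by
    simp only [F, integral_const_mul, integral_indicator_exp hz1, mul_div_assoc]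
    rw [Complex.cpow_def_of_ne_zero (by exact_mod_cast (h0 i).ne'), Complex.ofReal_log (h0 i).le]
    ring_nf
  simp only [hterm] at this
  rw [dirichletSum, ← tsum_div_const, this]
  refine integral_congr_ae (ae_of_all _ fun u => ?_)
  simp only [normalizedSum, partialSum, F]
  rw [mul_assoc, ← Complex.exp_add, ← tsum_mul_right]
  refine tsum_congr fun i => ?_
  have : n i ≤ Real.exp u ↔ u ∈ Set.Ici (Real.log (n i)) := by
    rw [Set.mem_Ici, Real.log_le_iff_le_exp (h0 i)]
  by_cases hu : u ∈ Set.Ici (Real.log (n i))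
  · rw [if_pos (this.2 hu), Set.indicator_of_mem hu]
    congr 2
    ring
  · rw [if_neg (fun h => hu (this.1 h)), Set.indicator_of_notMem hu]
    simp

end PartialSums

/-! ### Fejér smoothing and linear growth -/

section FejerSmoothing

lemma integrable_fejer_comp {lam : ℝ} (hlam : 0 < lam) (y : ℝ) :
    Integrable fun u => fejer (lam * (y - u)) :=
  (integrable_fejer.comp_mul_left' hlam.ne').comp_sub_left y

lemma integral_fejer_comp {lam : ℝ} (hlam : 0 < lam) (y : ℝ) :
    ∫ u, fejer (lam * (y - u)) = (∫ v, fejer v) / lam := by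
  rw [integral_sub_left_eq_self (fun v => fejer (lam * v)) volume y,
    Measure.integral_comp_mul_left fejer lam, abs_of_pos (by positivity), smul_eq_mul]
  ring

/-- `g` extends `F(s)/s - ρ/(s-1)`, where `F` is the sum of a Dirichlet series, continuously to the
line `re s = 1`. Agreement on `1 < re s` is only required near that line. -/
def ExtendsToLine {ι : Type*} (w : ι → ℂ) (n : ι → ℝ) (ρ : ℂ) (g : ℂ → ℂ) : Prop :=
  ∀ s : ℂ, s.re = 1 → ContinuousAt g s ∧
    ∀ᶠ z in 𝓝 s, 1 < z.re → g z = dirichletSum w n z / z - ρ / (z - 1)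

/-- The difference of the normalized partial sums and their expected limit `ρ`, on `u ≥ 0`. -/
def deviation {ι : Type*} (w : ι → ℂ) (n : ι → ℝ) (ρ : ℂ) (u : ℝ) : ℂ :=
  normalizedSum w n u - (Set.Ici (0 : ℝ)).indicator (fun _ => ρ) u

variable {ι : Type*} {w : ι → ℂ} {w' : ι → ℝ} {n : ι → ℝ} {ρ : ℂ} {g : ℂ → ℂ}

lemma integrable_deviation [Countable ι] (hn : ∀ i, 1 ≤ n i) (hw : ∀ i, ‖w i‖ ≤ w' i)
    (hs : ∀ σ : ℝ, 1 < σ → Summable fun i => w' i * n i ^ (-σ)) {ε : ℝ} (hε : 0 < ε) :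
    Integrable fun u : ℝ => deviation w n ρ u * Complex.exp (-(ε * u)) := by
  refine ((integrable_normalizedSum hn hw hs hε).sub ((integrable_indicator_exp (a := 0)
    (z := (ε : ℂ)) (by simpa using hε)).const_mul ρ)).congr (ae_of_all _ fun u => ?_)
  by_cases hu : u ∈ Set.Ici (0 : ℝ)
  · simp only [deviation, Pi.sub_apply, Set.indicator_of_mem hu]; ring
  · simp only [deviation, Pi.sub_apply, Set.indicator_of_notMem hu]; ring

lemma integral_deviation [Countable ι] (hn : ∀ i, 1 ≤ n i) (hw : ∀ i, ‖w i‖ ≤ w' i)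
    (hs : ∀ σ : ℝ, 1 < σ → Summable fun i => w' i * n i ^ (-σ)) {z : ℂ} (hz : 0 < z.re) :
    ∫ u : ℝ, deviation w n ρ u * Complex.exp (-(z * u)) =
      dirichletSum w n (1 + z) / (1 + z) - ρ / z := by
  have h1 : Integrable fun u : ℝ => normalizedSum w n u * Complex.exp (-(z * u)) := by
    refine (integrable_normalizedSum hn hw hs hz).mono
      (((measurable_normalizedSum hn hw hs).mul (by fun_prop)).aestronglyMeasurable)
      (ae_of_all _ fun u => ?_)
    simp [Complex.norm_exp]
  have h2 := (integrable_indicator_exp (a := 0) hz).const_mul ρ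
  rw [← integral_normalizedSum hn hw hs hz, show ρ / z = ρ * (Complex.exp (-(z * (0 : ℝ))) / z) by
    simp [div_eq_mul_inv], ← integral_indicator_exp hz, ← integral_const_mul, ← integral_sub h1 h2]
  refine integral_congr_ae (ae_of_all _ fun u => ?_)
  by_cases hu : u ∈ Set.Ici (0 : ℝ)
  · simp only [deviation, Set.indicator_of_mem hu]; ring
  · simp only [deviation, Set.indicator_of_notMem hu]; ring

/-- Near the segment `1 + i [-lam, lam]` the function `g` is bounded and, to the right of it,
given by the Dirichlet series; compactness of the segment makes both uniform. -/
lemma ExtendsToLine.eventually_segment (hg : ExtendsToLine w n ρ g) (lam : ℝ) :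
    ∃ M : ℝ, (∀ t ∈ Set.Icc (-1 : ℝ) 1, ‖g (1 + Complex.I * (lam * t))‖ ≤ M) ∧
    ∀ᶠ ε : ℝ in 𝓝[>] 0, ∀ t ∈ Set.Icc (-1 : ℝ) 1,
      ‖g (1 + (ε + Complex.I * (lam * t)))‖ ≤ M ∧
      dirichletSum w n (1 + (ε + Complex.I * (lam * t))) / (1 + (ε + Complex.I * (lam * t))) -
        ρ / (ε + Complex.I * (lam * t)) = g (1 + (ε + Complex.I * (lam * t))) := by
  have hre (t : ℝ) : (1 + Complex.I * (lam * t) : ℂ).re = 1 := by simp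
  have hcont : ContinuousOn (fun t : ℝ => g (1 + Complex.I * (lam * t))) (Set.Icc (-1) 1) :=
    fun t _ => ContinuousAt.continuousWithinAt
      (ContinuousAt.comp (f := fun t : ℝ => (1 + Complex.I * (lam * t) : ℂ)) (g := g)
        (hg _ (hre t)).1 (by fun_prop))
  obtain ⟨M, hM⟩ := isCompact_Icc.exists_bound_of_continuousOn hcont
  refine ⟨M + 1, fun t ht => (hM t ht).trans (by linarith), ?_⟩
  have key : ∀ᶠ ε : ℝ in 𝓝 0, ∀ t ∈ Set.Icc (-1 : ℝ) 1,
      ‖g (1 + (ε + Complex.I * (lam * t)))‖ ≤ M + 1 ∧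
        (1 < (1 + (ε + Complex.I * (lam * t)) : ℂ).re → g (1 + (ε + Complex.I * (lam * t))) =
          dirichletSum w n (1 + (ε + Complex.I * (lam * t))) /
        (1 + (ε + Complex.I * (lam * t))) - ρ / (1 + (ε + Complex.I * (lam * t)) - 1)) := by
    refine isCompact_Icc.eventually_forall_of_forall_eventually (P := fun (ε t : ℝ) =>
      ‖g (1 + (ε + Complex.I * (lam * t)))‖ ≤ M + 1 ∧
        (1 < (1 + (ε + Complex.I * (lam * t)) : ℂ).re → g (1 + (ε + Complex.I * (lam * t))) =
          dirichletSum w n (1 + (ε + Complex.I * (lam * t))) /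
        (1 + (ε + Complex.I * (lam * t))) - ρ / (1 + (ε + Complex.I * (lam * t)) - 1)))
      fun t ht => ?_
    have hc : ContinuousAt (fun z : ℝ × ℝ => (1 + (z.1 + Complex.I * (lam * z.2)) : ℂ)) (0, t) := by
      fun_prop
    have hz : (1 + (((0 : ℝ), t).1 + Complex.I * (lam * ((0 : ℝ), t).2)) : ℂ) =
      1 + Complex.I * (lam * t) := by simp
    have h := hg _ (hre t)
    rw [← hz] at h
    have h1 := hc.eventually (h.1.norm.eventually (eventually_lt_nhds (b := M + 1) (by
      rw [hz]; linarith [hM t ht])))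
    filter_upwards [h1, hc.eventually h.2] with z hz1 hz2 using ⟨hz1.le, hz2⟩
  filter_upwards [key.filter_mono nhdsWithin_le_nhds, self_mem_nhdsWithin] with ε hε hpos t ht
  refine ⟨(hε t ht).1, ?_⟩
  rw [(hε t ht).2 (by simpa using hpos), add_sub_cancel_left]

/-- Smoothing the deviation, damped by `e^{-εu}`, is an integral of `g` over a segment of the line
`re s = 1 + ε`. -/
lemma integral_deviation_mul_fejer [Countable ι] (hn : ∀ i, 1 ≤ n i) (hw : ∀ i, ‖w i‖ ≤ w' i)
    (hs : ∀ σ : ℝ, 1 < σ → Summable fun i => w' i * n i ^ (-σ)) (hg : ExtendsToLine w n ρ g)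
    (lam : ℝ) :
    ∀ᶠ ε : ℝ in 𝓝[>] 0, ∀ y : ℝ,
      ∫ u, deviation w n ρ u * Complex.exp (-(ε * u)) * (fejer (lam * (y - u)) : ℂ) =
      ∫ t in (-1 : ℝ)..1, ((1 - |t| : ℝ) : ℂ) * Complex.exp (Complex.I * (t * (lam * y))) *
        g (1 + (ε + Complex.I * (lam * t))) := by
  obtain ⟨M, -, hM⟩ := hg.eventually_segment lam
  filter_upwards [hM, self_mem_nhdsWithin] with ε hε hpos y
  rw [integral_mul_fejer _ _ _ _ (integrable_deviation hn hw hs hpos)]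
  refine intervalIntegral.integral_congr fun t ht => ?_
  rw [Set.uIcc_of_le (by norm_num)] at ht
  rw [integral_deviation hn hw hs (by simpa using hpos), (hε t ht).2]

lemma norm_triangle_mul_le {t : ℝ} (ht : t ∈ Set.Icc (-1 : ℝ) 1) (x : ℝ) {z : ℂ} {M : ℝ}
    (hz : ‖z‖ ≤ M) : ‖((1 - |t| : ℝ) : ℂ) * Complex.exp (Complex.I * (t * x)) * z‖ ≤ M := by
  rw [norm_mul, norm_mul, ← Complex.ofReal_mul, mul_comm Complex.I, Complex.norm_exp_ofReal_mul_I,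
    mul_one, Complex.norm_real, Real.norm_eq_abs]
  have h1 := abs_le.2 ht
  have h2 : |(1 - |t|)| ≤ 1 := by rw [abs_le]; constructor <;> linarith [abs_nonneg t]
  calc |(1 - |t|)| * ‖z‖ ≤ 1 * ‖z‖ := by gcongr
    _ ≤ M := by simpa using hz

/-- Nonnegative coefficients whose Dirichlet series extends to the line `re s = 1`, apart from a
pole at `1`, have partial sums of at most linear growth. -/
lemma exists_bound_of_extendsToLine [Countable ι] (hn : ∀ i, 1 ≤ n i) (hw' : ∀ i, 0 ≤ w' i)
    (hs : ∀ σ : ℝ, 1 < σ → Summable fun i => w' i * n i ^ (-σ))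
    (hg : ExtendsToLine (fun i => (w' i : ℂ)) n ρ g) :
    ∃ M : ℝ, ∀ u : ℝ, partialSum w' n (Real.exp u) * Real.exp (-u) ≤ M := by
  have hw : ∀ i, ‖(w' i : ℂ)‖ ≤ w' i := fun i => by simp [abs_of_nonneg (hw' i)]
  obtain ⟨M, -, hM⟩ := hg.eventually_segment 1
  set f : ℝ → ℝ := fun u => partialSum w' n (Real.exp u) * Real.exp (-u) with hf
  have hf0 : ∀ u, 0 ≤ f u := fun u =>
    mul_nonneg (partialSum_nonneg hw' _) (Real.exp_nonneg _)
  have hfc : ∀ u, normalizedSum (fun i => (w' i : ℂ)) n u = (f u : ℂ) := fun u => by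
    simp only [normalizedSum, hf, partialSum]
    push_cast
    congr 1
    exact tsum_congr fun i => by split_ifs <;> simp
  set I := ∫ v, fejer v with hI
  set κ := 4 / Real.pi ^ 2 with hκ
  have hκ0 : 0 < κ := by positivity
  refine ⟨(2 * M + ‖ρ‖ * I) / (Real.exp (-1) * κ), fun y => ?_⟩
  rw [le_div_iff₀ (by positivity)]
  have ev : ∀ᶠ ε : ℝ in 𝓝[>] 0,
      f y * Real.exp (-1) * Real.exp (-(ε * (|y| + 1))) * κ ≤ 2 * M + ‖ρ‖ * I := by
    filter_upwards [hM, integral_deviation_mul_fejer hn hw hs hg 1, self_mem_nhdsWithin]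
      with ε hε hint (hpos : 0 < ε)
    have hint1 : Integrable fun u : ℝ => (f u * Real.exp (-(ε * u))) * fejer (1 * (y - u)) := by
      have h1 : Integrable fun u : ℝ => f u * Real.exp (-(ε * u)) := by
        have := (integrable_normalizedSum hn hw hs hpos).norm
        refine this.congr (ae_of_all _ fun u => ?_)
        simp only [hfc, norm_mul, Complex.norm_real, Real.norm_of_nonneg (hf0 u), Complex.norm_exp]
        simp
      refine h1.mul_bdd (c := 5) (measurable_fejer.comp (by fun_prop)).aestronglyMeasurable
        (ae_of_all _ fun u => ?_)
      rw [Real.norm_of_nonneg (fejer_nonneg _)]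
      refine (fejer_le _).trans (mul_le_of_le_one_right (by norm_num) (inv_le_one_of_one_le₀ ?_))
      nlinarith [sq_nonneg (1 * (y - u))]
    have hpt : ∀ u : ℝ, ‖(Set.Ici (0 : ℝ)).indicator (fun _ => ρ) u * Complex.exp (-(ε * u)) *
        (fejer (1 * (y - u)) : ℂ)‖ ≤ ‖ρ‖ * fejer (1 * (y - u)) := fun u => by
      rw [norm_mul, Complex.norm_real, Real.norm_of_nonneg (fejer_nonneg _)]
      refine mul_le_mul_of_nonneg_right ?_ (fejer_nonneg _)
      by_cases hu : u ∈ Set.Ici (0 : ℝ)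
      · rw [norm_mul, Set.indicator_of_mem hu, Complex.norm_exp]
        refine mul_le_of_le_one_right (norm_nonneg _) (Real.exp_le_one_iff.2 ?_)
        have : 0 ≤ ε * u := mul_nonneg hpos.le hu
        simpa using this
      · rw [Set.indicator_of_notMem hu]; simp
    have hint2 : Integrable fun u : ℝ =>
        (Set.Ici (0 : ℝ)).indicator (fun _ => ρ) u * Complex.exp (-(ε * u)) *
          (fejer (1 * (y - u)) : ℂ) :=
      ((integrable_fejer_comp one_pos y).const_mul ‖ρ‖).mono'
        (((measurable_const.indicator measurableSet_Ici).mul (by fun_prop)).mul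
          (Complex.measurable_ofReal.comp (measurable_fejer.comp
            (by fun_prop)))).aestronglyMeasurable (ae_of_all _ hpt)
    have hb2 : ‖∫ u : ℝ, (Set.Ici (0 : ℝ)).indicator (fun _ => ρ) u * Complex.exp (-(ε * u)) *
          (fejer (1 * (y - u)) : ℂ)‖ ≤ ‖ρ‖ * I := by
      have : ‖ρ‖ * I = ∫ u, ‖ρ‖ * fejer (1 * (y - u)) := by
        rw [integral_const_mul, integral_fejer_comp one_pos, div_one]
      rw [this]
      exact norm_integral_le_of_norm_le ((integrable_fejer_comp one_pos y).const_mul _)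
        (ae_of_all _ hpt)
    have hb1 : ‖∫ u : ℝ, deviation (fun i => (w' i : ℂ)) n ρ u * Complex.exp (-(ε * u)) *
          (fejer (1 * (y - u)) : ℂ)‖ ≤ 2 * M := by
      have := hint y
      simp only [Complex.ofReal_one] at this hε
      rw [this]
      have h3 := intervalIntegral.norm_integral_le_of_norm_le_const (a := (-1 : ℝ)) (b := 1)
        (C := M) (f := fun t : ℝ => ((1 - |t| : ℝ) : ℂ) *
          Complex.exp (Complex.I * (t * (1 * y))) * g (1 + (ε + Complex.I * (1 * t))))
        (fun t ht => by
          rw [Set.uIoc_of_le (by norm_num)] at ht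
          have h4 := Set.Ioc_subset_Icc_self ht
          have := norm_triangle_mul_le h4 (1 * y) (hε t h4).1
          simpa using this)
      refine h3.trans (le_of_eq ?_)
      norm_num [mul_comm]
    have hsplit : ((∫ u, (f u * Real.exp (-(ε * u))) * fejer (1 * (y - u)) : ℝ) : ℂ) =
        (∫ u : ℝ, deviation (fun i => (w' i : ℂ)) n ρ u * Complex.exp (-(ε * u)) *
          (fejer (1 * (y - u)) : ℂ)) +
        ∫ u : ℝ, (Set.Ici (0 : ℝ)).indicator (fun _ => ρ) u * Complex.exp (-(ε * u)) *
          (fejer (1 * (y - u)) : ℂ) := by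
      have e : ∀ u : ℝ, deviation (fun i => (w' i : ℂ)) n ρ u * Complex.exp (-(ε * u)) *
          (fejer (1 * (y - u)) : ℂ) =
          (((f u * Real.exp (-(ε * u))) * fejer (1 * (y - u)) : ℝ) : ℂ) -
          (Set.Ici (0 : ℝ)).indicator (fun _ => ρ) u * Complex.exp (-(ε * u)) *
          (fejer (1 * (y - u)) : ℂ) := fun u => by
        rw [deviation, hfc]
        push_cast
        ring
      have hint1c : Integrable fun u : ℝ =>
        (((f u * Real.exp (-(ε * u))) * fejer (1 * (y - u)) : ℝ) : ℂ) := hint1.ofReal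
      simp only [e]
      rw [integral_sub hint1c hint2, sub_add_cancel, integral_complex_ofReal]
    have hle : (∫ u, (f u * Real.exp (-(ε * u))) * fejer (1 * (y - u))) ≤ 2 * M + ‖ρ‖ * I := by
      have h5 := (norm_add_le _ _).trans (add_le_add hb1 hb2)
      rw [← hsplit, Complex.norm_real] at h5
      exact (le_abs_self _).trans h5
    refine le_trans ?_ hle
    -- on `[y, y + 1]` the integrand is bounded below, by monotonicity of the partial sums
    have h6 : ∫ u in Set.Icc y (y + 1), f y * Real.exp (-1) * Real.exp (-(ε * (|y| + 1))) * κ ≤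
        ∫ u in Set.Icc y (y + 1), (f u * Real.exp (-(ε * u))) * fejer (1 * (y - u)) := by
      refine setIntegral_mono_on continuous_const.integrableOn_Icc hint1.integrableOn
        measurableSet_Icc fun u hu => ?_
      have h7 : f y * Real.exp (-1) ≤ f u := by
        simp only [hf]
        rw [mul_assoc, ← Real.exp_add]
        exact mul_le_mul (partialSum_mono hn hw' hs (Real.exp_le_exp.2 hu.1))
          (Real.exp_le_exp.2 (by linarith [hu.2])) (Real.exp_nonneg _) (partialSum_nonneg hw' _)
      have h8 : Real.exp (-(ε * (|y| + 1))) ≤ Real.exp (-(ε * u)) := by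
        refine Real.exp_le_exp.2 (neg_le_neg (mul_le_mul_of_nonneg_left ?_ hpos.le))
        linarith [hu.2, le_abs_self y]
      have h9 : κ ≤ fejer (1 * (y - u)) := le_fejer (by
        rw [one_mul, abs_le]; constructor <;> linarith [hu.1, hu.2])
      have := hf0 u
      gcongr
    refine le_trans ?_ (h6.trans (setIntegral_le_integral hint1 (ae_of_all _ fun u =>
      mul_nonneg (mul_nonneg (hf0 u) (Real.exp_nonneg _)) (fejer_nonneg _))))
    simp
  refine le_of_tendsto (x := 𝓝[>] (0 : ℝ)) ?_ ev
  refine Tendsto.mono_left ?_ nhdsWithin_le_nhds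
  have : ContinuousAt (fun ε : ℝ => f y * Real.exp (-1) * Real.exp (-(ε * (|y| + 1))) * κ) 0 := by
    fun_prop
  have h := this.tendsto
  simp only [zero_mul, neg_zero, Real.exp_zero, mul_one] at h
  convert h using 2
  ring

end FejerSmoothing

/-! ### Behaviour on the line, and removing the smoothing -/

section LineOfConvergence

section Limit

variable {ι : Type*} {w : ι → ℂ} {w' : ι → ℝ} {n : ι → ℝ} {ρ : ℂ} {g : ℂ → ℂ}

lemma norm_deviation_le {M : ℝ} (hM : ∀ u, ‖normalizedSum w n u‖ ≤ M) (u : ℝ) :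
    ‖deviation w n ρ u‖ ≤ M + ‖ρ‖ :=
  (norm_sub_le _ _).trans (add_le_add (hM u) (norm_indicator_le_norm_self _ _))

lemma deviation_of_neg (hn : ∀ i, 1 ≤ n i) {u : ℝ} (hu : u < 0) : deviation w n ρ u = 0 := by
  simp [deviation, normalizedSum, partialSum_eq_zero hn (y := Real.exp u) (by simpa using hu), hu]

lemma measurable_deviation [Countable ι] (hn : ∀ i, 1 ≤ n i) (hw : ∀ i, ‖w i‖ ≤ w' i)
    (hs : ∀ σ : ℝ, 1 < σ → Summable fun i => w' i * n i ^ (-σ)) :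
    Measurable (deviation w n ρ) :=
  (measurable_normalizedSum hn hw hs).sub (measurable_const.indicator measurableSet_Ici)

/-- The limiting form, on the line `re s = 1` itself, of the Fejér smoothing identity. -/
lemma integral_deviation_mul_fejer_line [Countable ι] (hn : ∀ i, 1 ≤ n i)
    (hw : ∀ i, ‖w i‖ ≤ w' i)
    (hs : ∀ σ : ℝ, 1 < σ → Summable fun i => w' i * n i ^ (-σ)) (hg : ExtendsToLine w n ρ g)
    {M : ℝ} (hM : ∀ u, ‖normalizedSum w n u‖ ≤ M) {lam : ℝ} (hlam : 0 < lam) (y : ℝ) :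
    ∫ u, deviation w n ρ u * (fejer (lam * (y - u)) : ℂ) =
      ∫ t in (-1 : ℝ)..1, ((1 - |t| : ℝ) : ℂ) * Complex.exp (Complex.I * (t * (lam * y))) *
        g (1 + Complex.I * (lam * t)) := by
  have h1 : Tendsto (fun ε : ℝ => ∫ u, deviation w n ρ u * Complex.exp (-(ε * u)) *
      (fejer (lam * (y - u)) : ℂ)) (𝓝[>] 0)
      (𝓝 (∫ u, deviation w n ρ u * (fejer (lam * (y - u)) : ℂ))) := by
    refine tendsto_integral_filter_of_dominated_convergence
      (fun u => (M + ‖ρ‖) * fejer (lam * (y - u)))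
      (Eventually.of_forall fun ε => Measurable.aestronglyMeasurable
        (((measurable_deviation hn hw hs).mul (by fun_prop)).mul
        (Complex.measurable_ofReal.comp (measurable_fejer.comp (by fun_prop))))) ?_
      ((integrable_fejer_comp hlam y).const_mul _) (ae_of_all _ fun u => ?_)
    · filter_upwards [self_mem_nhdsWithin] with ε (hε : 0 < ε)
      refine ae_of_all _ fun u => ?_
      rw [norm_mul, Complex.norm_real, Real.norm_of_nonneg (fejer_nonneg _)]
      refine mul_le_mul_of_nonneg_right ?_ (fejer_nonneg _)
      rcases lt_or_ge u 0 with hu | hu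
      · rw [deviation_of_neg hn hu, zero_mul, norm_zero]
        exact add_nonneg ((norm_nonneg _).trans (hM 0)) (norm_nonneg _)
      · rw [norm_mul, Complex.norm_exp]
        refine (mul_le_of_le_one_right (norm_nonneg _) (Real.exp_le_one_iff.2 ?_)).trans
          (norm_deviation_le hM u)
        have : 0 ≤ ε * u := mul_nonneg hε.le hu
        simpa using this
    · refine Tendsto.mono_left ?_ nhdsWithin_le_nhds
      have : ContinuousAt (fun ε : ℝ => deviation w n ρ u * Complex.exp (-(ε * u)) *
        (fejer (lam * (y - u)) : ℂ)) 0 := by fun_prop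
      simpa using this.tendsto
  obtain ⟨B, -, hB⟩ := hg.eventually_segment lam
  have h2 : Tendsto (fun ε : ℝ => ∫ t in (-1 : ℝ)..1,
      ((1 - |t| : ℝ) : ℂ) * Complex.exp (Complex.I * (t * (lam * y))) *
        g (1 + (ε + Complex.I * (lam * t)))) (𝓝[>] 0)
      (𝓝 (∫ t in (-1 : ℝ)..1, ((1 - |t| : ℝ) : ℂ) * Complex.exp (Complex.I * (t * (lam * y))) *
        g (1 + Complex.I * (lam * t)))) := by
    refine intervalIntegral.tendsto_integral_filter_of_dominated_convergence (fun _ => B) ?_ ?_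
      (by simp) ?_
    · filter_upwards [hB, self_mem_nhdsWithin] with ε hε (hpos : 0 < ε)
      have : ∀ t ∈ Set.uIoc (-1 : ℝ) 1,
          (∫ u, deviation w n ρ u * Complex.exp (-((ε + Complex.I * (lam * t)) * u))) =
          g (1 + (ε + Complex.I * (lam * t))) := fun t ht => by
        rw [Set.uIoc_of_le (by norm_num)] at ht
        rw [integral_deviation hn hw hs (by simpa using hpos),
          (hε t (Set.Ioc_subset_Icc_self ht)).2]
      have hsm : StronglyMeasurable fun t : ℝ =>
          ∫ u : ℝ, deviation w n ρ u * Complex.exp (-((ε + Complex.I * (lam * t)) * u)) := by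
        refine StronglyMeasurable.integral_prod_right (f := fun t u : ℝ =>
          deviation w n ρ u * Complex.exp (-((ε + Complex.I * (lam * t)) * u))) ?_
        exact (((measurable_deviation hn hw hs).comp measurable_snd).mul
          (by fun_prop)).stronglyMeasurable
      have htri : StronglyMeasurable fun t : ℝ =>
          ((1 - |t| : ℝ) : ℂ) * Complex.exp (Complex.I * (t * (lam * y))) :=
        Continuous.stronglyMeasurable (by fun_prop)
      refine (htri.mul hsm).aestronglyMeasurable.congr
        (ae_restrict_of_forall_mem measurableSet_uIoc fun t ht => ?_)
      simp only [Pi.mul_apply, this t ht]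
    · filter_upwards [hB] with ε hε
      refine ae_of_all _ fun t ht => ?_
      rw [Set.uIoc_of_le (by norm_num)] at ht
      have h4 := Set.Ioc_subset_Icc_self ht
      have := norm_triangle_mul_le h4 (lam * y) (hε t h4).1
      simpa using this
    · refine ae_of_all _ fun t _ => Tendsto.mono_left ?_ nhdsWithin_le_nhds
      have hcont : ContinuousAt (fun ε : ℝ => g (1 + (ε + Complex.I * (lam * t)))) 0 :=
        ContinuousAt.comp (f := fun ε : ℝ => (1 + (ε + Complex.I * (lam * t)) : ℂ)) (g := g)
          (by simpa using (hg (1 + Complex.I * (lam * t)) (by simp)).1) (by fun_prop)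
      simpa using hcont.tendsto.const_mul _
  refine tendsto_nhds_unique h1 (h2.congr' ?_)
  filter_upwards [integral_deviation_mul_fejer hn hw hs hg lam] with ε hε using (hε y).symm

/-- The smoothed deviation tends to zero, by the Riemann–Lebesgue lemma. -/
lemma tendsto_integral_deviation [Countable ι] (hn : ∀ i, 1 ≤ n i)
    (hw : ∀ i, ‖w i‖ ≤ w' i)
    (hs : ∀ σ : ℝ, 1 < σ → Summable fun i => w' i * n i ^ (-σ)) (hg : ExtendsToLine w n ρ g)
    {M : ℝ} (hM : ∀ u, ‖normalizedSum w n u‖ ≤ M) {lam : ℝ} (hlam : 0 < lam) :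
    Tendsto (fun y : ℝ => ∫ u, deviation w n ρ u * (fejer (lam * (y - u)) : ℂ)) atTop (𝓝 0) := by
  simp only [integral_deviation_mul_fejer_line hn hw hs hg hM hlam]
  set G : ℝ → ℂ := (Set.Ioc (-1 : ℝ) 1).indicator
    fun t => ((1 - |t| : ℝ) : ℂ) * g (1 + Complex.I * (lam * t)) with hG
  have hRL := Real.tendsto_integral_exp_smul_cocompact G
  have hlin : Tendsto (fun y : ℝ => -(lam / (2 * Real.pi)) * y) atTop (cocompact ℝ) :=
    (tendsto_id.const_mul_atTop_of_neg (by
      have := Real.pi_pos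
      rw [neg_lt_zero]; positivity)).mono_right atBot_le_cocompact
  refine (hRL.comp hlin).congr fun y => ?_
  rw [intervalIntegral.integral_of_le (by norm_num), ← integral_indicator measurableSet_Ioc]
  refine integral_congr_ae (ae_of_all _ fun t => ?_)
  by_cases ht : t ∈ Set.Ioc (-1 : ℝ) 1
  · simp only [hG, Set.indicator_of_mem ht, Circle.smul_def, Real.fourierChar_apply, smul_eq_mul]
    have e : Complex.exp (((2 * Real.pi * -(t * (-(lam / (2 * Real.pi)) * y)) : ℝ) : ℂ) * Complex.I)
        = Complex.exp (Complex.I * (t * (lam * y))) := by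
      congr 1
      push_cast
      have : (Real.pi : ℂ) ≠ 0 := by exact_mod_cast Real.pi_ne_zero
      field_simp
    rw [e]
    ring
  · simp [hG, Set.indicator_of_notMem ht]

lemma tendsto_integral_normalizedSum [Countable ι] (hn : ∀ i, 1 ≤ n i)
    (hw : ∀ i, ‖w i‖ ≤ w' i)
    (hs : ∀ σ : ℝ, 1 < σ → Summable fun i => w' i * n i ^ (-σ)) (hg : ExtendsToLine w n ρ g)
    {M : ℝ} (hM : ∀ u, ‖normalizedSum w n u‖ ≤ M) {lam : ℝ} (hlam : 0 < lam) :
    Tendsto (fun y : ℝ => ∫ u, normalizedSum w n u * (fejer (lam * (y - u)) : ℂ)) atTop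
      (𝓝 (ρ * (((∫ v, fejer v) / lam : ℝ) : ℂ))) := by
  have hker : Integrable fun v => (fejer (lam * v) : ℂ) :=
    (integrable_fejer.comp_mul_left' hlam.ne').ofReal
  have h1 : Tendsto (fun y : ℝ => ∫ u, (Set.Ici (0 : ℝ)).indicator (fun _ => ρ) u *
      (fejer (lam * (y - u)) : ℂ)) atTop (𝓝 (ρ * (((∫ v, fejer v) / lam : ℝ) : ℂ))) := by
    have h2 := (aecover_Iic (μ := volume) (tendsto_id (α := ℝ) (x := atTop))
      ).integral_tendsto_of_countably_generated hker
    have h3 := h2.const_mul ρ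
    rw [integral_complex_ofReal] at h3
    have h4 : ∫ v, fejer (lam * v) = (∫ v, fejer v) / lam := by
      rw [Measure.integral_comp_mul_left fejer lam, abs_of_pos (by positivity), smul_eq_mul]
      ring
    rw [h4] at h3
    refine h3.congr fun y => ?_
    rw [← integral_indicator measurableSet_Iic, ← integral_const_mul,
      ← integral_sub_left_eq_self _ volume y]
    refine integral_congr_ae (ae_of_all _ fun u => ?_)
    by_cases hu : u ∈ Set.Ici (0 : ℝ)
    · have : y - u ∈ Set.Iic (id y) := by simpa using hu
      simp only [Set.indicator_of_mem hu, Set.indicator_of_mem this]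
    · have : y - u ∉ Set.Iic (id y) := by simpa using hu
      simp only [Set.indicator_of_notMem hu, Set.indicator_of_notMem this, mul_zero, zero_mul]
  have h := (tendsto_integral_deviation hn hw hs hg hM hlam).add h1
  rw [zero_add] at h
  refine h.congr fun y => ?_
  have hkery : Integrable fun u => (fejer (lam * (y - u)) : ℂ) := hker.comp_sub_left y
  rw [← integral_add]
  · refine integral_congr_ae (ae_of_all _ fun u => ?_)
    simp only [deviation]
    ring
  · exact hkery.bdd_mul (measurable_deviation hn hw hs).aestronglyMeasurable
      (ae_of_all _ (norm_deviation_le hM))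
  · exact hkery.bdd_mul (measurable_const.indicator measurableSet_Ici).aestronglyMeasurable
      (ae_of_all _ fun u => norm_indicator_le_norm_self _ _)

end Limit

/-- Undoing the smoothing: if `A` is nondecreasing, `A(u) e^{-u}` is bounded, and all its averages
against rescaled Fejér kernels converge as they should for the limit `ρ`, then it tends to `ρ`. -/
lemma tendsto_of_tendsto_fejer {A : ℝ → ℝ} (hA : Monotone A) (hA0 : ∀ u, 0 ≤ A u) {M ρ : ℝ}
    (hM : ∀ u, A u * Real.exp (-u) ≤ M)
    (h : ∀ lam : ℝ, 0 < lam → Tendsto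
      (fun y => ∫ u, A u * Real.exp (-u) * fejer (lam * (y - u))) atTop
      (𝓝 (ρ * ((∫ v, fejer v) / lam)))) :
    Tendsto (fun u => A u * Real.exp (-u)) atTop (𝓝 ρ) := by
  set I := ∫ v, fejer v with hI
  have hI0 : 0 < I := integral_fejer_pos
  set f : ℝ → ℝ := fun u => A u * Real.exp (-u) with hf
  have hf0 : ∀ u, 0 ≤ f u := fun u => mul_nonneg (hA0 u) (Real.exp_nonneg _)
  have hM0 : 0 ≤ M := (hf0 0).trans (hM 0)
  have hfmeas : Measurable f := hA.measurable.mul (by fun_prop)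
  have hfexp : ∀ u v d, u ≤ v → v - u ≤ d → f u * Real.exp (-d) ≤ f v := fun u v d huv hd => by
    simp only [hf]
    rw [mul_assoc, ← Real.exp_add]
    exact mul_le_mul (hA huv) (Real.exp_le_exp.2 (by linarith)) (Real.exp_nonneg _) (hA0 _)
  -- the mass of the kernel at scale `lam⁻¹` concentrates near the origin
  have hmass : ∀ δ : ℝ, 0 < δ → ∃ lam : ℝ, 0 < lam ∧ ∀ c : ℝ,
      (1 - δ) * (I / lam) ≤ ∫ u in Set.Icc (c - δ) (c + δ), fejer (lam * (c - u)) := by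
    intro δ hδ
    have h1 : Tendsto (fun R : ℝ => ∫ v in Set.Icc (-R) R, fejer v) atTop (𝓝 I) :=
      (aecover_Icc tendsto_neg_atTop_atBot tendsto_id
        ).integral_tendsto_of_countably_generated integrable_fejer
    have h2 : ∀ᶠ R : ℝ in atTop, (1 - δ) * I < ∫ v in Set.Icc (-R) R, fejer v :=
      h1.eventually (eventually_gt_nhds (by nlinarith))
    obtain ⟨R, hR, hR0⟩ := (h2.and (eventually_gt_atTop 0)).exists
    refine ⟨R / δ, by positivity, fun c => ?_⟩
    have hl : 0 < R / δ := by positivity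
    have h3 : ∫ u in Set.Icc (c - δ) (c + δ), fejer (R / δ * (c - u)) =
        (∫ v in Set.Icc (-R) R, fejer v) / (R / δ) := by
      rw [← integral_indicator measurableSet_Icc, ← integral_indicator measurableSet_Icc]
      have e : ∀ u, (Set.Icc (c - δ) (c + δ)).indicator (fun u => fejer (R / δ * (c - u))) u =
          (fun x => (Set.Icc (-R) R).indicator fejer (R / δ * x)) (c - u) := fun u => by
        have hiff : u ∈ Set.Icc (c - δ) (c + δ) ↔ R / δ * (c - u) ∈ Set.Icc (-R) R := by
          have e1 : R / δ * (c - u) = R * ((c - u) / δ) := by ring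
          have e2 : -R = R * (-1) := by ring
          rw [Set.mem_Icc, Set.mem_Icc, e1, e2]
          nth_rewrite 4 [← mul_one R]
          rw [mul_le_mul_iff_right₀ hR0, mul_le_mul_iff_right₀ hR0, le_div_iff₀ hδ, div_le_iff₀ hδ]
          constructor <;> rintro ⟨h1, h2⟩ <;> constructor <;> linarith
        by_cases hu : u ∈ Set.Icc (c - δ) (c + δ)
        · simp only [Set.indicator_of_mem hu, Set.indicator_of_mem (hiff.1 hu)]
        · simp only [Set.indicator_of_notMem hu, Set.indicator_of_notMem (fun h => hu (hiff.2 h))]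
      simp only [e]
      rw [integral_sub_left_eq_self (fun x => (Set.Icc (-R) R).indicator fejer (R / δ * x))
          volume c,
        Measure.integral_comp_mul_left, abs_of_pos (by positivity), smul_eq_mul]
      ring
    rw [h3, ← mul_div_assoc]
    gcongr
  have hint : ∀ lam : ℝ, 0 < lam → ∀ c, Integrable fun u => f u * fejer (lam * (c - u)) :=
    fun lam hl c => (integrable_fejer_comp hl c).bdd_mul hfmeas.aestronglyMeasurable
      (ae_of_all _ fun u => by rw [Real.norm_of_nonneg (hf0 u)]; exact hM u)
  rw [tendsto_order]
  constructor
  · -- centre the kernel at `y - δ`, so that the values of `f` near the centre are at most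
    -- `f y * exp (2 * δ)`; outside, `f` is at most `M`, where the kernel has small mass
    intro a ha
    have hc : ContinuousAt (fun δ : ℝ => Real.exp (-(2 * δ)) * (ρ - M * δ)) 0 := by fun_prop
    have hc2 := hc.eventually (eventually_gt_nhds (by simpa using ha))
    obtain ⟨δ, hδa, hδ⟩ :=
      ((hc2.filter_mono nhdsWithin_le_nhds).and (self_mem_nhdsWithin (s := Set.Ioi 0))).exists
    replace hδ : 0 < δ := hδ
    obtain ⟨lam, hlam, hm⟩ := hmass δ hδ
    have h1 : Tendsto (fun y => Real.exp (-(2 * δ)) *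
        ((∫ u, f u * fejer (lam * ((y - δ) - u))) / (I / lam) - M * δ)) atTop
        (𝓝 (Real.exp (-(2 * δ)) * (ρ - M * δ))) := by
      have h0 := ((((h lam hlam).comp (tendsto_atTop_add_const_right atTop (-δ)
        tendsto_id)).div_const (I / lam)).sub_const (M * δ)).const_mul (Real.exp (-(2 * δ)))
      rw [mul_div_cancel_right₀ _ (by positivity)] at h0
      exact h0
    filter_upwards [h1.eventually (eventually_gt_nhds hδa)] with y hy
    refine hy.trans_le ?_
    set c := y - δ with hcdef
    have h2 : ∫ u, f u * fejer (lam * (c - u)) ≤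
        f y * Real.exp (2 * δ) * (I / lam) + M * (δ * (I / lam)) := by
      rw [← integral_add_compl (measurableSet_Icc (a := c - δ) (b := c + δ)) (hint lam hlam c)]
      have h3 : ∫ u in Set.Icc (c - δ) (c + δ), f u * fejer (lam * (c - u)) ≤
          f y * Real.exp (2 * δ) * (I / lam) := by
        have h4 : ∫ u in Set.Icc (c - δ) (c + δ), f u * fejer (lam * (c - u)) ≤
            ∫ u in Set.Icc (c - δ) (c + δ), f y * Real.exp (2 * δ) * fejer (lam * (c - u)) := by
          refine setIntegral_mono_on (hint lam hlam c).integrableOn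
            ((integrable_fejer_comp hlam c).const_mul _).integrableOn measurableSet_Icc
            fun u hu => mul_le_mul_of_nonneg_right ?_ (fejer_nonneg _)
          have := hfexp u y (2 * δ) (by linarith [hu.2]) (by linarith [hu.1])
          rw [Real.exp_neg, ← div_eq_mul_inv, div_le_iff₀ (Real.exp_pos _)] at this
          exact this
        refine h4.trans ?_
        rw [integral_const_mul, ← integral_fejer_comp hlam c]
        exact mul_le_mul_of_nonneg_left (setIntegral_le_integral (integrable_fejer_comp hlam c)
          (ae_of_all _ fun u => fejer_nonneg _)) (mul_nonneg (hf0 _) (Real.exp_nonneg _))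
      have h5 : ∫ u in (Set.Icc (c - δ) (c + δ))ᶜ, f u * fejer (lam * (c - u)) ≤
          M * (δ * (I / lam)) := by
        have h6 : ∫ u in (Set.Icc (c - δ) (c + δ))ᶜ, f u * fejer (lam * (c - u)) ≤
            ∫ u in (Set.Icc (c - δ) (c + δ))ᶜ, M * fejer (lam * (c - u)) :=
          setIntegral_mono_on (hint lam hlam c).integrableOn
            ((integrable_fejer_comp hlam c).const_mul _).integrableOn measurableSet_Icc.compl
            fun u hu => mul_le_mul_of_nonneg_right (hM u) (fejer_nonneg _)
        refine h6.trans ?_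
        rw [integral_const_mul]
        refine mul_le_mul_of_nonneg_left ?_ hM0
        have h7 := integral_add_compl (measurableSet_Icc (a := c - δ) (b := c + δ))
          (integrable_fejer_comp hlam c)
        rw [integral_fejer_comp hlam c] at h7
        linarith [hm c]
      linarith
    have hIl : 0 < I / lam := by positivity
    have h8 : (∫ u, f u * fejer (lam * (c - u))) / (I / lam) - M * δ ≤ f y * Real.exp (2 * δ) := by
      rw [sub_le_iff_le_add, div_le_iff₀ hIl]
      linarith
    calc _ ≤ Real.exp (-(2 * δ)) * (f y * Real.exp (2 * δ)) :=
          mul_le_mul_of_nonneg_left h8 (Real.exp_nonneg _)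
      _ = f y := by rw [mul_comm, mul_assoc, ← Real.exp_add]; simp
  · -- centre the kernel at `y + δ`, so that the values of `f` near the centre are at least
    -- `f y * exp (-(2 * δ))`
    intro a ha
    have hc : ContinuousAt (fun δ : ℝ => Real.exp (2 * δ) * (ρ / (1 - δ))) 0 := by
      refine ContinuousAt.mul (by fun_prop) (continuousAt_const.div (by fun_prop) (by norm_num))
    have hc2 := hc.eventually (eventually_lt_nhds (b := a) (by simpa using ha))
    obtain ⟨δ, ⟨hδa, hδ1⟩, hδ⟩ := (((hc2.and
      (eventually_lt_nhds (b := (1 : ℝ)) (by norm_num))).filter_mono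
      nhdsWithin_le_nhds).and (self_mem_nhdsWithin (s := Set.Ioi 0))).exists
    replace hδ : 0 < δ := hδ
    obtain ⟨lam, hlam, hm⟩ := hmass δ hδ
    have hIl : 0 < I / lam := by positivity
    have h1 : Tendsto (fun y => Real.exp (2 * δ) *
        ((∫ u, f u * fejer (lam * ((y + δ) - u))) / (I / lam) / (1 - δ))) atTop
        (𝓝 (Real.exp (2 * δ) * (ρ / (1 - δ)))) := by
      have h0 := ((((h lam hlam).comp (tendsto_atTop_add_const_right atTop δ tendsto_id)).div_const
        (I / lam)).div_const (1 - δ)).const_mul (Real.exp (2 * δ))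
      rw [mul_div_cancel_right₀ _ (by positivity)] at h0
      exact h0
    filter_upwards [h1.eventually (eventually_lt_nhds hδa)] with y hy
    refine lt_of_le_of_lt ?_ hy
    set c := y + δ with hcdef
    have h2 : f y * Real.exp (-(2 * δ)) * ((1 - δ) * (I / lam)) ≤
        ∫ u, f u * fejer (lam * (c - u)) := by
      refine le_trans (mul_le_mul_of_nonneg_left (hm c)
        (mul_nonneg (hf0 _) (Real.exp_nonneg _))) ?_
      rw [← integral_const_mul]
      refine le_trans (setIntegral_mono_on
        ((integrable_fejer_comp hlam c).const_mul _).integrableOn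
        (hint lam hlam c).integrableOn measurableSet_Icc
        fun u hu => mul_le_mul_of_nonneg_right ?_ (fejer_nonneg _))
        (setIntegral_le_integral (hint lam hlam c)
          (ae_of_all _ fun u => mul_nonneg (hf0 _) (fejer_nonneg _)))
      exact hfexp y u (2 * δ) (by linarith [hu.1]) (by linarith [hu.2])
    have h1δ : 0 < 1 - δ := by linarith
    have h8 : f y * Real.exp (-(2 * δ)) ≤
        (∫ u, f u * fejer (lam * (c - u))) / (I / lam) / (1 - δ) := by
      rw [le_div_iff₀ h1δ, le_div_iff₀ hIl]
      linarith
    calc f y = Real.exp (2 * δ) * (f y * Real.exp (-(2 * δ))) := by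
          rw [mul_comm, mul_assoc, ← Real.exp_add]; simp
      _ ≤ _ := mul_le_mul_of_nonneg_left h8 (Real.exp_nonneg _)

end LineOfConvergence

/-! ### The Wiener–Ikehara theorem -/

section Tauberian

variable {ι : Type*} [Countable ι] {w : ι → ℂ} {w' : ι → ℝ} {n : ι → ℝ} {ρ ρ' : ℂ} {g g' : ℂ → ℂ}

/-- Adding the majorant to the real part of a rotation of the coefficients makes them nonnegative,
so that the unsmoothing lemma applies. -/
lemma tendsto_re_mul_normalizedSum_add (hn : ∀ i, 1 ≤ n i) (hw : ∀ i, ‖w i‖ ≤ w' i)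
    (hs : ∀ σ : ℝ, 1 < σ → Summable fun i => w' i * n i ^ (-σ)) (hg : ExtendsToLine w n ρ g)
    (hg' : ExtendsToLine (fun i => (w' i : ℂ)) n ρ' g') {ζ : ℂ} (hζ : ‖ζ‖ ≤ 1) :
    Tendsto (fun u => (ζ * normalizedSum w n u).re +
      (normalizedSum (fun i => (w' i : ℂ)) n u).re) atTop (𝓝 ((ζ * ρ).re + ρ'.re)) := by
  have hw' : ∀ i, 0 ≤ w' i := fun i => (norm_nonneg _).trans (hw i)
  have hwc : ∀ i, ‖(w' i : ℂ)‖ ≤ w' i := fun i => by simp [abs_of_nonneg (hw' i)]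
  obtain ⟨M, hM'⟩ := exists_bound_of_extendsToLine hn hw' hs hg'
  have hMw : ∀ u, ‖normalizedSum w n u‖ ≤ M :=
    fun u => (norm_normalizedSum_le hn hw hs u).trans (hM' u)
  have hMw' : ∀ u, ‖normalizedSum (fun i => (w' i : ℂ)) n u‖ ≤ M :=
    fun u => (norm_normalizedSum_le hn hwc hs u).trans (hM' u)
  set v : ι → ℝ := fun i => (ζ * w i).re + w' i with hv
  have hre : ∀ i, |(ζ * w i).re| ≤ w' i := fun i => by
    refine (Complex.abs_re_le_norm _).trans ?_
    rw [norm_mul]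
    exact (mul_le_of_le_one_left (norm_nonneg _) hζ).trans (hw i)
  have hv0 : ∀ i, 0 ≤ v i := fun i => by
    have := (abs_le.1 (hre i)).1
    simp only [hv]
    linarith
  have hvs : ∀ σ : ℝ, 1 < σ → Summable fun i => v i * n i ^ (-σ) := fun σ hσ => by
    have h0 : ∀ i, 0 ≤ n i ^ (-σ) := fun i => Real.rpow_nonneg (zero_le_one.trans (hn i)) _
    refine ((hs σ hσ).mul_left 2).of_nonneg_of_le (fun i => mul_nonneg (hv0 i) (h0 i)) fun i => ?_
    rw [← mul_assoc]
    refine mul_le_mul_of_nonneg_right ?_ (h0 i)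
    have := (abs_le.1 (hre i)).2
    simp only [hv]
    linarith
  have hsw := summable_ite_le_of_norm_le hn hw hs
  have hA : ∀ u : ℝ, partialSum v n (Real.exp u) * Real.exp (-u) =
      (ζ * normalizedSum w n u).re + (normalizedSum (fun i => (w' i : ℂ)) n u).re := fun u => by
    have h1 : ((ζ * partialSum w n (Real.exp u)).re +
        (partialSum (fun i => (w' i : ℂ)) n (Real.exp u)).re) = partialSum v n (Real.exp u) := by
      simp only [partialSum]
      rw [← tsum_mul_left, Complex.re_tsum ((hsw _).mul_left ζ),
        Complex.re_tsum (summable_ite_le_of_norm_le hn hwc hs _), ← Summable.tsum_add]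
      · refine tsum_congr fun i => ?_
        split_ifs <;> simp [hv]
      · exact (Complex.hasSum_re ((hsw _).mul_left ζ).hasSum).summable
      · exact (Complex.hasSum_re (summable_ite_le_of_norm_le hn hwc hs _).hasSum).summable
    rw [← h1]
    simp only [normalizedSum, ← Complex.ofReal_neg, ← Complex.ofReal_exp, ← mul_assoc,
      Complex.re_mul_ofReal]
    ring
  have key := tendsto_of_tendsto_fejer (A := fun u => partialSum v n (Real.exp u))
    (fun x y hxy => partialSum_mono hn hv0 hvs (Real.exp_le_exp.2 hxy))
    (fun u => partialSum_nonneg hv0 _) (M := 2 * M) (ρ := (ζ * ρ).re + ρ'.re) (fun u => by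
      rw [hA u]
      have h1 := (Complex.abs_re_le_norm (ζ * normalizedSum w n u))
      rw [norm_mul] at h1
      have h2 := (le_abs_self _).trans
        (h1.trans ((mul_le_of_le_one_left (norm_nonneg _) hζ).trans (hMw u)))
      have h3 := (le_abs_self _).trans ((Complex.abs_re_le_norm _).trans (hMw' u))
      linarith) (fun lam hlam => ?_)
  · simpa only [hA] using key
  · have h1 := tendsto_integral_normalizedSum hn hw hs hg hMw hlam
    have h2 := tendsto_integral_normalizedSum hn hwc hs hg' hMw' hlam
    have h3 := (Complex.continuous_re.tendsto _).comp (h1.const_mul ζ)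
    have h4 := (Complex.continuous_re.tendsto _).comp h2
    have h5 := h3.add h4
    rw [← mul_assoc, Complex.re_mul_ofReal, Complex.re_mul_ofReal, ← add_mul] at h5
    refine h5.congr fun y => ?_
    have hk : Integrable fun u => (fejer (lam * (y - u)) : ℂ) :=
      (integrable_fejer_comp hlam y).ofReal
    have i1 : Integrable fun u => ζ * (normalizedSum w n u * (fejer (lam * (y - u)) : ℂ)) :=
      (hk.bdd_mul (measurable_normalizedSum hn hw hs).aestronglyMeasurable
        (ae_of_all _ hMw)).const_mul _
    have i2 : Integrable fun u =>
        normalizedSum (fun i => (w' i : ℂ)) n u * (fejer (lam * (y - u)) : ℂ) :=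
      hk.bdd_mul (measurable_normalizedSum hn hwc hs).aestronglyMeasurable (ae_of_all _ hMw')
    simp only [Function.comp_apply]
    have r1 := integral_re i1
    have r2 := integral_re i2
    simp only [RCLike.re_to_complex] at r1 r2
    rw [← integral_const_mul, ← r1, ← r2]
    refine (integral_add i1.re i2.re).symm.trans ?_
    refine integral_congr_ae (ae_of_all _ fun u => ?_)
    simp only [hA u, RCLike.re_to_complex, ← mul_assoc, Complex.re_mul_ofReal]
    ring

/-- The **Wiener–Ikehara theorem** for generalized Dirichlet series with complex coefficients `w`
dominated by coefficients `w'` whose series also extends to the line `re s = 1`. -/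
theorem tendsto_partialSum_div (hn : ∀ i, 1 ≤ n i) (hw : ∀ i, ‖w i‖ ≤ w' i)
    (hs : ∀ σ : ℝ, 1 < σ → Summable fun i => w' i * n i ^ (-σ)) (hg : ExtendsToLine w n ρ g)
    (hg' : ExtendsToLine (fun i => (w' i : ℂ)) n ρ' g') :
    Tendsto (fun y : ℝ => partialSum w n y / (y : ℂ)) atTop (𝓝 ρ) := by
  -- `ζ = 0` isolates the majorant, `ζ = 1` and `ζ = -I` the real and imaginary parts
  have h0 := tendsto_re_mul_normalizedSum_add hn hw hs hg hg' (ζ := 0) (by simp)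
  have h1 := (tendsto_re_mul_normalizedSum_add hn hw hs hg hg' (ζ := 1) (by simp)).sub h0
  have h2 := (tendsto_re_mul_normalizedSum_add hn hw hs hg hg' (ζ := -Complex.I) (by simp)).sub h0
  simp only [one_mul, zero_mul, Complex.zero_re, zero_add, add_sub_cancel_right, neg_mul,
    Complex.neg_re, Complex.I_mul_re, neg_neg] at h1 h2
  have h3 : Tendsto (fun u => normalizedSum w n u) atTop (𝓝 ρ) := by
    have h4 := ((Complex.continuous_ofReal.tendsto _).comp h1).add
      (((Complex.continuous_ofReal.tendsto _).comp h2).mul_const Complex.I)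
    simpa only [Function.comp_def, Complex.re_add_im] using h4
  refine (h3.comp Real.tendsto_log_atTop).congr' ?_
  filter_upwards [eventually_gt_atTop 0] with y hy
  rw [Function.comp_apply, normalizedSum, Real.exp_log hy, ← Complex.ofReal_neg,
    ← Complex.ofReal_exp, Real.exp_neg, Real.exp_log hy, Complex.ofReal_inv, div_eq_mul_inv]

end Tauberian

/-! ### Primes of a number field and Euler products -/

section Primes

variable {K : Type*} [Field K] [NumberField K]

lemma two_le_primeNorm (p : HeightOneSpectrum (𝓞 K)) : 2 ≤ primeNorm p := by
  have h0 : primeNorm p ≠ 0 := by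
    rw [primeNorm, Ne, Ideal.absNorm_eq_zero_iff]
    exact p.ne_bot
  have h1 : primeNorm p ≠ 1 := by
    rw [primeNorm, Ne, Ideal.absNorm_eq_one_iff]
    exact p.isPrime.ne_top
  omega

lemma finite_primeNorm_le (x : ℝ) :
    {p : HeightOneSpectrum (𝓞 K) | (primeNorm p : ℝ) ≤ x}.Finite := by
  refine Set.Finite.of_finite_image (f := fun p => p.asIdeal)
    ((Ideal.finite_setOfPred_absNorm_le (S := 𝓞 K) ⌊x⌋₊).subset ?_)
    (fun p _ q _ h => HeightOneSpectrum.ext h)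
  rintro _ ⟨p, hp, rfl⟩
  exact Nat.le_floor hp

instance countable_heightOneSpectrum : Countable (HeightOneSpectrum (𝓞 K)) := by
  rw [← Set.countable_univ_iff]
  have : (Set.univ : Set (HeightOneSpectrum (𝓞 K))) = ⋃ n : ℕ, {p | (primeNorm p : ℝ) ≤ n} := by
    ext p
    simp only [Set.mem_univ, Set.mem_iUnion, true_iff]
    exact ⟨primeNorm p, le_refl (primeNorm p : ℝ)⟩
  rw [this]
  exact Set.countable_iUnion fun n => (finite_primeNorm_le _).countable

/-- Even the sum over all nonzero ideals converges, as the number of ideals of norm at most `x`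
grows linearly. -/
lemma summable_primeNorm_rpow {σ : ℝ} (hσ : 1 < σ) :
    Summable fun p : HeightOneSpectrum (𝓞 K) => (primeNorm p : ℝ) ^ (-σ) := by
  have hbig : LSeriesSummable (fun n => (Nat.card {I : Ideal (𝓞 K) // Ideal.absNorm I = n} : ℂ))
      (σ : ℂ) := by
    have hlim : Tendsto (fun n : ℕ => (∑ k ∈ Finset.Icc 1 n,
        (Nat.card {I : Ideal (𝓞 K) // Ideal.absNorm I = k} : ℝ)) / n) atTop
        (𝓝 (NumberField.dedekindZeta_residue K)) := by
      refine ((NumberField.Ideal.tendsto_norm_le_div_atTop₀ K).comp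
        tendsto_natCast_atTop_atTop).congr fun n ↦ ?_
      simp only [Function.comp_apply, Nat.cast_le, ← Nat.cast_sum]
      congr
      rw [← add_left_inj 1, ← Ideal.card_norm_le_eq_card_norm_le_add_one,
        show Finset.Icc 1 n = Finset.Ioc 0 n from Finset.Icc_succ_left_eq_Ioc _ _,
        show 1 = Nat.card {I : Ideal (𝓞 K) // Ideal.absNorm I = 0} by
          simp [Ideal.absNorm_eq_zero_iff],
        Finset.sum_Ioc_add_eq_sum_Icc (n.zero_le),
        ← Finset.card_preimage_eq_sum_card_image_eq (fun k _ ↦ Ideal.finite_setOfPred_absNorm_eq k)]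
      simp [Set.coe_eq_subtype]
    refine LSeriesSummable_of_sum_norm_bigO (r := 1) ?_ zero_le_one (by simpa using hσ)
    simp only [Real.rpow_one, Complex.norm_natCast]
    refine (isBigO_of_div_tendsto_nhds ?_ _ hlim)
    filter_upwards [eventually_gt_atTop 0] with n hn h
    exact absurd h (by positivity)
  have hsum : Summable fun n : ℕ =>
      (Nat.card {I : Ideal (𝓞 K) // Ideal.absNorm I = n} : ℝ) * (n : ℝ) ^ (-σ) := by
    refine hbig.norm.congr fun n => ?_
    rcases eq_or_ne n 0 with rfl | hn
    · simp [LSeries.term_def, Real.zero_rpow (by linarith : -σ ≠ 0)]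
    · rw [LSeries.norm_term_eq, if_neg hn, Complex.norm_natCast, Complex.ofReal_re,
        Real.rpow_neg (by positivity), div_eq_mul_inv]
  rw [← (Equiv.sigmaFiberEquiv (primeNorm (K := K))).summable_iff, summable_sigma_of_nonneg
    (f := (fun p : HeightOneSpectrum (𝓞 K) => (primeNorm p : ℝ) ^ (-σ)) ∘
      Equiv.sigmaFiberEquiv (primeNorm (K := K))) (fun x => Real.rpow_nonneg (by positivity) _)]
  have hfin : ∀ n : ℕ, Finite {p : HeightOneSpectrum (𝓞 K) // primeNorm p = n} := fun n =>
    ((finite_primeNorm_le (K := K) n).subset fun p (hp : primeNorm p = n) => by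
      simp [hp]).to_subtype
  have hcard : ∀ n : ℕ, Nat.card {p : HeightOneSpectrum (𝓞 K) // primeNorm p = n} ≤
      Nat.card {I : Ideal (𝓞 K) // Ideal.absNorm I = n} := fun n => by
    have : Finite {I : Ideal (𝓞 K) // Ideal.absNorm I = n} :=
      (Ideal.finite_setOfPred_absNorm_eq (S := 𝓞 K) n).to_subtype
    refine Nat.card_le_card_of_injective
      (fun p => ⟨p.1.asIdeal, p.2⟩ : _ → {I : Ideal (𝓞 K) // Ideal.absNorm I = n})
      fun p q h => ?_
    exact Subtype.ext (HeightOneSpectrum.ext (congrArg Subtype.val h))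
  have hval : ∀ (n : ℕ) (p : {p : HeightOneSpectrum (𝓞 K) // primeNorm p = n}),
      ((fun p : HeightOneSpectrum (𝓞 K) => (primeNorm p : ℝ) ^ (-σ)) ∘
        Equiv.sigmaFiberEquiv (primeNorm (K := K))) ⟨n, p⟩ = (n : ℝ) ^ (-σ) := fun n p => by
    simp [Equiv.sigmaFiberEquiv, p.2]
  refine ⟨fun n => by have := hfin n; exact Summable.of_finite, ?_⟩
  refine hsum.of_nonneg_of_le (fun n => tsum_nonneg fun p => ?_) fun n => ?_
  · exact Real.rpow_nonneg (by positivity) _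
  · have := hfin n
    simp only [hval, tsum_const, nsmul_eq_mul]
    exact mul_le_mul_of_nonneg_right (by exact_mod_cast hcard n)
      (Real.rpow_nonneg (by positivity) _)

/-- The norm of the product of the primes in `J`. -/
def setNorm (J : Finset (HeightOneSpectrum (𝓞 K))) : ℝ := ∏ p ∈ J, (primeNorm p : ℝ)

lemma primeNorm_pos (p : HeightOneSpectrum (𝓞 K)) : (0 : ℝ) < primeNorm p := by
  exact_mod_cast two_pos.trans_le (two_le_primeNorm p)

lemma one_lt_primeNorm (p : HeightOneSpectrum (𝓞 K)) : (1 : ℝ) < primeNorm p := by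
  exact_mod_cast two_le_primeNorm p

lemma one_le_setNorm (J : Finset (HeightOneSpectrum (𝓞 K))) : 1 ≤ setNorm J :=
  Finset.one_le_prod fun p _ => (one_lt_primeNorm p).le

lemma setNorm_pos (J : Finset (HeightOneSpectrum (𝓞 K))) : 0 < setNorm J :=
  zero_lt_one.trans_le (one_le_setNorm J)

lemma primeNorm_le_setNorm {J : Finset (HeightOneSpectrum (𝓞 K))} {p : HeightOneSpectrum (𝓞 K)}
    (hp : p ∈ J) : (primeNorm p : ℝ) ≤ setNorm J := by
  classical
  rw [setNorm, ← Finset.mul_prod_erase _ _ hp]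
  exact le_mul_of_one_le_right (primeNorm_pos p).le (one_le_setNorm _)

lemma finite_setNorm_le (y : ℝ) :
    {J : Finset (HeightOneSpectrum (𝓞 K)) | setNorm J ≤ y}.Finite := by
  classical
  refine ((finite_primeNorm_le (K := K) y).toFinset.powerset : Finset _).finite_toSet.subset
    fun J hJ => ?_
  simp only [Finset.coe_powerset, Set.mem_preimage, Set.mem_powerset_iff]
  intro p hp
  simp only [Set.Finite.coe_toFinset]
  exact (primeNorm_le_setNorm hp).trans hJ

lemma summable_prod_mul_setNorm_rpow {v : HeightOneSpectrum (𝓞 K) → ℝ} (hv : ∀ p, 0 ≤ v p) {B : ℝ}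
    (hB : ∀ p, v p ≤ B) {σ : ℝ} (hσ : 1 < σ) :
    Summable fun J : Finset (HeightOneSpectrum (𝓞 K)) => (∏ p ∈ J, v p) * setNorm J ^ (-σ) := by
  have h0 : ∀ p : HeightOneSpectrum (𝓞 K), 0 ≤ (primeNorm p : ℝ) ^ (-σ) :=
    fun p => Real.rpow_nonneg (primeNorm_pos p).le _
  have h1 : Summable fun p : HeightOneSpectrum (𝓞 K) => v p * (primeNorm p : ℝ) ^ (-σ) :=
    ((summable_primeNorm_rpow hσ).mul_left B).of_nonneg_of_le
      (fun p => mul_nonneg (hv p) (h0 p)) fun p => mul_le_mul_of_nonneg_right (hB p) (h0 p)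
  refine (summable_finsetProd_of_summable_nonneg (fun p => mul_nonneg (hv p) (h0 p)) h1).congr
    fun J => ?_
  rw [Finset.prod_mul_distrib, setNorm, Real.finsetProd_rpow _ _ fun p _ => (primeNorm_pos p).le]

lemma summable_norm_mul_cpow {v : HeightOneSpectrum (𝓞 K) → ℂ} {B : ℝ} (hB : ∀ p, ‖v p‖ ≤ B)
    {z : ℂ} (hz : 1 < z.re) :
    Summable fun p : HeightOneSpectrum (𝓞 K) => ‖v p * (primeNorm p : ℂ) ^ (-z)‖ := by
  refine ((summable_primeNorm_rpow hz).mul_left B).of_nonneg_of_le (fun p => norm_nonneg _)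
    fun p => ?_
  rw [norm_mul, Complex.norm_natCast_cpow_of_pos (by exact_mod_cast primeNorm_pos p)]
  exact mul_le_mul_of_nonneg_right (hB p) (Real.rpow_nonneg (primeNorm_pos p).le _)

/-- Multiplying out an Euler product with square-free local factors. -/
lemma dirichletSum_eq_tprod {v : HeightOneSpectrum (𝓞 K) → ℂ} {B : ℝ} (hB : ∀ p, ‖v p‖ ≤ B)
    {z : ℂ} (hz : 1 < z.re) :
    dirichletSum (fun J => ∏ p ∈ J, v p) setNorm z =
      ∏' p, (1 + v p * (primeNorm p : ℂ) ^ (-z)) := by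
  rw [tprod_one_add (summable_finsetProd_of_summable_norm (summable_norm_mul_cpow hB hz)),
    dirichletSum]
  refine tsum_congr fun J => ?_
  rw [Finset.prod_mul_distrib, setNorm, Complex.ofReal_prod]
  simp only [Complex.ofReal_natCast]
  congr 1
  induction J using Finset.cons_induction with
  | empty => simp
  | cons p J hp ih =>
    rw [Finset.prod_cons, Finset.prod_cons, ← ih]
    have e : ∏ q ∈ J, (primeNorm q : ℂ) = ((∏ q ∈ J, (primeNorm q : ℝ) : ℝ) : ℂ) := by
      push_cast; rfl
    rw [e, ← Complex.ofReal_natCast (primeNorm p), Complex.mul_cpow_ofReal_nonneg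
      (primeNorm_pos p).le (b := ∏ q ∈ J, (primeNorm q : ℝ)) (setNorm_pos J).le]

/-- Two convergent products whose factors agree outside a finite set. -/
lemma tprod_mul_prod_eq {ι : Type*} [DecidableEq ι] {a b : ι → ℂ} {S : Finset ι}
    (hab : ∀ i ∉ S, a i = b i) (h : Multipliable fun i => if i ∈ S then 1 else a i) :
    (∏' i, a i) * ∏ i ∈ S, b i = (∏' i, b i) * ∏ i ∈ S, a i := by
  have key : ∀ d : ι → ℂ, (∀ i ∉ S, a i = d i) →
      ∏' i, d i = (∏' i, if i ∈ S then 1 else a i) * ∏ i ∈ S, d i := fun d hd => by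
    have h1 : HasProd (fun i => if i ∈ S then d i else 1) (∏ i ∈ S, if i ∈ S then d i else 1) :=
      hasProd_prod_of_ne_finset_one fun i hi => if_neg hi
    have h2 := (h.hasProd.mul h1).tprod_eq
    rw [Finset.prod_congr rfl fun i hi => if_pos hi] at h2
    rw [← h2]
    refine tprod_congr fun i => ?_
    by_cases hi : i ∈ S
    · simp [hi]
    · simp [hi, hd i hi]
  rw [key a fun _ _ => rfl, key b hab]
  ring

/-- If an Euler product with coefficients `u` continues to `re s ≥ 1`, apart from a simple pole at
`1`, then so does any Euler product with coefficients `v` agreeing with `u` outside a finite set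
`S`, provided that the factors to be divided out do not vanish on `re s = 1`. -/
lemma exists_extendsToLine {u v : HeightOneSpectrum (𝓞 K) → ℂ} {B : ℝ} (hu : ∀ p, ‖u p‖ ≤ B)
    (hv : ∀ p, ‖v p‖ ≤ B) {E : ℝ} {S : Finset (HeightOneSpectrum (𝓞 K))}
    (hS : ∀ p ∉ S, E < primeNorm p ∧ v p = u p)
    (hD : ∀ p ∈ S, E < primeNorm p → ∀ s : ℂ, s.re = 1 → 1 + u p * (primeNorm p : ℂ) ^ (-s) ≠ 0)
    {r : ℂ} (hr : ContinuesWithValue (fun s => (s - 1) * eulerProduct E u s) r) :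
    ∃ (ρ : ℂ) (g : ℂ → ℂ), ExtendsToLine (fun J => ∏ p ∈ J, v p) setNorm ρ g ∧
      ((∀ p ∈ S, v p = 0) → r ≠ 0 → ρ ≠ 0) := by
  classical
  obtain ⟨G, hG, hGe, hG1⟩ := hr
  set num : ℂ → ℂ := fun z => ∏ p ∈ S, (1 + v p * (primeNorm p : ℂ) ^ (-z)) with hnum
  set den : ℂ → ℂ := fun z => ∏ p ∈ S, if E < primeNorm p then
    (1 + u p * (primeNorm p : ℂ) ^ (-z)) else 1 with hden
  have hN0 (p : HeightOneSpectrum (𝓞 K)) : (primeNorm p : ℂ) ≠ 0 := by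
    exact_mod_cast (primeNorm_pos p).ne'
  have hfac (a : ℂ) (p : HeightOneSpectrum (𝓞 K)) :
      Differentiable ℂ fun z : ℂ => 1 + a * (primeNorm p : ℂ) ^ (-z) := by
    intro z
    refine DifferentiableAt.const_add _ (DifferentiableAt.const_mul ?_ _)
    exact DifferentiableAt.const_cpow (by fun_prop) (Or.inl (hN0 p))
  have hnumd : Differentiable ℂ num := fun z => by
    refine DifferentiableAt.fun_finsetProd fun p _ => hfac _ _ z
  have hdend : Differentiable ℂ den := fun z => by
    refine DifferentiableAt.fun_finsetProd fun p _ => ?_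
    by_cases h : E < primeNorm p
    · simpa only [h, if_true] using hfac _ _ z
    · simp only [h, if_false]; fun_prop
  have hden0 : ∀ s : ℂ, s.re = 1 → den s ≠ 0 := fun s hs => by
    rw [hden, Finset.prod_ne_zero_iff]
    intro p hp
    split_ifs with h
    · exact hD p hp h s hs
    · exact one_ne_zero
  -- the factors at the primes in `S` are cleared by cross-multiplying
  have hident : ∀ z : ℂ, 1 < z.re →
      eulerProduct E u z * num z = dirichletSum (fun J => ∏ p ∈ J, v p) setNorm z * den z := by
    intro z hz
    have e1 : eulerProduct E u z = ∏' p, if E < primeNorm p then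
        (1 + u p * (primeNorm p : ℂ) ^ (-z)) else 1 := by
      rw [eulerProduct]
      have := tprod_subtype {p : HeightOneSpectrum (𝓞 K) | E < primeNorm p}
        (fun p => 1 + u p * (primeNorm p : ℂ) ^ (-z))
      refine this.trans (tprod_congr fun p => ?_)
      rw [Set.mulIndicator_apply]
      rfl
    rw [e1, dirichletSum_eq_tprod hv hz]
    refine tprod_mul_prod_eq (fun p hp => ?_) ?_
    · rw [if_pos (hS p hp).1, (hS p hp).2]
    · have hm : Multipliable fun p : HeightOneSpectrum (𝓞 K) =>
          1 + (if p ∈ S then 0 else u p * (primeNorm p : ℂ) ^ (-z)) := by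
        refine multipliable_one_add_of_summable ((summable_norm_mul_cpow hu hz).of_nonneg_of_le
          (fun p => norm_nonneg _) fun p => ?_)
        split_ifs
        · simp only [norm_zero, norm_nonneg]
        · exact le_rfl
      refine hm.congr fun p => ?_
      by_cases hp : p ∈ S
      · simp [hp]
      · simp [hp, (hS p hp).1]
  set H : ℂ → ℂ := fun z => G z * num z / (den z * z) with hH
  have hHd : ∀ s : ℂ, s.re = 1 → DifferentiableAt ℂ H s := fun s hs => by
    have hs0 : s ≠ 0 := by rintro rfl; simp at hs
    exact ((hG s (by simp [hs])).differentiableAt.mul (hnumd s)).div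
      ((hdend s).mul differentiableAt_id) (mul_ne_zero (hden0 s hs) hs0)
  -- the series divided by `z` is `H z / (z - 1)`, so the difference quotient of `H` at `1` removes
  -- the pole
  refine ⟨H 1, dslope H 1, fun s hs => ⟨?_, ?_⟩, fun h0 hr0 => ?_⟩
  · rcases eq_or_ne s 1 with rfl | h1
    · exact continuousAt_dslope_same.2 (hHd 1 (by simp))
    · exact (continuousAt_dslope_of_ne h1).2 (hHd s hs).continuousAt
  · filter_upwards [(hdend s).continuousAt.eventually_ne (hden0 s hs)] with z hz hz1
    have hz' : z ≠ 1 := by rintro rfl; simp at hz1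
    have hz0 : z ≠ 0 := by rintro rfl; norm_num at hz1
    have hz'' : z - 1 ≠ 0 := sub_ne_zero.2 hz'
    rw [dslope_of_ne _ hz', slope_def_field, sub_div]
    congr 1
    have := hident z hz1
    simp only [hH, hGe z hz1]
    field_simp
    linear_combination this
  · simp only [hH, hG1, mul_one]
    refine div_ne_zero (mul_ne_zero hr0 ?_) (hden0 1 (by simp))
    rw [hnum, Finset.prod_ne_zero_iff]
    intro p hp
    simp [h0 p hp]

end Primes

/-! ### Sums over boxes and collisions -/

section Boxes

open scoped Classical

variable {K : Type*} [Field K] [NumberField K]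

/-- The finite sets `J` of primes whose norm is at most `y`, and equal to `y` if `t` holds. -/
def window (K : Type*) [Field K] [NumberField K] (t : Prop) (y : ℝ) :
    Finset (Finset (HeightOneSpectrum (𝓞 K))) :=
  (Set.Finite.subset (finite_setNorm_le (K := K) y) fun _ h => h.2 :
    {J | (t → setNorm J = y) ∧ setNorm J ≤ y}.Finite).toFinset

lemma mem_window {t : Prop} {y : ℝ} {J : Finset (HeightOneSpectrum (𝓞 K))} :
    J ∈ window K t y ↔ (t → setNorm J = y) ∧ setNorm J ≤ y := by
  simp [window]

/-- The sum of `∏_{p ∈ J} v_p` over the finite sets `J` of primes in a window. -/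
def windowSum {R : Type*} [CommSemiring R] (t : Prop) (v : HeightOneSpectrum (𝓞 K) → R) (y : ℝ) :
    R :=
  ∑ J ∈ window K t y, ∏ p ∈ J, v p

lemma partialSum_eq_windowSum {E : Type*} [NormedCommRing E]
    (v : HeightOneSpectrum (𝓞 K) → E) (y : ℝ) :
    partialSum (fun J => ∏ p ∈ J, v p) setNorm y = windowSum False v y := by
  rw [partialSum, windowSum, tsum_eq_sum (s := window K False y)]
  · exact Finset.sum_congr rfl fun J hJ => if_pos (mem_window.1 hJ).2
  · intro J hJ
    exact if_neg fun h => hJ (mem_window.2 ⟨False.elim, h⟩)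

lemma windowSum_nonneg {t : Prop} {v : HeightOneSpectrum (𝓞 K) → ℝ} (hv : ∀ p, 0 ≤ v p) (y : ℝ) :
    0 ≤ windowSum t v y :=
  Finset.sum_nonneg fun _ _ => Finset.prod_nonneg fun p _ => hv p

lemma windowSum_le {t : Prop} {v : HeightOneSpectrum (𝓞 K) → ℝ} (hv : ∀ p, 0 ≤ v p) (y : ℝ) :
    windowSum t v y ≤ windowSum False v y :=
  Finset.sum_le_sum_of_subset_of_nonneg
    (fun _ hJ => mem_window.2 ⟨False.elim, (mem_window.1 hJ).2⟩)
    fun _ _ _ => Finset.prod_nonneg fun p _ => hv p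

lemma windowSum_of_lt_one {R : Type*} [CommSemiring R] {t : Prop}
    (v : HeightOneSpectrum (𝓞 K) → R) {y : ℝ} (hy : y < 1) : windowSum t v y = 0 :=
  Finset.sum_eq_zero fun J hJ =>
    absurd ((one_le_setNorm J).trans (mem_window.1 hJ).2) (not_le.2 hy)

lemma setNorm_insert {p : HeightOneSpectrum (𝓞 K)} {J : Finset (HeightOneSpectrum (𝓞 K))}
    (hp : p ∉ J) : setNorm (insert p J) = primeNorm p * setNorm J := by
  rw [setNorm, Finset.prod_insert hp, setNorm]

lemma insert_mem_window {t : Prop} {y : ℝ} {p : HeightOneSpectrum (𝓞 K)}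
    {J : Finset (HeightOneSpectrum (𝓞 K))} (hp : p ∉ J) :
    insert p J ∈ window K t y ↔ J ∈ window K t (y / primeNorm p) := by
  have := primeNorm_pos p
  rw [mem_window, mem_window, setNorm_insert hp, eq_div_iff this.ne', le_div_iff₀ this,
    mul_comm]

lemma setNorm_eq_one {J : Finset (HeightOneSpectrum (𝓞 K))} : setNorm J = 1 ↔ J = ∅ := by
  refine ⟨fun h => Finset.eq_empty_of_forall_notMem fun p hp => ?_, fun h => by simp [h, setNorm]⟩
  have := primeNorm_le_setNorm hp
  rw [h] at this
  exact absurd (one_lt_primeNorm p) (not_lt.2 this)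

lemma windowSum_one {R : Type*} [CommSemiring R] {t : Prop}
    (v : HeightOneSpectrum (𝓞 K) → R) : windowSum t v 1 = 1 := by
  have : window K t 1 = {∅} := by
    ext J
    rw [mem_window, Finset.mem_singleton, ← setNorm_eq_one]
    exact ⟨fun h => le_antisymm h.2 (one_le_setNorm J), fun h => ⟨fun _ => h, h.le⟩⟩
  rw [windowSum, this]
  simp

/-- The part of a window sum coming from the sets containing a given prime. -/
lemma sum_window_mem_le {t : Prop} {v : HeightOneSpectrum (𝓞 K) → ℝ} (hv : ∀ p, 0 ≤ v p)
    (p : HeightOneSpectrum (𝓞 K)) (y : ℝ) :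
    ∑ J ∈ window K t y, (if p ∈ J then ∏ q ∈ J, v q else 0) ≤
      v p * windowSum t v (y / primeNorm p) := by
  rw [← Finset.sum_filter, windowSum, Finset.mul_sum]
  have h1 : ∀ J ∈ (window K t y).filter (fun J => p ∈ J),
      ∏ q ∈ J, v q = v p * ∏ q ∈ J.erase p, v q := fun J hJ =>
    (Finset.mul_prod_erase _ _ (Finset.mem_filter.1 hJ).2).symm
  rw [Finset.sum_congr rfl h1]
  have hinj : Set.InjOn (fun J : Finset (HeightOneSpectrum (𝓞 K)) => J.erase p)
      ((window K t y).filter (fun J => p ∈ J) : Finset _) := fun J hJ J' hJ' h => by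
    rw [← Finset.insert_erase (Finset.mem_filter.1 hJ).2,
      ← Finset.insert_erase (Finset.mem_filter.1 hJ').2]
    exact congrArg _ h
  rw [← Finset.sum_image (f := fun J => v p * ∏ q ∈ J, v q) hinj]
  refine Finset.sum_le_sum_of_subset_of_nonneg (fun J hJ => ?_)
    fun J _ _ => mul_nonneg (hv p) (Finset.prod_nonneg fun q _ => hv q)
  obtain ⟨J', hJ', rfl⟩ := Finset.mem_image.1 hJ
  rw [Finset.mem_filter] at hJ'
  rw [← insert_mem_window (Finset.notMem_erase p J'), Finset.insert_erase hJ'.2]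
  exact hJ'.1

variable {m : ℕ} {P : Type*}

/-- The tuples of finite sets of primes whose norms lie in the box with corner `X`, the coordinates
in `T` being prescribed exactly. -/
def box (K : Type*) [Field K] [NumberField K] (T : Finset (Fin m)) (X : Fin m → ℝ) :
    Finset (Fin m → Finset (HeightOneSpectrum (𝓞 K))) :=
  Fintype.piFinset fun i => window K (i ∈ T) (X i)

/-- The prime `p` belongs to at most one of the sets `J_i`. -/
def DisjointAt (J : Fin m → Finset P) (p : P) : Prop :=
  ∀ i j, p ∈ J i → p ∈ J j → i = j

/-- The coefficient of the monomial encoded by the tuple `J` in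
`∏_{p ∈ S} (b_p + ∑_i c_{p,i} q_{p,i}) ∏_{p ∉ S} ∏_i (1 + c_{p,i} q_{p,i})`. -/
def weight (S : Finset P) (b : P → ℂ)
    (c : P → Fin m → ℂ) (J : Fin m → Finset P) : ℂ :=
  if ∀ p ∈ S, DisjointAt J p then
    (∏ i, ∏ p ∈ J i, c p i) * ∏ p ∈ S, (if ∃ i, p ∈ J i then 1 else b p) else 0

/-- The sum over a box of the coefficients of
`∏_{p ∈ S} (b_p + ∑_i c_{p,i} N(p)^{-s_i}) ∏_{p ∉ S} ∏_i (1 + c_{p,i} N(p)^{-s_i})`. -/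
def boxSum (T : Finset (Fin m)) (S : Finset (HeightOneSpectrum (𝓞 K)))
    (b : HeightOneSpectrum (𝓞 K) → ℂ) (c : HeightOneSpectrum (𝓞 K) → Fin m → ℂ)
    (X : Fin m → ℝ) : ℂ :=
  ∑ J ∈ box K T X, weight S b c J

/-- The coefficients `c` with those at the primes in `S` replaced by zero. -/
def kill {R : Type*} [Zero R] (S : Finset P)
    (c : P → Fin m → R) : P → Fin m → R :=
  fun p i => if p ∈ S then 0 else c p i

lemma kill_empty {R : Type*} [Zero R] (c : P → Fin m → R) :
    kill ∅ c = c := by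
  ext p i; simp [kill]

lemma kill_singleton_kill {R : Type*} [Zero R] (S : Finset P)
    (p : P) (c : P → Fin m → R) :
    kill {p} (kill S c) = kill (insert p S) c := by
  ext q i
  by_cases h1 : q = p <;> by_cases h2 : q ∈ S <;> simp [kill, h1, h2]

lemma boxSum_empty (T : Finset (Fin m)) (b : HeightOneSpectrum (𝓞 K) → ℂ)
    (c : HeightOneSpectrum (𝓞 K) → Fin m → ℂ) (X : Fin m → ℝ) :
    boxSum T ∅ b c X = ∏ i, windowSum (i ∈ T) (fun p => c p i) (X i) := by
  simp only [boxSum, weight, windowSum, Finset.prod_univ_sum, box]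
  simp

lemma weight_eq_zero {S : Finset P} {b : P → ℂ}
    {c : P → Fin m → ℂ} {J : Fin m → Finset P}
    {p : P} {i : Fin m} (hp : p ∈ J i) (hc : c p i = 0) :
    weight S b c J = 0 := by
  have : ∏ i, ∏ p ∈ J i, c p i = 0 :=
    Finset.prod_eq_zero (Finset.mem_univ i) (Finset.prod_eq_zero hp hc)
  simp [weight, this]

lemma prod_kill {p : P} (c : P → Fin m → ℂ)
    {J : Fin m → Finset P} (hJ : ∀ i, p ∉ J i) :
    ∏ i, ∏ q ∈ J i, kill {p} c q i = ∏ i, ∏ q ∈ J i, c q i := by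
  refine Finset.prod_congr rfl fun i _ => Finset.prod_congr rfl fun q hq => ?_
  have : q ≠ p := by rintro rfl; exact hJ i hq
  simp [kill, this]

lemma weight_insert_of_notMem {S : Finset P}
    {b : P → ℂ} {c : P → Fin m → ℂ}
    {J : Fin m → Finset P} {p : P} (hpS : p ∉ S)
    (hJ : ∀ i, p ∉ J i) :
    weight (insert p S) b c J = b p * weight S b (kill {p} c) J := by
  have hd : DisjointAt J p := fun i j hi _ => absurd hi (hJ i)
  simp only [weight, Finset.forall_mem_insert, hd, true_and, prod_kill c hJ,
    Finset.prod_insert hpS, hJ, exists_false, if_false]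
  split_ifs
  · ring
  · simp

lemma weight_insert_update {S : Finset P}
    {b : P → ℂ} {c : P → Fin m → ℂ}
    {J : Fin m → Finset P} {p : P} (hpS : p ∉ S)
    (hJ : ∀ i, p ∉ J i) (i : Fin m) :
    weight (insert p S) b c (Function.update J i (insert p (J i))) =
      c p i * weight S b (kill {p} c) J := by
  set J' := Function.update J i (insert p (J i)) with hJ'
  have hmem : ∀ q ≠ p, ∀ j, q ∈ J' j ↔ q ∈ J j := fun q hq j => by
    rcases eq_or_ne j i with rfl | hj
    · simp [hJ', hq]
    · simp [hJ', hj]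
  have hp : ∀ j, p ∈ J' j ↔ j = i := fun j => by
    rcases eq_or_ne j i with rfl | hj
    · simp [hJ']
    · simp [hJ', hj, hJ]
  have hne : ∀ q ∈ S, q ≠ p := fun q hq => by rintro rfl; exact hpS hq
  have hd : DisjointAt J' p := fun j k hj hk => ((hp j).1 hj).trans ((hp k).1 hk).symm
  have hdS : (∀ q ∈ S, DisjointAt J' q) ↔ ∀ q ∈ S, DisjointAt J q :=
    forall₂_congr fun q hq => by simp only [DisjointAt, hmem q (hne q hq)]
  have hprod : ∏ j, ∏ q ∈ J' j, c q j = c p i * ∏ j, ∏ q ∈ J j, c q j := by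
    rw [← Finset.mul_prod_erase _ _ (Finset.mem_univ i),
      ← Finset.mul_prod_erase _ (fun j => ∏ q ∈ J j, c q j) (Finset.mem_univ i), ← mul_assoc]
    congr 1
    · simp [hJ', Finset.prod_insert (hJ i)]
    · refine Finset.prod_congr rfl fun j hj => ?_
      simp [hJ', Finset.ne_of_mem_erase hj]
  have hb : ∏ q ∈ S, (if ∃ j, q ∈ J' j then 1 else b q) =
      ∏ q ∈ S, (if ∃ j, q ∈ J j then 1 else b q) :=
    Finset.prod_congr rfl fun q hq => by simp only [hmem q (hne q hq)]
  simp only [weight, Finset.forall_mem_insert, hd, true_and, hdS, hprod, prod_kill c hJ,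
    Finset.prod_insert hpS, hp, exists_eq, if_true, hb]
  split_ifs
  · ring
  · simp

/-- Splitting off the factor at one prime. -/
lemma boxSum_insert (T : Finset (Fin m)) {S : Finset (HeightOneSpectrum (𝓞 K))}
    (b : HeightOneSpectrum (𝓞 K) → ℂ) (c : HeightOneSpectrum (𝓞 K) → Fin m → ℂ)
    {p : HeightOneSpectrum (𝓞 K)} (hpS : p ∉ S) (X : Fin m → ℝ) :
    boxSum T (insert p S) b c X = b p * boxSum T S b (kill {p} c) X +
      ∑ i, c p i * boxSum T S b (kill {p} c) (Function.update X i (X i / primeNorm p)) := by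
  have hkill : ∀ i, kill {p} c p i = 0 := fun i => by simp [kill]
  have hsplit : ∀ J ∈ box K T X, weight (insert p S) b c J =
      b p * weight S b (kill {p} c) J +
        ∑ i, if p ∈ J i ∧ DisjointAt J p then weight (insert p S) b c J else 0 := by
    intro J _
    by_cases h : ∀ i, p ∉ J i
    · simp [weight_insert_of_notMem hpS h, h]
    · push Not at h
      obtain ⟨i, hi⟩ := h
      rw [weight_eq_zero hi (hkill i), mul_zero, zero_add]
      by_cases hd : DisjointAt J p
      · rw [Finset.sum_eq_single i, if_pos ⟨hi, hd⟩]
        · exact fun j _ hj => if_neg fun h => hj (hd j i h.1 hi)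
        · exact fun h => absurd (Finset.mem_univ i) h
      · simp [hd, weight]
  rw [boxSum, Finset.sum_congr rfl hsplit, Finset.sum_add_distrib, ← Finset.mul_sum,
    Finset.sum_comm]
  congr 1
  refine Finset.sum_congr rfl fun i _ => ?_
  rw [boxSum, ← Finset.sum_filter]
  have hz : ∑ J ∈ box K T (Function.update X i (X i / primeNorm p)), weight S b (kill {p} c) J =
      ∑ J ∈ (box K T (Function.update X i (X i / primeNorm p))).filter (fun J => ∀ j, p ∉ J j),
        weight S b (kill {p} c) J := by
    rw [Finset.sum_filter]
    refine Finset.sum_congr rfl fun J _ => ?_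
    split_ifs with h
    · rfl
    · push Not at h
      obtain ⟨j, hj⟩ := h
      exact weight_eq_zero hj (hkill j)
  rw [hz, Finset.mul_sum]
  refine Finset.sum_nbij' (fun J => Function.update J i ((J i).erase p))
    (fun J => Function.update J i (insert p (J i))) ?_ ?_ ?_ ?_ ?_
  · intro J hJ
    simp only [Finset.mem_filter, box, Fintype.mem_piFinset] at hJ ⊢
    obtain ⟨hJ, hpi, hd⟩ := hJ
    refine ⟨fun j => ?_, fun j => ?_⟩
    · rcases eq_or_ne j i with rfl | hj
      · simp only [Function.update_self]
        rw [← insert_mem_window (Finset.notMem_erase p _), Finset.insert_erase hpi]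
        exact hJ j
      · simpa [hj] using hJ j
    · rcases eq_or_ne j i with rfl | hj
      · simp
      · simpa [hj] using fun h => hj (hd j i h hpi)
  · intro J hJ
    simp only [Finset.mem_filter, box, Fintype.mem_piFinset] at hJ ⊢
    obtain ⟨hJ, hpi⟩ := hJ
    refine ⟨fun j => ?_, by simp, fun j k hj hk => ?_⟩
    · rcases eq_or_ne j i with rfl | hj
      · have := hJ j
        simp only [Function.update_self] at this ⊢
        exact (insert_mem_window (hpi j)).2 this
      · simpa [hj] using hJ j
    · have : ∀ j, p ∈ Function.update J i (insert p (J i)) j → j = i := fun j hj => by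
        by_contra hne
        simp [hne, hpi] at hj
      rw [this j hj, this k hk]
  · intro J hJ
    simp only [Finset.mem_filter] at hJ
    simp [Finset.insert_erase hJ.2.1]
  · intro J hJ
    simp only [Finset.mem_filter] at hJ
    simp [Finset.erase_insert (hJ.2 i)]
  · intro J hJ
    simp only [Finset.mem_filter] at hJ
    have hni : ∀ j, p ∉ Function.update J i ((J i).erase p) j := fun j => by
      rcases eq_or_ne j i with rfl | hj
      · simp
      · simpa [hj] using fun h => hj (hJ.2.2 j i h hJ.2.1)
    rw [← weight_insert_update hpS hni i]
    congr 1
    simp [Finset.insert_erase hJ.2.1]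

/-- The majorant for the coefficients of the tuples in which `p` occurs in both `J_i` and `J_j`. -/
def collision (T : Finset (Fin m)) (c' : HeightOneSpectrum (𝓞 K) → Fin m → ℝ) (X : Fin m → ℝ)
    (p : HeightOneSpectrum (𝓞 K)) (i j : Fin m) : ℝ :=
  ∏ l, if l = i ∨ l = j then c' p l * windowSum (l ∈ T) (fun q => c' q l) (X l / primeNorm p)
    else windowSum (l ∈ T) (fun q => c' q l) (X l)

lemma collision_nonneg (T : Finset (Fin m)) {c' : HeightOneSpectrum (𝓞 K) → Fin m → ℝ}
    (hc' : ∀ p i, 0 ≤ c' p i) (X : Fin m → ℝ) (p : HeightOneSpectrum (𝓞 K)) (i j : Fin m) :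
    0 ≤ collision T c' X p i j :=
  Finset.prod_nonneg fun l _ => by
    split_ifs
    · exact mul_nonneg (hc' _ _) (windowSum_nonneg (fun q => hc' q l) _)
    · exact windowSum_nonneg (fun q => hc' q l) _

lemma sum_box_mem_mem_le (T : Finset (Fin m)) {c' : HeightOneSpectrum (𝓞 K) → Fin m → ℝ}
    (hc' : ∀ p i, 0 ≤ c' p i) (X : Fin m → ℝ) (p : HeightOneSpectrum (𝓞 K)) (i j : Fin m) :
    ∑ J ∈ box K T X, (if p ∈ J i ∧ p ∈ J j then ∏ l, ∏ q ∈ J l, c' q l else 0) ≤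
      collision T c' X p i j := by
  have h1 : ∀ J ∈ box K T X, (if p ∈ J i ∧ p ∈ J j then ∏ l, ∏ q ∈ J l, c' q l else 0) =
      ∏ l, if (l = i ∨ l = j) then (if p ∈ J l then ∏ q ∈ J l, c' q l else 0)
        else ∏ q ∈ J l, c' q l := fun J _ => by
    split_ifs with h
    · refine Finset.prod_congr rfl fun l _ => ?_
      split_ifs with hl hpl
      · rfl
      · rcases hl with rfl | rfl
        · exact absurd h.1 hpl
        · exact absurd h.2 hpl
      · rfl
    · rw [not_and_or] at h
      rcases h with h | h
      · exact (Finset.prod_eq_zero (Finset.mem_univ i) (by simp [h])).symm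
      · exact (Finset.prod_eq_zero (Finset.mem_univ j) (by simp [h])).symm
  rw [Finset.sum_congr rfl h1, box, ← Finset.prod_univ_sum (fun l => window K (l ∈ T) (X l))
    (fun l A => if (l = i ∨ l = j) then (if p ∈ A then ∏ q ∈ A, c' q l else 0)
        else ∏ q ∈ A, c' q l)]
  refine Finset.prod_le_prod (fun l _ => Finset.sum_nonneg fun A _ => ?_) fun l _ => ?_
  · have := Finset.prod_nonneg fun q (_ : q ∈ A) => hc' q l
    split_ifs <;> first | exact this | exact le_rfl
  · split_ifs
    · exact sum_window_mem_le (fun q => hc' q l) p _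
    · exact le_rfl

/-- Replacing the local factors `∏_i (1 + c_{p,i} q_{p,i})` by `1 + ∑_i c_{p,i} q_{p,i}` at further
primes only affects tuples with a collision at one of these primes. -/
lemma norm_boxSum_sub_le (T : Finset (Fin m)) {S S' : Finset (HeightOneSpectrum (𝓞 K))}
    (hSS' : S ⊆ S') {b : HeightOneSpectrum (𝓞 K) → ℂ} (hb : ∀ p ∉ S, b p = 1)
    {c : HeightOneSpectrum (𝓞 K) → Fin m → ℂ} {c' : HeightOneSpectrum (𝓞 K) → Fin m → ℝ}
    (hc : ∀ p i, ‖c p i‖ ≤ c' p i) {M : ℝ} (hM : ∏ p ∈ S, max 1 ‖b p‖ ≤ M) (X : Fin m → ℝ) :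
    ‖boxSum T S' b c X - boxSum T S b c X‖ ≤
      M * ∑ p ∈ S' \ S, ∑ ij ∈ (Finset.univ : Finset (Fin m)).offDiag,
        collision T c' X p ij.1 ij.2 := by
  have hc' : ∀ p i, 0 ≤ c' p i := fun p i => (norm_nonneg _).trans (hc p i)
  have hM0 : 0 ≤ M := (Finset.prod_nonneg fun p _ => by positivity).trans hM
  have hpt : ∀ J ∈ box K T X, ‖weight S' b c J - weight S b c J‖ ≤
      M * ∑ p ∈ S' \ S, ∑ ij ∈ (Finset.univ : Finset (Fin m)).offDiag,
        (if p ∈ J ij.1 ∧ p ∈ J ij.2 then ∏ l, ∏ q ∈ J l, c' q l else 0) := by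
    intro J _
    have hprod0 : 0 ≤ ∏ l, ∏ q ∈ J l, c' q l :=
      Finset.prod_nonneg fun l _ => Finset.prod_nonneg fun q _ => hc' q l
    have hrhs : 0 ≤ ∑ p ∈ S' \ S, ∑ ij ∈ (Finset.univ : Finset (Fin m)).offDiag,
        (if p ∈ J ij.1 ∧ p ∈ J ij.2 then ∏ l, ∏ q ∈ J l, c' q l else 0) :=
      Finset.sum_nonneg fun p _ => Finset.sum_nonneg fun ij _ => by split_ifs <;> simp [hprod0]
    by_cases hS : ∀ p ∈ S, DisjointAt J p
    · by_cases hS' : ∀ p ∈ S', DisjointAt J p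
      · have : ∏ p ∈ S', (if ∃ i, p ∈ J i then 1 else b p) =
            ∏ p ∈ S, (if ∃ i, p ∈ J i then 1 else b p) :=
          (Finset.prod_subset hSS' fun p _ hp => by simp [hb p hp]).symm
        rw [weight, weight, if_pos hS, if_pos hS', this, sub_self, norm_zero]
        exact mul_nonneg hM0 hrhs
      · push Not at hS'
        obtain ⟨p, hpS', hp⟩ := hS'
        have hpS : p ∈ S' \ S := Finset.mem_sdiff.2 ⟨hpS', fun h => hp (hS p h)⟩
        simp only [DisjointAt, not_forall] at hp
        obtain ⟨i, j, hi, hj, hij⟩ := hp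
        have hS'n : ¬ ∀ p ∈ S', DisjointAt J p := fun h => hij (h p hpS' i j hi hj)
        rw [weight, weight, if_neg hS'n, if_pos hS, zero_sub, norm_neg, norm_mul, mul_comm]
        have h1 : ‖∏ p ∈ S, (if ∃ i, p ∈ J i then 1 else b p)‖ ≤ M := by
          rw [norm_prod]
          refine (Finset.prod_le_prod (fun p _ => norm_nonneg _) fun p _ => ?_).trans hM
          split_ifs <;> simp
        have h2 : ‖∏ i, ∏ p ∈ J i, c p i‖ ≤ ∏ l, ∏ q ∈ J l, c' q l := by
          rw [norm_prod]
          refine Finset.prod_le_prod (fun p _ => norm_nonneg _) fun l _ => ?_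
          rw [norm_prod]
          exact Finset.prod_le_prod (fun p _ => norm_nonneg _) fun q _ => hc q l
        refine mul_le_mul h1 (h2.trans ?_) (norm_nonneg _) hM0
        refine le_trans ?_ (Finset.single_le_sum (f := fun p =>
          ∑ ij ∈ (Finset.univ : Finset (Fin m)).offDiag,
          (if p ∈ J ij.1 ∧ p ∈ J ij.2 then ∏ l, ∏ q ∈ J l, c' q l else 0))
          (fun p _ => Finset.sum_nonneg fun ij _ => by split_ifs <;> simp [hprod0]) hpS)
        refine le_trans ?_ (Finset.single_le_sum (f := fun ij : Fin m × Fin m =>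
          (if p ∈ J ij.1 ∧ p ∈ J ij.2 then ∏ l, ∏ q ∈ J l, c' q l else 0))
          (fun ij _ => by split_ifs <;> simp [hprod0])
          (show (i, j) ∈ Finset.univ.offDiag by simpa using hij))
        simp [hi, hj]
    · have hS' : ¬ ∀ p ∈ S', DisjointAt J p := fun h => hS fun p hp => h p (hSS' hp)
      rw [weight, weight, if_neg hS, if_neg hS', sub_self, norm_zero]
      exact mul_nonneg hM0 hrhs
  rw [boxSum, boxSum, ← Finset.sum_sub_distrib]
  refine (norm_sum_le_of_le _ hpt).trans ?_
  rw [← Finset.mul_sum]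
  refine mul_le_mul_of_nonneg_left ?_ hM0
  rw [Finset.sum_comm]
  refine Finset.sum_le_sum fun p _ => ?_
  rw [Finset.sum_comm]
  exact Finset.sum_le_sum fun ij _ => sum_box_mem_mem_le T hc' X p ij.1 ij.2

end Boxes

/-! ### Existence of mean values -/

section MeanValues

open scoped Classical

variable {K : Type*} [Field K] [NumberField K] {m : ℕ}

/-- The filter describing `X_i → ∞` for `i ∉ T`, while `X_i = v_i` for `i ∈ T`. -/
def cornerFilter (T : Finset (Fin m)) (v : Fin m → ℝ) : Filter (Fin m → ℝ) :=
  Filter.pi fun i => if i ∈ T then pure (v i) else atTop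

instance (T : Finset (Fin m)) (v : Fin m → ℝ) : NeBot (cornerFilter T v) := by
  have : ∀ i, NeBot (if i ∈ T then pure (v i) else (atTop : Filter ℝ)) := fun i => by
    split_ifs <;> infer_instance
  unfold cornerFilter
  infer_instance

lemma tendsto_eval_cornerFilter (T : Finset (Fin m)) (v : Fin m → ℝ) (i : Fin m) :
    Tendsto (fun X : Fin m → ℝ => X i) (cornerFilter T v)
      (if i ∈ T then pure (v i) else atTop) :=
  tendsto_eval_pi _ i

lemma eventually_cornerFilter_eq {T : Finset (Fin m)} (v : Fin m → ℝ) {i : Fin m} (hi : i ∈ T) :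
    ∀ᶠ X in cornerFilter T v, X i = v i := by
  have h := tendsto_eval_cornerFilter T v i
  rw [if_pos hi] at h
  exact tendsto_pure.1 h

lemma tendsto_cornerFilter_atTop {T : Finset (Fin m)} (v : Fin m → ℝ) {i : Fin m} (hi : i ∉ T) :
    Tendsto (fun X : Fin m → ℝ => X i) (cornerFilter T v) atTop := by
  have h := tendsto_eval_cornerFilter T v i
  rwa [if_neg hi] at h

lemma eventually_cornerFilter_pos {T : Finset (Fin m)} {v : Fin m → ℝ} (hv : ∀ i ∈ T, 0 < v i) :
    ∀ᶠ X in cornerFilter T v, ∀ i, 0 < X i := by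
  rw [eventually_all]
  intro i
  by_cases hi : i ∈ T
  · filter_upwards [eventually_cornerFilter_eq v hi] with X hX
    rw [hX]
    exact hv i hi
  · exact (tendsto_cornerFilter_atTop v hi).eventually (eventually_gt_atTop 0)

lemma tendsto_cornerFilter_iff {α : Type*} {l : Filter α} {T : Finset (Fin m)} {v : Fin m → ℝ}
    {f : α → Fin m → ℝ} : Tendsto f l (cornerFilter T v) ↔
      ∀ i, Tendsto (fun a => f a i) l (if i ∈ T then pure (v i) else atTop) :=
  tendsto_pi

lemma tendsto_div_cornerFilter (T : Finset (Fin m)) (v d : Fin m → ℝ) (hd : ∀ i, 0 < d i) :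
    Tendsto (fun X : Fin m → ℝ => fun i => X i / d i) (cornerFilter T v)
      (cornerFilter T fun i => v i / d i) := by
  rw [tendsto_cornerFilter_iff]
  intro i
  by_cases hi : i ∈ T
  · rw [if_pos hi, tendsto_pure]
    filter_upwards [eventually_cornerFilter_eq v hi] with X hX
    rw [hX]
  · rw [if_neg hi]
    exact (tendsto_cornerFilter_atTop v hi).atTop_div_const (hd i)

lemma update_div_eq (X : Fin m → ℝ) (i : Fin m) (a : ℝ) :
    Function.update X i (X i / a) = fun j => X j / (if j = i then a else 1) := by
  ext j
  rcases eq_or_ne j i with rfl | hj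
  · simp
  · simp [hj]

/-- A limit exists if the function can be approximated uniformly, up to any error, by functions
having a limit. -/
lemma exists_tendsto_of_approx {α : Type*} {l : Filter α} [NeBot l] {f : α → ℂ}
    (h : ∀ ε > 0, ∃ (g : α → ℂ) (C : ℂ), Tendsto g l (𝓝 C) ∧ ∀ᶠ x in l, ‖f x - g x‖ ≤ ε) :
    ∃ C, Tendsto f l (𝓝 C) := by
  rw [← cauchy_map_iff_exists_tendsto, Metric.cauchy_iff]
  refine ⟨inferInstance, fun ε hε => ?_⟩
  obtain ⟨g, C, hg, hfg⟩ := h (ε / 5) (by positivity)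
  refine ⟨Metric.ball C (2 * ε / 5), ?_, fun x hx y hy => ?_⟩
  · rw [mem_map]
    filter_upwards [hfg, hg (Metric.ball_mem_nhds C (ε := ε / 5) (by positivity))] with x h1 h2
    rw [Set.mem_preimage, Metric.mem_ball] at h2 ⊢
    calc dist (f x) C ≤ dist (f x) (g x) + dist (g x) C := dist_triangle _ _ _
      _ < ε / 5 + ε / 5 := by rw [dist_eq_norm]; linarith
      _ = 2 * ε / 5 := by ring
  · rw [Metric.mem_ball] at hx hy
    linarith [dist_triangle_right x y C]

lemma tendsto_windowSum_div {T : Finset (Fin m)} (v : Fin m → ℝ) (i : Fin m)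
    {u : HeightOneSpectrum (𝓞 K) → ℂ} {ρ : ℂ}
    (h : Tendsto (fun y : ℝ => windowSum False u y / (y : ℂ)) atTop (𝓝 ρ)) :
    Tendsto (fun X : Fin m → ℝ => windowSum (i ∈ T) u (X i) / (X i : ℂ)) (cornerFilter T v)
      (𝓝 (if i ∈ T then windowSum True u (v i) / (v i : ℂ) else ρ)) := by
  by_cases hi : i ∈ T
  · simp only [hi, if_true]
    refine tendsto_nhds_of_eventually_eq ?_
    filter_upwards [eventually_cornerFilter_eq v hi] with X hX
    rw [hX]
  · simp only [hi, if_false]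
    exact h.comp (tendsto_cornerFilter_atTop v hi)

/-- The box sums in which only finitely many local factors differ from a product over the
variables have a mean value. Each prime of `S` split off rescales one coordinate of the corner,
also a prescribed one; so the statement is for all `v`, and for coefficients vanishing on an
arbitrary set `U`, where the primes split off are collected. -/
lemma exists_tendsto_boxSum_div {S₀ : Finset (HeightOneSpectrum (𝓞 K))}
    (b : HeightOneSpectrum (𝓞 K) → ℂ) {c : HeightOneSpectrum (𝓞 K) → Fin m → ℂ}
    (hlim : ∀ U, S₀ ⊆ U → ∀ i, ∃ ρ : ℂ, Tendsto
      (fun y : ℝ => windowSum False (fun p => kill U c p i) y / (y : ℂ)) atTop (𝓝 ρ))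
    (T : Finset (Fin m)) (S : Finset (HeightOneSpectrum (𝓞 K))) :
    ∀ U, S₀ ⊆ S ∪ U → ∀ v : Fin m → ℝ,
      ∃ C : ℂ, Tendsto (fun X : Fin m → ℝ => boxSum T S b (kill U c) X / ∏ i, (X i : ℂ))
        (cornerFilter T v) (𝓝 C) := by
  induction S using Finset.induction_on with
  | empty =>
    intro U hU v
    choose ρ hρ using hlim U (by simpa using hU)
    have h := tendsto_finsetProd Finset.univ fun i _ =>
      tendsto_windowSum_div (T := T) v i (hρ i)
    exact ⟨_, h.congr fun X => by rw [boxSum_empty, Finset.prod_div_distrib]⟩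
  | insert p S hp ih =>
    intro U hU v
    have hU' : S₀ ⊆ S ∪ insert p U := by
      rwa [Finset.union_insert, ← Finset.insert_union]
    have hN := primeNorm_pos p
    obtain ⟨C₀, hC₀⟩ := ih (insert p U) hU' v
    choose C hC using fun i => ih (insert p U) hU' fun j =>
      v j / (if j = i then (primeNorm p : ℝ) else 1)
    refine ⟨b p * C₀ + ∑ i, kill U c p i * ((primeNorm p : ℂ)⁻¹ * C i), ?_⟩
    have h1 := (hC₀.const_mul (b p)).add (tendsto_finsetSum Finset.univ fun i _ =>
      (((hC i).comp (tendsto_div_cornerFilter T v (fun j => if j = i then primeNorm p else 1)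
        fun j => by split_ifs <;> simp [hN])).const_mul
          ((primeNorm p : ℂ)⁻¹)).const_mul (kill U c p i))
    refine h1.congr fun X => ?_
    rw [boxSum_insert T b _ hp, kill_singleton_kill, add_div, mul_div_assoc, Finset.sum_div]
    congr 1
    refine Finset.sum_congr rfl fun i _ => ?_
    rw [Function.comp_apply, update_div_eq, mul_div_assoc]
    have : ∏ j, ((X j / (if j = i then (primeNorm p : ℝ) else 1) : ℝ) : ℂ) =
        (primeNorm p : ℂ)⁻¹ * ∏ j, (X j : ℂ) := by
      push_cast
      rw [Finset.prod_div_distrib, div_eq_inv_mul]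
      congr 2
      rw [← Complex.ofReal_prod, Finset.prod_ite_eq']
      simp
    rw [this]
    have hN' : (primeNorm p : ℂ) ≠ 0 := by exact_mod_cast hN.ne'
    field_simp

/-- Two of the coordinates are divided by `N(p)`, which saves a factor `N(p)^{-2}`. -/
lemma collision_le (T : Finset (Fin m)) {c' : HeightOneSpectrum (𝓞 K) → Fin m → ℝ}
    (hc' : ∀ p i, 0 ≤ c' p i) {B C : ℝ} (hB : ∀ p i, c' p i ≤ B)
    (hC : ∀ i y, 0 ≤ y → windowSum False (fun p => c' p i) y ≤ C * y) {X : Fin m → ℝ}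
    (hX : ∀ i, 0 ≤ X i) (p : HeightOneSpectrum (𝓞 K)) {i j : Fin m} (hij : i ≠ j) :
    collision T c' X p i j ≤ C ^ m * B ^ 2 * (primeNorm p : ℝ) ^ (-2 : ℝ) * ∏ l, X l := by
  have hN := primeNorm_pos p
  have hB0 : 0 ≤ B := (hc' p i).trans (hB p i)
  have hW : ∀ l y, 0 ≤ y → windowSum (l ∈ T) (fun q => c' q l) y ≤ C * y := fun l y hy =>
    (windowSum_le (fun q => hc' q l) y).trans (hC l y hy)
  have h1 : collision T c' X p i j ≤
      ∏ l, (if l = i ∨ l = j then B / primeNorm p else 1) * (C * X l) := by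
    refine Finset.prod_le_prod (fun l _ => ?_) fun l _ => ?_
    · have h1 := windowSum_nonneg (t := l ∈ T) (fun q => hc' q l) (X l / primeNorm p)
      have h2 := windowSum_nonneg (t := l ∈ T) (fun q => hc' q l) (X l)
      have := hc' p l
      split_ifs <;> positivity
    · split_ifs
      · refine (mul_le_mul (hB p l) (hW l _ (div_nonneg (hX l) hN.le))
          (windowSum_nonneg (fun q => hc' q l) _) hB0).trans (le_of_eq ?_)
        field_simp
      · rw [one_mul]
        exact hW l _ (hX l)
  refine h1.trans (le_of_eq ?_)
  rw [Finset.prod_mul_distrib, Finset.prod_mul_distrib, Finset.prod_const, Finset.card_univ,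
    Fintype.card_fin, Finset.prod_ite, Finset.prod_const, Finset.prod_const_one]
  have : Finset.univ.filter (fun l => l = i ∨ l = j) = {i, j} := by ext l; simp
  rw [this, Finset.card_pair hij, Real.rpow_neg hN.le, Real.rpow_two]
  ring

lemma collision_eq_zero (T : Finset (Fin m)) (c' : HeightOneSpectrum (𝓞 K) → Fin m → ℝ)
    {X : Fin m → ℝ} {p : HeightOneSpectrum (𝓞 K)} {i : Fin m} (j : Fin m)
    (h : X i < primeNorm p) : collision T c' X p i j = 0 :=
  Finset.prod_eq_zero (Finset.mem_univ i) (by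
    rw [if_pos (Or.inl rfl), windowSum_of_lt_one _ ((div_lt_one (primeNorm_pos p)).2 h), mul_zero])

/-- The primes that can occur in the box with corner `X`. -/
def primesUpTo (K : Type*) [Field K] [NumberField K] (X : Fin m → ℝ) :
    Finset (HeightOneSpectrum (𝓞 K)) :=
  (Set.finite_iUnion fun i => finite_primeNorm_le (K := K) (X i)).toFinset

lemma mem_primesUpTo {X : Fin m → ℝ} {p : HeightOneSpectrum (𝓞 K)} :
    p ∈ primesUpTo K X ↔ ∃ i, (primeNorm p : ℝ) ≤ X i := by
  simp [primesUpTo]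

/-- There are no collisions at primes exceeding all coordinates of the corner. -/
lemma boxSum_eq_of_subset (T : Finset (Fin m)) {S S' : Finset (HeightOneSpectrum (𝓞 K))}
    (hSS' : S ⊆ S') {b : HeightOneSpectrum (𝓞 K) → ℂ} (hb : ∀ p ∉ S, b p = 1)
    (c : HeightOneSpectrum (𝓞 K) → Fin m → ℂ) {X : Fin m → ℝ} (hX : primesUpTo K X ⊆ S) :
    boxSum T S' b c X = boxSum T S b c X := by
  have h := norm_boxSum_sub_le T hSS' hb (c := c) (c' := fun p i => ‖c p i‖) (fun _ _ => le_rfl)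
    le_rfl X
  have h0 : ∑ p ∈ S' \ S, ∑ ij ∈ (Finset.univ : Finset (Fin m)).offDiag,
      collision T (fun p i => ‖c p i‖) X p ij.1 ij.2 = 0 := by
    refine Finset.sum_eq_zero fun p hp => Finset.sum_eq_zero fun ij _ =>
      collision_eq_zero T _ _ (lt_of_not_ge fun hle => ?_)
    exact (Finset.mem_sdiff.1 hp).2 (hX (mem_primesUpTo.2 ⟨_, hle⟩))
  rw [h0, mul_zero] at h
  exact sub_eq_zero.1 (norm_le_zero_iff.1 h)

/-- The sum over a box of the coefficients of `∏_p (b_p + ∑_i c_{p,i} N(p)^{-s_i})`, where `b_p = 1`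
outside `S₀`. -/
def fullSum (T : Finset (Fin m)) (S₀ : Finset (HeightOneSpectrum (𝓞 K)))
    (b : HeightOneSpectrum (𝓞 K) → ℂ) (c : HeightOneSpectrum (𝓞 K) → Fin m → ℂ)
    (X : Fin m → ℝ) : ℂ :=
  boxSum T (S₀ ∪ primesUpTo K X) b c X

lemma boxSum_eq_fullSum (T : Finset (Fin m)) {S₀ S : Finset (HeightOneSpectrum (𝓞 K))}
    (hS : S₀ ⊆ S) {b : HeightOneSpectrum (𝓞 K) → ℂ} (hb : ∀ p ∉ S₀, b p = 1)
    (c : HeightOneSpectrum (𝓞 K) → Fin m → ℂ) {X : Fin m → ℝ} (hX : primesUpTo K X ⊆ S) :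
    boxSum T S b c X = fullSum T S₀ b c X :=
  boxSum_eq_of_subset T (Finset.union_subset hS hX)
    (fun p hp => hb p fun h => hp (Finset.mem_union_left _ h)) c Finset.subset_union_right

/-- The full sums are approximated, uniformly in the box, by box sums in which finitely many local
factors have been changed; hence they have a mean value. -/
lemma exists_tendsto_fullSum_div {S₀ : Finset (HeightOneSpectrum (𝓞 K))}
    {b : HeightOneSpectrum (𝓞 K) → ℂ} (hb : ∀ p ∉ S₀, b p = 1)
    {c : HeightOneSpectrum (𝓞 K) → Fin m → ℂ}
    (hlim : ∀ U, S₀ ⊆ U → ∀ i, ∃ ρ : ℂ, Tendsto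
      (fun y : ℝ => windowSum False (fun p => kill U c p i) y / (y : ℂ)) atTop (𝓝 ρ))
    {c' : HeightOneSpectrum (𝓞 K) → Fin m → ℝ} (hcc' : ∀ p i, ‖c p i‖ ≤ c' p i) {B C : ℝ}
    (hB : ∀ p i, c' p i ≤ B) (hC0 : 0 ≤ C)
    (hC : ∀ i y, 0 ≤ y → windowSum False (fun p => c' p i) y ≤ C * y)
    (T : Finset (Fin m)) {v : Fin m → ℝ} (hv : ∀ i ∈ T, 0 < v i) :
    ∃ C₀ : ℂ, Tendsto (fun X : Fin m → ℝ => fullSum T S₀ b c X / ∏ i, (X i : ℂ))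
      (cornerFilter T v) (𝓝 C₀) := by
  have hc' : ∀ p i, 0 ≤ c' p i := fun p i => (norm_nonneg _).trans (hcc' p i)
  refine exists_tendsto_of_approx fun ε hε => ?_
  set M := ∏ p ∈ S₀, max 1 ‖b p‖ with hM
  have hM0 : 0 ≤ M := Finset.prod_nonneg fun p _ => by positivity
  set D := M * ((Finset.univ : Finset (Fin m)).offDiag.card * (C ^ m * B ^ 2)) with hD
  have hD0 : 0 ≤ D := by positivity
  obtain ⟨S₁, hS₁⟩ := summable_iff_vanishing_norm.1
    (summable_primeNorm_rpow (K := K) (σ := 2) (by norm_num)) (ε / (D + 1)) (by positivity)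
  obtain ⟨C₁, hC₁⟩ := exists_tendsto_boxSum_div b hlim T (S₀ ∪ S₁) ∅
    (Finset.subset_union_left.trans Finset.subset_union_left) v
  rw [kill_empty] at hC₁
  refine ⟨_, C₁, hC₁, ?_⟩
  filter_upwards [eventually_cornerFilter_pos hv] with X hX
  have hprod : 0 < ∏ i, X i := Finset.prod_pos fun i _ => hX i
  rw [← boxSum_eq_fullSum T (S := S₀ ∪ S₁ ∪ primesUpTo K X)
    (Finset.subset_union_left.trans Finset.subset_union_left) hb c Finset.subset_union_right,
    ← sub_div, norm_div, ← Complex.ofReal_prod, Complex.norm_real, Real.norm_of_nonneg hprod.le,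
    div_le_iff₀ hprod]
  refine (norm_boxSum_sub_le T Finset.subset_union_left
    (fun p hp => hb p fun h => hp (Finset.mem_union_left _ h)) hcc' (M := M) (le_of_eq ?_) X).trans
      ?_
  · exact (Finset.prod_subset Finset.subset_union_left fun p _ hp => by simp [hb p hp]).symm
  set R := (S₀ ∪ S₁ ∪ primesUpTo K X) \ (S₀ ∪ S₁) with hR
  have hdisj : Disjoint R S₁ :=
    Finset.disjoint_left.2 fun p hp h => (Finset.mem_sdiff.1 hp).2 (Finset.mem_union_right _ h)
  have h1 : ∑ p ∈ R, ∑ ij ∈ (Finset.univ : Finset (Fin m)).offDiag,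
      collision T c' X p ij.1 ij.2 ≤ ∑ p ∈ R, ∑ ij ∈ (Finset.univ : Finset (Fin m)).offDiag,
        C ^ m * B ^ 2 * (primeNorm p : ℝ) ^ (-2 : ℝ) * ∏ l, X l :=
    Finset.sum_le_sum fun p _ => Finset.sum_le_sum fun ij hij =>
      collision_le T hc' hB hC (fun i => (hX i).le) p (Finset.mem_offDiag.1 hij).2.2
  have h2 := (le_abs_self _).trans (hS₁ R hdisj).le
  calc _ ≤ M * ∑ p ∈ R, ∑ ij ∈ (Finset.univ : Finset (Fin m)).offDiag,
        C ^ m * B ^ 2 * (primeNorm p : ℝ) ^ (-2 : ℝ) * ∏ l, X l :=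
        mul_le_mul_of_nonneg_left h1 hM0
    _ = D * (∑ p ∈ R, (primeNorm p : ℝ) ^ (-2 : ℝ)) * ∏ l, X l := by
        simp only [Finset.sum_const, nsmul_eq_mul, ← Finset.mul_sum, ← Finset.sum_mul, hD]
        ring
    _ ≤ D * (ε / (D + 1)) * ∏ l, X l := by gcongr
    _ ≤ ε * ∏ l, X l := by
        refine mul_le_mul_of_nonneg_right ?_ hprod.le
        rw [mul_div_assoc', div_le_iff₀ (by positivity)]
        nlinarith

end MeanValues

/-! ### The formal expansion as a box sum -/

section Expansion

open scoped Classical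

variable {K : Type*} [Field K] [NumberField K] {m : ℕ}

lemma mem_of_mem_selections {z : Fin m → ℕ} (hz : ∀ i, 1 ≤ z i)
    {S : Finset (HeightOneSpectrum (𝓞 K))} (hS : ∀ p i, primeNorm p ≤ z i → p ∈ S)
    {φ : HeightOneSpectrum (𝓞 K) → Option (Fin m)} (hφ : φ ∈ selections K z)
    {p : HeightOneSpectrum (𝓞 K)} {i : Fin m} (hp : φ p = some i) : p ∈ S := by
  have hfin : {p | φ p = some i}.Finite := hφ.1.subset fun q (hq : φ q = some i) => by
    simp [hq]
  have h := hφ.2 i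
  rw [finprod_mem_eq_finite_toFinset_prod _ hfin] at h
  refine hS p i (Nat.le_of_dvd (hz i) ?_)
  rw [← h]
  exact Finset.dvd_prod_of_mem _ (by simpa using hp)

lemma coe_filter_selection {z : Fin m → ℕ} (hz : ∀ i, 1 ≤ z i)
    {S : Finset (HeightOneSpectrum (𝓞 K))} (hS : ∀ p i, primeNorm p ≤ z i → p ∈ S)
    {φ : HeightOneSpectrum (𝓞 K) → Option (Fin m)} (hφ : φ ∈ selections K z) (i : Fin m) :
    ((S.filter fun p => φ p = some i : Finset _) : Set (HeightOneSpectrum (𝓞 K))) =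
      {p | φ p = some i} := by
  ext p
  simpa using fun h => mem_of_mem_selections hz hS hφ h

/-- The tuple of sets `{p | φ p = some i}` attached to a selection `φ` identifies selections with
tuples of pairwise disjoint sets. -/
lemma bijOn_selections {z : Fin m → ℕ} (hz : ∀ i, 1 ≤ z i)
    {S : Finset (HeightOneSpectrum (𝓞 K))} (hS : ∀ p i, primeNorm p ≤ z i → p ∈ S) :
    Set.BijOn (fun φ i => S.filter fun p => φ p = some i) (selections K z)
      ((box K Finset.univ fun i => (z i : ℝ)).filter fun J =>
        ∀ p ∈ S, DisjointAt J p : Finset _) := by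
  refine ⟨fun φ hφ => ?_, fun φ hφ ψ hψ h => ?_, fun J hJ => ?_⟩
  · rw [Finset.mem_coe, Finset.mem_filter, box, Fintype.mem_piFinset]
    refine ⟨fun i => ?_, fun p _ i j hi hj => ?_⟩
    · have h := hφ.2 i
      rw [← coe_filter_selection hz hS hφ i, finprod_mem_coe_finset] at h
      have : setNorm (S.filter fun p => φ p = some i) = z i := by
        rw [← h, setNorm, Nat.cast_prod]
      exact mem_window.2 ⟨fun _ => this, this.le⟩
    · simp only [Finset.mem_filter] at hi hj
      exact Option.some_injective _ (hi.2.symm.trans hj.2)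
  · ext p i
    have h' := congrFun h i
    have : p ∈ S.filter (fun p => φ p = some i) ↔ p ∈ S.filter (fun p => ψ p = some i) := by
      simp only at h'
      rw [h']
    rw [← Finset.mem_coe, ← Finset.mem_coe, coe_filter_selection hz hS hφ,
      coe_filter_selection hz hS hψ] at this
    exact this
  · rw [Finset.mem_coe, Finset.mem_filter, box, Fintype.mem_piFinset] at hJ
    obtain ⟨hJ, hd⟩ := hJ
    have hJ1 : ∀ i, setNorm (J i) = z i := fun i => (mem_window.1 (hJ i)).1 (Finset.mem_univ i)
    have hJS : ∀ i p, p ∈ J i → p ∈ S := fun i p hp => hS p i (by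
      have := primeNorm_le_setNorm hp
      rw [hJ1] at this
      exact_mod_cast this)
    have hφ : ∀ p i, (if h : ∃ i, p ∈ J i then some h.choose else none) = some i ↔ p ∈ J i := by
      intro p i
      constructor
      · intro h
        split_ifs at h with h1
        rw [← Option.some_injective _ h]
        exact h1.choose_spec
      · intro h
        have h1 : ∃ i, p ∈ J i := ⟨i, h⟩
        rw [dif_pos h1, hd p (hJS i p h) _ _ h1.choose_spec h]
    refine ⟨fun p => if h : ∃ i, p ∈ J i then some h.choose else none, ⟨?_, fun i => ?_⟩, ?_⟩
    · refine S.finite_toSet.subset fun p hp => ?_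
      obtain ⟨i, hi⟩ := Option.ne_none_iff_exists'.1 hp
      exact hJS i p ((hφ p i).1 hi)
    · have : {p | (if h : ∃ i, p ∈ J i then some h.choose else none) = some i} = (J i : Set _) := by
        ext p; exact hφ p i
      rw [this, finprod_mem_coe_finset]
      have := hJ1 i
      rw [setNorm] at this
      exact_mod_cast this
    · funext i
      ext p
      simp only [Finset.mem_filter, hφ]
      exact ⟨fun h => h.2, fun h => ⟨hJS i p h, h⟩⟩

lemma finprod_selection {z : Fin m → ℕ} (hz : ∀ i, 1 ≤ z i)
    {S : Finset (HeightOneSpectrum (𝓞 K))} (hS : ∀ p i, primeNorm p ≤ z i → p ∈ S)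
    {b : HeightOneSpectrum (𝓞 K) → ℂ} (hb : ∀ p ∉ S, b p = 1)
    (c : HeightOneSpectrum (𝓞 K) → Fin m → ℂ)
    {φ : HeightOneSpectrum (𝓞 K) → Option (Fin m)} (hφ : φ ∈ selections K z) :
    ∏ᶠ p, (φ p).elim (b p) (c p) = ∏ p ∈ S, (φ p).elim (b p) (c p) := by
  refine finprod_eq_prod_of_mulSupport_subset _ fun p hp => ?_
  by_contra hpS
  refine hp ?_
  change (φ p).elim (b p) (c p) = 1
  rcases h : φ p with _ | i
  · exact hb p hpS
  · exact absurd (mem_of_mem_selections hz hS hφ h) hpS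

/-- A single coefficient of the formal expansion is the box sum in which all coordinates are
prescribed. -/
lemma coeff_eq_boxSum {z : Fin m → ℕ} (hz : ∀ i, 1 ≤ z i)
    {S : Finset (HeightOneSpectrum (𝓞 K))} (hS : ∀ p i, primeNorm p ≤ z i → p ∈ S)
    {b : HeightOneSpectrum (𝓞 K) → ℂ} (hb : ∀ p ∉ S, b p = 1)
    (c : HeightOneSpectrum (𝓞 K) → Fin m → ℂ) :
    coeff b c z = boxSum Finset.univ S b c fun i => (z i : ℝ) := by
  simp only [boxSum, weight]
  rw [← Finset.sum_filter, coeff, ← finsum_mem_coe_finset]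
  refine finsum_mem_eq_of_bijOn _ (bijOn_selections hz hS) fun φ hφ => ?_
  rw [finprod_selection hz hS hb c hφ]
  have h1 : ∏ i, ∏ p ∈ S.filter (fun p => φ p = some i), c p i =
      ∏ p ∈ S, ∏ i, if φ p = some i then c p i else 1 := by
    rw [Finset.prod_comm]
    exact Finset.prod_congr rfl fun i _ => Finset.prod_filter _ _
  rw [h1, ← Finset.prod_mul_distrib]
  refine Finset.prod_congr rfl fun p hp => ?_
  rcases h : φ p with _ | i
  · simp [h]
  · have : ∃ j, p ∈ S.filter (fun p => φ p = some j) := ⟨i, Finset.mem_filter.2 ⟨hp, h⟩⟩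
    rw [if_pos this]
    simp

/-- The corner of the box whose coordinates are `x` on `T` and `X` off `T`. -/
def corner {T : Finset (Fin m)} (x : {i // i ∈ T} → ℕ) (X : {i // i ∉ T} → ℝ) : Fin m → ℝ :=
  fun i => if h : i ∈ T then (x ⟨i, h⟩ : ℝ) else X ⟨i, h⟩

lemma boundarySum_eq_fullSum {S₀ : Finset (HeightOneSpectrum (𝓞 K))}
    {b : HeightOneSpectrum (𝓞 K) → ℂ} (hb : ∀ p ∉ S₀, b p = 1)
    (c : HeightOneSpectrum (𝓞 K) → Fin m → ℂ) {T : Finset (Fin m)} {x : {i // i ∈ T} → ℕ}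
    (hx : ∀ i, 1 ≤ x i) (X : {i // i ∉ T} → ℝ) :
    boundarySum b c x X = fullSum T S₀ b c (corner x X) := by
  set S := S₀ ∪ primesUpTo K (corner x X) with hSdef
  have hbS : ∀ p ∉ S, b p = 1 := fun p hp => hb p fun h => hp (Finset.mem_union_left _ h)
  have hle : ∀ y ∈ Fintype.piFinset (fun i => Finset.Icc 1 ⌊X i⌋₊), ∀ i,
      1 ≤ glue x y i ∧ (glue x y i : ℝ) ≤ corner x X i := fun y hy i => by
    rw [Fintype.mem_piFinset] at hy
    unfold glue corner
    split_ifs with h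
    · exact ⟨hx _, le_rfl⟩
    · have := Finset.mem_Icc.1 (hy ⟨i, h⟩)
      refine ⟨this.1, (Nat.le_floor_iff' (by omega)).1 this.2⟩
  have h1 : ∀ y ∈ Fintype.piFinset (fun i => Finset.Icc 1 ⌊X i⌋₊), coeff b c (glue x y) =
      boxSum Finset.univ S b c fun i => (glue x y i : ℝ) := fun y hy =>
    coeff_eq_boxSum (fun i => (hle y hy i).1) (fun p i hp => Finset.mem_union_right _
      (mem_primesUpTo.2 ⟨i, le_trans (by exact_mod_cast hp) (hle y hy i).2⟩)) hbS c
  rw [boundarySum, Finset.sum_congr rfl h1, fullSum]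
  -- sort the tuples in the box by the norms of their components off `T`
  have hmaps : ∀ J ∈ box K T (corner x X), (fun i : {i // i ∉ T} => ∏ p ∈ J i, primeNorm p) ∈
      Fintype.piFinset (fun i => Finset.Icc 1 ⌊X i⌋₊) := fun J hJ => by
    rw [box, Fintype.mem_piFinset] at hJ
    rw [Fintype.mem_piFinset]
    intro i
    have h := (mem_window.1 (hJ i)).2
    rw [corner, dif_neg i.2, setNorm] at h
    have h2 := one_le_setNorm (J i)
    rw [setNorm] at h2
    exact Finset.mem_Icc.2 ⟨by exact_mod_cast h2, Nat.le_floor (by exact_mod_cast h)⟩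
  rw [boxSum, ← Finset.sum_fiberwise_of_maps_to hmaps]
  refine Finset.sum_congr rfl fun y hy => ?_
  rw [boxSum]
  refine Finset.sum_congr ?_ fun _ _ => rfl
  ext J
  simp only [Finset.mem_filter, box, Fintype.mem_piFinset, mem_window, Finset.mem_univ,
    true_imp_iff]
  have hcast : ∀ i, setNorm (J i) = ((∏ p ∈ J i, primeNorm p : ℕ) : ℝ) := fun i => by
    rw [setNorm, Nat.cast_prod]
  constructor
  · intro h
    refine ⟨fun i => ⟨fun hi => ?_, (h i).2.trans (hle y hy i).2⟩, funext fun i => ?_⟩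
    · rw [(h i).1, glue, corner, dif_pos hi, dif_pos hi]
    · have := (h i).1
      rw [glue, dif_neg i.2, hcast] at this
      exact_mod_cast this
  · rintro ⟨h, rfl⟩ i
    have : setNorm (J i) = (glue x (fun i : {i // i ∉ T} => ∏ p ∈ J i, primeNorm p) i : ℝ) := by
      by_cases hi : i ∈ T
      · rw [(h i).1 hi, glue, corner, dif_pos hi, dif_pos hi]
      · rw [glue, dif_neg hi, hcast]
    exact ⟨this, this.le⟩

end Expansion

/-! ### Lower bounds for nonnegative coefficients -/

section LowerBounds

open scoped Classical

variable {K : Type*} [Field K] [NumberField K] {m : ℕ}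

lemma kill_kill {P R : Type*} [Zero R] (S U : Finset P) (c : P → Fin m → R) :
    kill S (kill U c) = kill (S ∪ U) c := by
  ext q i
  by_cases h1 : q ∈ S <;> by_cases h2 : q ∈ U <;> simp [kill, h1, h2]

lemma kill_nonneg {P : Type*} (S : Finset P) {c : P → Fin m → ℂ} (hc : ∀ p i, 0 ≤ c p i) (p : P)
    (i : Fin m) : 0 ≤ kill S c p i := by
  unfold kill
  split_ifs
  · exact le_rfl
  · exact hc p i

lemma weight_nonneg {P : Type*} (S : Finset P) {b : P → ℂ} (hb : ∀ p, 0 ≤ b p) {c : P → Fin m → ℂ}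
    (hc : ∀ p i, 0 ≤ c p i) (J : Fin m → Finset P) : 0 ≤ weight S b c J := by
  unfold weight
  split_ifs
  · refine mul_nonneg (Finset.prod_nonneg fun i _ => Finset.prod_nonneg fun p _ => hc p i)
      (Finset.prod_nonneg fun p _ => ?_)
    split_ifs
    · exact zero_le_one
    · exact hb p
  · exact le_rfl

lemma boxSum_nonneg (T : Finset (Fin m)) (S : Finset (HeightOneSpectrum (𝓞 K)))
    {b : HeightOneSpectrum (𝓞 K) → ℂ} (hb : ∀ p, 0 ≤ b p)
    {c : HeightOneSpectrum (𝓞 K) → Fin m → ℂ} (hc : ∀ p i, 0 ≤ c p i) (X : Fin m → ℝ) :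
    0 ≤ boxSum T S b c X :=
  Finset.sum_nonneg fun J _ => weight_nonneg S hb hc J

/-- With nonnegative coefficients, prescribing the selected summand at the primes in `S` gives a
lower bound. -/
lemma prod_mul_boxSum_le (T : Finset (Fin m)) {b : HeightOneSpectrum (𝓞 K) → ℂ}
    (hb : ∀ p, 0 ≤ b p) (φ : HeightOneSpectrum (𝓞 K) → Option (Fin m))
    (S' S : Finset (HeightOneSpectrum (𝓞 K))) (hSS' : Disjoint S S') :
    ∀ c : HeightOneSpectrum (𝓞 K) → Fin m → ℂ, (∀ p i, 0 ≤ c p i) → ∀ X : Fin m → ℝ,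
      (∏ p ∈ S, (φ p).elim (b p) (c p)) * boxSum T S' b (kill S c)
        (fun i => X i / setNorm (S.filter fun p => φ p = some i)) ≤ boxSum T (S ∪ S') b c X := by
  induction S using Finset.induction_on with
  | empty =>
    intro c _ X
    simp [kill_empty, setNorm]
  | insert p S hp ih =>
    intro c hc X
    rw [Finset.disjoint_insert_left] at hSS'
    have hpS : p ∉ S ∪ S' := by simp [hp, hSS'.1]
    have hc1 := kill_nonneg {p} hc
    have hprod : ∏ q ∈ S, (φ q).elim (b q) (kill {p} c q) = ∏ q ∈ S, (φ q).elim (b q) (c q) := by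
      refine Finset.prod_congr rfl fun q hq => ?_
      have : q ≠ p := by rintro rfl; exact hp hq
      rcases φ q with _ | i <;> simp [kill, this]
    have hkill : kill S (kill {p} c) = kill (insert p S) c := by
      rw [kill_kill, Finset.union_comm, ← Finset.insert_eq]
    rw [Finset.insert_union, boxSum_insert T b c hpS, Finset.prod_insert hp]
    have hnn : ∀ i, 0 ≤ c p i * boxSum T (S ∪ S') b (kill {p} c)
        (Function.update X i (X i / primeNorm p)) := fun i =>
      mul_nonneg (hc p i) (boxSum_nonneg T _ hb hc1 _)
    rcases hφ : φ p with _ | i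
    · have h := ih hSS'.2 (kill {p} c) hc1 X
      rw [hprod, hkill] at h
      have hf : ∀ i, (insert p S).filter (fun q => φ q = some i) =
          S.filter fun q => φ q = some i := fun i => by
        rw [Finset.filter_insert, if_neg (by simp [hφ])]
      simp only [hf, Option.elim_none, mul_assoc]
      exact (mul_le_mul_of_nonneg_left h (hb p)).trans
        (le_add_of_nonneg_right (Finset.sum_nonneg fun i _ => hnn i))
    · have h := ih hSS'.2 (kill {p} c) hc1 (Function.update X i (X i / primeNorm p))
      rw [hprod, hkill] at h
      have hX : (fun j => Function.update X i (X i / primeNorm p) j /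
          setNorm (S.filter fun q => φ q = some j)) =
          fun j => X j / setNorm ((insert p S).filter fun q => φ q = some j) := by
        funext j
        rcases eq_or_ne j i with rfl | hj
        · rw [Finset.filter_insert, if_pos hφ, setNorm_insert (by simp [hp]), Function.update_self,
            div_div]
        · rw [Finset.filter_insert, if_neg (by simpa [hφ] using hj.symm), Function.update_of_ne hj]
      rw [hX] at h
      simp only [Option.elim_some, mul_assoc]
      refine (mul_le_mul_of_nonneg_left h (hc p i)).trans ?_
      refine (Finset.single_le_sum (f := fun i => c p i * boxSum T (S ∪ S') b (kill {p} c)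
        (Function.update X i (X i / primeNorm p))) (fun i _ => hnn i) (Finset.mem_univ i)).trans ?_
      exact le_add_of_nonneg_left (mul_nonneg (hb p) (boxSum_nonneg T _ hb hc1 _))

lemma boxSum_congr_left (T : Finset (Fin m)) {S : Finset (HeightOneSpectrum (𝓞 K))}
    {b b' : HeightOneSpectrum (𝓞 K) → ℂ} (h : ∀ p ∈ S, b p = b' p)
    (c : HeightOneSpectrum (𝓞 K) → Fin m → ℂ) (X : Fin m → ℝ) :
    boxSum T S b c X = boxSum T S b' c X := by
  refine Finset.sum_congr rfl fun J _ => ?_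
  have : ∏ p ∈ S, (if ∃ i, p ∈ J i then 1 else b p) =
      ∏ p ∈ S, (if ∃ i, p ∈ J i then 1 else b' p) :=
    Finset.prod_congr rfl fun p hp => by rw [h p hp]
  rw [weight, weight, this]

lemma ofReal_windowSum (t : Prop) (v : HeightOneSpectrum (𝓞 K) → ℝ) (y : ℝ) :
    ((windowSum t v y : ℝ) : ℂ) = windowSum t (fun p => (v p : ℂ)) y := by
  simp [windowSum]

lemma windowSum_mono {t : Prop} {u v : HeightOneSpectrum (𝓞 K) → ℝ} (hu : ∀ p, 0 ≤ u p)
    (huv : ∀ p, u p ≤ v p) (y : ℝ) : windowSum t u y ≤ windowSum t v y :=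
  Finset.sum_le_sum fun _ _ => Finset.prod_le_prod (fun p _ => hu p) fun p _ => huv p

section Positivity

variable {a : HeightOneSpectrum (𝓞 K) → Fin m → ℝ} {T : Finset (Fin m)} {σ : Fin m → ℝ}
  {v : Fin m → ℝ}

lemma tendsto_windowSum_one_div (hσ : ∀ i ∉ T, Tendsto
      (fun y : ℝ => windowSum False (fun p => a p i) y / y) atTop (𝓝 (σ i)))
    (hv : ∀ i ∈ T, v i = 1) (i : Fin m) :
    Tendsto (fun Y : Fin m → ℝ => windowSum (i ∈ T) (fun p => a p i) (Y i) / Y i)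
      (cornerFilter T v) (𝓝 (if i ∈ T then 1 else σ i)) := by
  by_cases hi : i ∈ T
  · rw [if_pos hi]
    refine tendsto_nhds_of_eventually_eq ?_
    filter_upwards [eventually_cornerFilter_eq v hi] with X hX
    rw [hX, hv i hi, windowSum_one, div_one]
  · simp only [hi, if_false]
    exact (hσ i hi).comp (tendsto_cornerFilter_atTop v hi)

lemma tendsto_windowSum_div_div (hσ : ∀ i ∉ T, Tendsto
      (fun y : ℝ => windowSum False (fun p => a p i) y / y) atTop (𝓝 (σ i)))
    (hv : ∀ i ∈ T, v i = 1) (p : HeightOneSpectrum (𝓞 K)) (i : Fin m) :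
    Tendsto (fun Y : Fin m → ℝ => windowSum (i ∈ T) (fun p => a p i) (Y i / primeNorm p) / Y i)
      (cornerFilter T v) (𝓝 (if i ∈ T then 0 else σ i / primeNorm p)) := by
  have hN := primeNorm_pos p
  by_cases hi : i ∈ T
  · rw [if_pos hi]
    refine tendsto_nhds_of_eventually_eq ?_
    filter_upwards [eventually_cornerFilter_eq v hi] with X hX
    rw [hX, hv i hi, windowSum_of_lt_one _ ((div_lt_one hN).2 (one_lt_primeNorm p)), zero_div]
  · simp only [hi, if_false]
    have h := (((hσ i hi).comp ((tendsto_cornerFilter_atTop v hi).atTop_div_const hN)).div_const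
      (primeNorm p : ℝ))
    refine h.congr fun X => ?_
    rw [Function.comp_apply, div_div, div_mul_cancel₀ _ hN.ne']

/-- The weighted sum over collisions has a mean value, which is smaller than that of the sum over
all tuples by a factor of at most the number of pairs times `B² ∑_p N(p)^{-2}`, the sum being over
the primes outside `S`. -/
lemma exists_tendsto_collisions {c' : HeightOneSpectrum (𝓞 K) → Fin m → ℝ} {B C δ : ℝ}
    (ha : ∀ p i, 0 ≤ a p i) (hac : ∀ p i, a p i ≤ c' p i) (hB : ∀ p i, c' p i ≤ B)
    (hC : ∀ i y, 0 ≤ y → windowSum False (fun p => c' p i) y ≤ C * y)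
    (hσ : ∀ i ∉ T, Tendsto
      (fun y : ℝ => windowSum False (fun p => a p i) y / y) atTop (𝓝 (σ i)))
    (hσ0 : ∀ i ∉ T, 0 < σ i) (hv : ∀ i ∈ T, v i = 1)
    {S : Finset (HeightOneSpectrum (𝓞 K))} (haS : ∀ p ∈ S, ∀ i, a p i = 0)
    (hS : ∀ t, Disjoint t S → ∑ p ∈ t, (primeNorm p : ℝ) ^ (-2 : ℝ) ≤ δ) :
    ∃ L : ℝ, L ≤ (Finset.univ : Finset (Fin m)).offDiag.card * B ^ 2 * δ *
        ∏ i, (if i ∈ T then 1 else σ i) ∧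
      Tendsto (fun Y : Fin m → ℝ => (∑' p, ∑ ij ∈ (Finset.univ : Finset (Fin m)).offDiag,
        collision T a Y p ij.1 ij.2) / ∏ i, Y i) (cornerFilter T v) (𝓝 L) ∧
      ∀ᶠ Y in cornerFilter T v, Summable fun p => ∑ ij ∈ (Finset.univ : Finset (Fin m)).offDiag,
        collision T a Y p ij.1 ij.2 := by
  set n := (Finset.univ : Finset (Fin m)).offDiag.card with hn
  have hsum := summable_primeNorm_rpow (K := K) (σ := 2) (by norm_num)
  have hbound : ∀ Y : Fin m → ℝ, (∀ i, 0 < Y i) → ∀ p,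
      ∑ ij ∈ (Finset.univ : Finset (Fin m)).offDiag, collision T a Y p ij.1 ij.2 ≤
        n * (C ^ m * B ^ 2) * (primeNorm p : ℝ) ^ (-2 : ℝ) * ∏ l, Y l := fun Y hY p => by
    refine (Finset.sum_le_sum fun ij hij => collision_le T ha (fun p i => (hac p i).trans (hB p i))
      (fun i y hy => (windowSum_mono (fun p => ha p i) (fun p => hac p i) y).trans (hC i y hy))
      (fun i => (hY i).le) p (Finset.mem_offDiag.1 hij).2.2).trans (le_of_eq ?_)
    simp only [Finset.sum_const, nsmul_eq_mul, ← hn]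
    ring
  have hnonneg : ∀ Y : Fin m → ℝ, ∀ p,
      0 ≤ ∑ ij ∈ (Finset.univ : Finset (Fin m)).offDiag, collision T a Y p ij.1 ij.2 :=
    fun Y p => Finset.sum_nonneg fun ij _ => collision_nonneg T ha Y p _ _
  have hpos := eventually_cornerFilter_pos (T := T) (v := v)
    fun i hi => by rw [hv i hi]; exact one_pos
  set lam : HeightOneSpectrum (𝓞 K) → Fin m × Fin m → ℝ := fun p ij =>
    ∏ l, if l = ij.1 ∨ l = ij.2 then a p l * (if l ∈ T then 0 else σ l / primeNorm p)
      else (if l ∈ T then 1 else σ l) with hlam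
  have hτ : ∀ l, 0 < (if l ∈ T then 1 else σ l) := fun l => by
    split_ifs with h
    · exact one_pos
    · exact hσ0 l h
  have hfac0 : ∀ p (ij : Fin m × Fin m) l, 0 ≤ if l = ij.1 ∨ l = ij.2 then
      a p l * (if l ∈ T then 0 else σ l / primeNorm p) else (if l ∈ T then 1 else σ l) := by
    intro p ij l
    have := ha p l
    split_ifs with h1 h2 h3
    · simp
    · exact mul_nonneg this (div_nonneg (hσ0 l h2).le (primeNorm_pos p).le)
    · exact zero_le_one
    · exact (hσ0 l h3).le
  have hlam0 : ∀ p ij, 0 ≤ lam p ij := fun p ij => Finset.prod_nonneg fun l _ => hfac0 p ij l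
  have hlamle : ∀ p, ∀ ij ∈ (Finset.univ : Finset (Fin m)).offDiag,
      lam p ij ≤ B ^ 2 * (primeNorm p : ℝ) ^ (-2 : ℝ) * ∏ l, (if l ∈ T then 1 else σ l) := by
    intro p ij hij
    have hN := primeNorm_pos p
    have h1 : lam p ij ≤ ∏ l, (if l = ij.1 ∨ l = ij.2 then B / primeNorm p else 1) *
        (if l ∈ T then 1 else σ l) := by
      refine Finset.prod_le_prod (fun l _ => hfac0 p ij l) fun l _ => ?_
      · have h0 := ha p l
        have hab := (hac p l).trans (hB p l)
        split_ifs with h1 h2 h3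
        · simpa using div_nonneg (h0.trans hab) hN.le
        · have := (hσ0 l h2).le
          rw [mul_div_assoc', div_mul_eq_mul_div]
          gcongr
        · simp
        · simp
    refine h1.trans (le_of_eq ?_)
    rw [Finset.prod_mul_distrib]
    congr 1
    rw [Finset.prod_ite, Finset.prod_const, Finset.prod_const_one]
    have : Finset.univ.filter (fun l => l = ij.1 ∨ l = ij.2) = {ij.1, ij.2} := by ext l; simp
    rw [this, Finset.card_pair (Finset.mem_offDiag.1 hij).2.2, Real.rpow_neg hN.le, Real.rpow_two]
    ring
  have hlamS : ∀ p ∈ S, ∀ ij, lam p ij = 0 := fun p hp ij =>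
    Finset.prod_eq_zero (Finset.mem_univ ij.1) (by simp [haS p hp])
  have hδ0 : 0 ≤ δ := by simpa using hS ∅ (Finset.disjoint_empty_left _)
  have hprodτ : 0 < ∏ l, (if l ∈ T then 1 else σ l) := Finset.prod_pos fun l _ => hτ l
  refine ⟨∑' p, ∑ ij ∈ (Finset.univ : Finset (Fin m)).offDiag, lam p ij, ?_, ?_, ?_⟩
  · refine Real.tsum_le_of_sum_le (fun p => Finset.sum_nonneg fun ij _ => hlam0 p ij) fun t => ?_
    have h1 : ∑ p ∈ t \ S, ∑ ij ∈ (Finset.univ : Finset (Fin m)).offDiag, lam p ij =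
        ∑ p ∈ t, ∑ ij ∈ (Finset.univ : Finset (Fin m)).offDiag, lam p ij := by
      refine Finset.sum_subset Finset.sdiff_subset fun p hp hp' => ?_
      have hpS : p ∈ S := by
        by_contra h
        exact hp' (Finset.mem_sdiff.2 ⟨hp, h⟩)
      exact Finset.sum_eq_zero fun ij _ => hlamS p hpS ij
    rw [← h1]
    refine (Finset.sum_le_sum fun p _ => Finset.sum_le_sum (hlamle p)).trans ?_
    simp only [Finset.sum_const, nsmul_eq_mul, ← Finset.mul_sum, ← Finset.sum_mul, ← hn]
    have h2 := hS (t \ S) Finset.sdiff_disjoint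
    calc _ = n * B ^ 2 * (∑ p ∈ t \ S, (primeNorm p : ℝ) ^ (-2 : ℝ)) *
          ∏ l, (if l ∈ T then 1 else σ l) := by ring
      _ ≤ _ := by gcongr
  · have h := tendsto_tsum_of_dominated_convergence (𝓕 := cornerFilter T v)
      (f := fun Y p => (∑ ij ∈ (Finset.univ : Finset (Fin m)).offDiag,
        collision T a Y p ij.1 ij.2) / ∏ i, Y i)
      (g := fun p => ∑ ij ∈ (Finset.univ : Finset (Fin m)).offDiag, lam p ij)
      (hsum.mul_left (n * (C ^ m * B ^ 2))) (fun p => ?_) ?_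
    · simpa only [tsum_div_const] using h
    · simp only [Finset.sum_div]
      refine tendsto_finsetSum _ fun ij _ => ?_
      simp only [collision, ← Finset.prod_div_distrib, hlam]
      refine tendsto_finsetProd _ fun l _ => ?_
      by_cases h1 : l = ij.1 ∨ l = ij.2
      · simp only [h1, if_true, mul_div_assoc]
        exact (tendsto_windowSum_div_div hσ hv p l).const_mul (a p l)
      · simp only [h1, if_false]
        exact tendsto_windowSum_one_div hσ hv l
    · filter_upwards [hpos] with Y hY p
      have hprod : 0 < ∏ i, Y i := Finset.prod_pos fun i _ => hY i
      rw [Real.norm_of_nonneg (div_nonneg (hnonneg Y p) hprod.le), div_le_iff₀ hprod]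
      exact hbound Y hY p
  · filter_upwards [hpos] with Y hY
    exact ((hsum.mul_left (n * (C ^ m * B ^ 2))).mul_right (∏ l, Y l)).of_nonneg_of_le
      (hnonneg Y) (hbound Y hY)

end Positivity

end LowerBounds

/-! ### Mean values from the analytic hypotheses -/

section Analytic

open scoped Classical

variable {K : Type*} [Field K] [NumberField K] {m : ℕ}

/-- With nonnegative coefficients, the mean value of the full sums is nonzero as soon as one
coefficient compatible with the prescribed coordinates is. -/
lemma limit_ne_zero {S₀ : Finset (HeightOneSpectrum (𝓞 K))}
    {b : HeightOneSpectrum (𝓞 K) → ℂ} (hb : ∀ p ∉ S₀, b p = 1) (hb0 : ∀ p, 0 ≤ b p)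
    {c : HeightOneSpectrum (𝓞 K) → Fin m → ℂ} (hc0 : ∀ p i, 0 ≤ c p i) {T : Finset (Fin m)}
    (hlim : ∀ U, S₀ ⊆ U → ∀ i ∉ T, ∃ ρ : ℂ, ρ ≠ 0 ∧ Tendsto
      (fun y : ℝ => windowSum False (fun p => kill U c p i) y / (y : ℂ)) atTop (𝓝 ρ))
    {c' : HeightOneSpectrum (𝓞 K) → Fin m → ℝ} (hcc' : ∀ p i, ‖c p i‖ ≤ c' p i) {B C : ℝ}
    (hB : ∀ p i, c' p i ≤ B)
    (hC : ∀ i y, 0 ≤ y → windowSum False (fun p => c' p i) y ≤ C * y)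
    {z : Fin m → ℕ} (hz : ∀ i, 1 ≤ z i) {φ : HeightOneSpectrum (𝓞 K) → Option (Fin m)}
    (hφ : φ ∈ selections K z) (hφ0 : ∏ᶠ p, (φ p).elim (b p) (c p) ≠ 0)
    {v : Fin m → ℝ} (hv : ∀ i ∈ T, v i = z i) {C₀ : ℂ}
    (hC₀ : Tendsto (fun X : Fin m → ℝ => fullSum T S₀ b c X / ∏ i, (X i : ℂ))
      (cornerFilter T v) (𝓝 C₀)) : C₀ ≠ 0 := by
  set n := (Finset.univ : Finset (Fin m)).offDiag.card with hn
  -- beyond the primes in `S₁`, collisions are rare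
  obtain ⟨S₁, hS₁⟩ := summable_iff_vanishing_norm.1
    (summable_primeNorm_rpow (K := K) (σ := 2) (by norm_num)) (1 / (2 * (n * B ^ 2 + 1)))
    (by positivity)
  set S := S₀ ∪ S₁ ∪ primesUpTo K (fun i => (z i : ℝ)) with hS
  have hS₀S : S₀ ⊆ S := Finset.subset_union_left.trans Finset.subset_union_left
  have hzS : ∀ p i, primeNorm p ≤ z i → p ∈ S := fun p i h =>
    Finset.mem_union_right _ (mem_primesUpTo.2 ⟨i, by exact_mod_cast h⟩)
  have hbS : ∀ p ∉ S, b p = 1 := fun p hp => hb p fun h => hp (hS₀S h)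
  set w₀ := ∏ p ∈ S, (φ p).elim (b p) (c p) with hw₀
  have hw₀pos : 0 < w₀ := by
    rw [finprod_selection hz hzS hbS c hφ] at hφ0
    refine lt_of_le_of_ne (Finset.prod_nonneg fun p _ => ?_) (Ne.symm hφ0)
    rcases φ p with _ | i
    · exact hb0 p
    · exact hc0 p i
  have hnorm : ∀ i, setNorm (S.filter fun p => φ p = some i) = z i := fun i => by
    have h := hφ.2 i
    rw [← coe_filter_selection hz hzS hφ i, finprod_mem_coe_finset] at h
    rw [← h, setNorm, Nat.cast_prod]
  have hz0 : ∀ i, (0 : ℝ) < z i := fun i => by exact_mod_cast hz i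
  set a : HeightOneSpectrum (𝓞 K) → Fin m → ℝ := fun p i => ‖kill S c p i‖ with ha
  have hac : ∀ p i, kill S c p i = (a p i : ℂ) := fun p i =>
    (Complex.eq_coe_norm_of_nonneg (kill_nonneg S hc0 p i))
  have haS : ∀ p ∈ S, ∀ i, a p i = 0 := fun p hp i => by simp [ha, kill, hp]
  have hac' : ∀ p i, a p i ≤ c' p i := fun p i => by
    refine le_trans ?_ (hcc' p i)
    simp only [ha, kill]
    split_ifs <;> simp
  have hσ : ∀ i, ∃ σ : ℝ, i ∉ T → 0 < σ ∧ Tendsto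
      (fun y : ℝ => windowSum False (fun p => a p i) y / y) atTop (𝓝 σ) := fun i => by
    by_cases hi : i ∈ T
    · exact ⟨0, fun h => absurd hi h⟩
    obtain ⟨ρ, hρ0, hρ⟩ := hlim S hS₀S i hi
    refine ⟨‖ρ‖, fun _ => ⟨norm_pos_iff.2 hρ0, hρ.norm.congr' ?_⟩⟩
    filter_upwards [eventually_gt_atTop 0] with y hy
    simp only [hac]
    rw [← ofReal_windowSum, ← Complex.ofReal_div, Complex.norm_real, Real.norm_of_nonneg
      (div_nonneg (windowSum_nonneg (fun p => norm_nonneg _) _) hy.le)]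
  choose σ hσ using hσ
  set τ := ∏ i, (if i ∈ T then 1 else σ i) with hτ
  have hτ0 : 0 < τ := Finset.prod_pos fun i _ => by
    split_ifs with h
    · exact one_pos
    · exact (hσ i h).1
  have hv1 : ∀ i ∈ T, v i / z i = 1 := fun i hi => by rw [hv i hi, div_self (hz0 i).ne']
  obtain ⟨L, hL, hLlim, hLsum⟩ := exists_tendsto_collisions (T := T)
    (v := fun i => v i / z i) (fun p i => norm_nonneg (kill S c p i)) hac' hB hC
    (fun i hi => (hσ i hi).2) (fun i hi => (hσ i hi).1) hv1 haS (δ := 1 / (2 * (n * B ^ 2 + 1)))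
    fun t ht => (le_abs_self _).trans (hS₁ t (ht.mono_right
      (Finset.subset_union_right.trans Finset.subset_union_left))).le
  -- the choice of `S₁` makes the collisions at most half of all tuples
  have hLτ : L ≤ τ / 2 := by
    refine hL.trans ?_
    have h0 : (0 : ℝ) ≤ n * B ^ 2 := mul_nonneg n.cast_nonneg (sq_nonneg B)
    have h1 : 1 / (2 * (n * B ^ 2 + 1)) * (n * B ^ 2) ≤ 1 / 2 := by
      rw [div_mul_eq_mul_div, div_le_div_iff₀ (by linarith) two_pos]
      linarith
    have h2 := mul_le_mul_of_nonneg_right h1 hτ0.le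
    rw [← hn, ← hτ]
    linarith
  have hdiv := tendsto_div_cornerFilter T v (fun i => (z i : ℝ)) hz0
  have hprodlim := tendsto_finsetProd Finset.univ fun i _ =>
    tendsto_windowSum_one_div (fun i hi => (hσ i hi).2) hv1 i
  have hlow := ((hprodlim.sub hLlim).comp hdiv).const_mul (w₀.re / ∏ i, (z i : ℝ))
  have hre := (Complex.continuous_re.tendsto _).comp hC₀
  -- fixing the selection `φ` on `S` leaves the box with corner `X i / z i`, in which the prescribed
  -- coordinates are `1`
  have hle : w₀.re / (∏ i, (z i : ℝ)) * (τ - L) ≤ C₀.re := by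
    refine le_of_tendsto_of_tendsto hlow hre ?_
    have hXpos := eventually_cornerFilter_pos (T := T) (v := v) fun i hi => by
      rw [hv i hi]; exact hz0 i
    filter_upwards [hXpos, hdiv.eventually hLsum] with X hX hsum
    set Y : Fin m → ℝ := fun i => X i / z i with hY
    have hYpos : 0 < ∏ i, Y i := Finset.prod_pos fun i _ => div_pos (hX i) (hz0 i)
    have hzprod : 0 < ∏ i, (z i : ℝ) := Finset.prod_pos fun i _ => hz0 i
    have hXY : ∏ i, X i = (∏ i, (z i : ℝ)) * ∏ i, Y i := by
      rw [← Finset.prod_mul_distrib]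
      refine Finset.prod_congr rfl fun i _ => ?_
      rw [hY, mul_div_cancel₀ _ (hz0 i).ne']
    set S' := primesUpTo K X \ S with hS'
    have h1 := prod_mul_boxSum_le T hb0 φ S' S Finset.disjoint_sdiff c hc0 X
    have h2 : boxSum T (S ∪ S') b c X = fullSum T S₀ b c X :=
      boxSum_eq_fullSum T (hS₀S.trans Finset.subset_union_left) hb c (by
        rw [hS', Finset.union_sdiff_self_eq_union]; exact Finset.subset_union_right)
    simp only [h2, hnorm] at h1
    have h3 : boxSum T S' b (kill S c) Y = boxSum T S' (fun _ => 1) (kill S c) Y :=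
      boxSum_congr_left T (fun p hp => hbS p (Finset.mem_sdiff.1 hp).2) _ _
    have h4 := norm_boxSum_sub_le T (Finset.empty_subset S') (b := fun _ => 1) (fun _ _ => rfl)
      (c := kill S c) (c' := a) (fun _ _ => le_rfl) (M := 1) (by simp) Y
    have h5 : ∑ p ∈ S' \ ∅, ∑ ij ∈ (Finset.univ : Finset (Fin m)).offDiag,
        collision T a Y p ij.1 ij.2 ≤ ∑' p, ∑ ij ∈ (Finset.univ : Finset (Fin m)).offDiag,
        collision T a Y p ij.1 ij.2 := hsum.sum_le_tsum _ fun p _ =>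
      Finset.sum_nonneg fun ij _ => collision_nonneg T (fun p i => norm_nonneg _) Y p _ _
    have h6 : boxSum T ∅ (fun _ => 1) (kill S c) Y =
        ((∏ i, windowSum (i ∈ T) (fun p => a p i) (Y i) : ℝ) : ℂ) := by
      rw [boxSum_empty]
      push_cast
      simp only [hac, ofReal_windowSum]
    rw [h6, one_mul] at h4
    have h7 := (neg_le_abs _).trans ((Complex.abs_re_le_norm _).trans (h4.trans h5))
    rw [Complex.sub_re, Complex.ofReal_re] at h7
    have h8 : w₀ = ((w₀.re : ℝ) : ℂ) := (Complex.eq_re_of_ofReal_le hw₀pos.le)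
    have hw₀re : 0 ≤ w₀.re := by
      have := hw₀pos.le
      rw [h8] at this
      exact_mod_cast this
    have h9 : w₀.re * (boxSum T S' (fun _ => 1) (kill S c) Y).re ≤
        (fullSum T S₀ b c X).re := by
      rw [← Complex.re_ofReal_mul, ← h8, ← h3]
      exact (Complex.le_def.1 h1).1
    simp only [Function.comp_apply]
    rw [← Complex.ofReal_prod, Complex.div_ofReal_re, hXY, Finset.prod_div_distrib, ← sub_div,
      div_mul_div_comm]
    refine div_le_div_of_nonneg_right (le_trans (mul_le_mul_of_nonneg_left ?_ hw₀re) h9)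
      (mul_pos hzprod hYpos).le
    linarith
  have hpos : 0 < w₀.re / (∏ i, (z i : ℝ)) * (τ - L) := by
    have : 0 < w₀.re := (Complex.lt_def.1 hw₀pos).1
    have := Finset.prod_pos fun i (_ : i ∈ (Finset.univ : Finset (Fin m))) => hz0 i
    have : 0 < τ - L := by linarith
    positivity
  rintro rfl
  simp only [Complex.zero_re] at hle
  linarith

/-- The one-variable mean values supplied by the Wiener–Ikehara theorem. -/
lemma exists_tendsto_windowSum_div {c : HeightOneSpectrum (𝓞 K) → ℂ}
    {c' : HeightOneSpectrum (𝓞 K) → ℝ} (hcc' : ∀ p, ‖c p‖ ≤ c' p) {B E : ℝ} (hB : ∀ p, c' p ≤ B)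
    (hD : ∀ p, E < primeNorm p → ∀ s : ℂ, s.re = 1 → 1 + c p * (primeNorm p : ℂ) ^ (-s) ≠ 0)
    {r r' : ℂ} (hr : ContinuesWithValue (fun s => (s - 1) * eulerProduct E c s) r)
    (hr' : ContinuesWithValue (fun s => (s - 1) * eulerProduct E (fun p => (c' p : ℂ)) s) r')
    {U : Finset (HeightOneSpectrum (𝓞 K))} (hU : ∀ p, (primeNorm p : ℝ) ≤ E → p ∈ U) :
    ∃ ρ : ℂ, (r ≠ 0 → ρ ≠ 0) ∧ Tendsto
      (fun y : ℝ => windowSum False (fun p => if p ∈ U then 0 else c p) y / (y : ℂ))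
      atTop (𝓝 ρ) := by
  have hc'0 : ∀ p, 0 ≤ c' p := fun p => (norm_nonneg _).trans (hcc' p)
  have hkle : ∀ p, ‖if p ∈ U then 0 else c p‖ ≤ c' p := fun p => by
    split_ifs
    · simpa using hc'0 p
    · exact hcc' p
  have hc'n : ∀ p, ‖(c' p : ℂ)‖ ≤ B := fun p => by
    rw [Complex.norm_real, Real.norm_of_nonneg (hc'0 p)]; exact hB p
  obtain ⟨ρ, g, hg, hρ⟩ := exists_extendsToLine (u := c) (v := fun p => if p ∈ U then 0 else c p)
    (fun p => (hcc' p).trans (hB p)) (fun p => (hkle p).trans (hB p)) (E := E) (S := U)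
    (fun p hp => ⟨lt_of_not_ge fun h => hp (hU p h), if_neg hp⟩) (fun p _ => hD p) hr
  obtain ⟨ρ', g', hg', -⟩ := exists_extendsToLine (u := fun p => (c' p : ℂ))
    (v := fun p => (c' p : ℂ)) hc'n hc'n (E := E) (S := (finite_primeNorm_le (K := K) E).toFinset)
    (fun p hp => ⟨lt_of_not_ge fun h => hp (by simpa using h), rfl⟩)
    (fun p hp h => absurd h (not_lt.2 (by simpa using hp))) hr'
  refine ⟨ρ, hρ fun p hp => if_pos hp, ?_⟩
  have key := tendsto_partialSum_div (w' := fun J => ∏ p ∈ J, c' p) (g' := g') one_le_setNorm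
    (fun J => ?_) (fun σ hσ => summable_prod_mul_setNorm_rpow hc'0 hB hσ) hg
    (ρ' := ρ') (by simpa only [Complex.ofReal_prod] using hg')
  · simpa only [partialSum_eq_windowSum] using key
  · rw [norm_prod]
    exact Finset.prod_le_prod (fun p _ => norm_nonneg _) fun p _ => hkle p

/-- The majorants have window sums of at most linear growth. -/
lemma exists_windowSum_le {c' : HeightOneSpectrum (𝓞 K) → ℝ} (hc'0 : ∀ p, 0 ≤ c' p) {B E : ℝ}
    (hB : ∀ p, c' p ≤ B) {r' : ℂ}
    (hr' : ContinuesWithValue (fun s => (s - 1) * eulerProduct E (fun p => (c' p : ℂ)) s) r') :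
    ∃ C : ℝ, ∀ y : ℝ, 0 ≤ y → windowSum False c' y ≤ C * y := by
  have hc'n : ∀ p, ‖(c' p : ℂ)‖ ≤ B := fun p => by
    rw [Complex.norm_real, Real.norm_of_nonneg (hc'0 p)]; exact hB p
  obtain ⟨ρ', g', hg', -⟩ := exists_extendsToLine (u := fun p => (c' p : ℂ))
    (v := fun p => (c' p : ℂ)) hc'n hc'n (E := E) (S := (finite_primeNorm_le (K := K) E).toFinset)
    (fun p hp => ⟨lt_of_not_ge fun h => hp (by simpa using h), rfl⟩)
    (fun p hp h => absurd h (not_lt.2 (by simpa using hp))) hr'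
  obtain ⟨C, hC⟩ := exists_bound_of_extendsToLine (w' := fun J => ∏ p ∈ J, c' p) (n := setNorm)
    one_le_setNorm (fun J => Finset.prod_nonneg fun p _ => hc'0 p)
    (fun σ hσ => summable_prod_mul_setNorm_rpow hc'0 hB hσ)
    (by simpa only [Complex.ofReal_prod] using hg')
  refine ⟨C, fun y hy => ?_⟩
  rcases hy.eq_or_lt with rfl | hy
  · rw [windowSum_of_lt_one _ one_pos, mul_zero]
  · have := hC (Real.log y)
    rwa [Real.exp_log hy, Real.exp_neg, Real.exp_log hy, partialSum_eq_windowSum,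
      ← div_eq_mul_inv, div_le_iff₀ hy] at this

lemma tendsto_corner {T : Finset (Fin m)} (x : {i // i ∈ T} → ℕ) :
    Tendsto (corner x) atTop (cornerFilter T (corner x 0)) := by
  rw [tendsto_cornerFilter_iff]
  intro i
  by_cases hi : i ∈ T
  · rw [if_pos hi, tendsto_pure]
    exact Eventually.of_forall fun X => by simp [corner, hi]
  · rw [if_neg hi]
    simp only [corner, hi, dif_neg, not_false_eq_true]
    exact tendsto_atTop_atTop.2 fun M => ⟨fun _ => M, fun X hX => hX ⟨i, hi⟩⟩

lemma prod_corner {T : Finset (Fin m)} (x : {i // i ∈ T} → ℕ) (X : {i // i ∉ T} → ℝ) :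
    ∏ i, corner x X i = (∏ i, (x i : ℝ)) * ∏ i, X i := by
  rw [← Fintype.prod_subtype_mul_prod_subtype (fun i => i ∈ T)]
  congr 1
  · exact Finset.prod_congr (by ext; simp) fun i _ => by simp [corner, i.2]
  · exact Finset.prod_congr (by ext; simp) fun i _ => by simp [corner, i.2]

end Analytic

end

end MultiDirichlet


theorem mainTheorem8 {K : Type*} [Field K] [NumberField K] (m : ℕ)
    (b : HeightOneSpectrum (𝓞 K) → ℂ) (c : HeightOneSpectrum (𝓞 K) → Fin m → ℂ)
    (hb : {p | b p ≠ 1}.Finite)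
    (hc : ∃ B : ℝ, ∀ p i, ‖c p i‖ ≤ B)
    (E₀ : ℝ)
    (hE₀ : ∀ p, E₀ < (MultiDirichlet.primeNorm p : ℝ) →
      b p = 1 ∧ ∀ i, ∀ s : ℂ, s.re = 1 →
        1 + c p i * (MultiDirichlet.primeNorm p : ℂ) ^ (-s) ≠ 0)
    (r : Fin m → ℂ)
    (hr : ∀ i, MultiDirichlet.ContinuesWithValue
      (fun s => (s - 1) * MultiDirichlet.eulerProduct E₀ (fun p => c p i) s) (r i))
    (c' : HeightOneSpectrum (𝓞 K) → Fin m → ℝ)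
    (hc'_bdd : ∃ B : ℝ, ∀ p i, c' p i ≤ B)
    (hc' : ∀ p i, ‖c p i‖ ≤ c' p i)
    (hr' : ∀ i, ∃ r' : ℂ, MultiDirichlet.ContinuesWithValue
      (fun s => (s - 1) * MultiDirichlet.eulerProduct E₀ (fun p => (c' p i : ℂ)) s) r')
    (T : Finset (Fin m)) (x : {i // i ∈ T} → ℕ) (hx : ∀ i, 1 ≤ x i) :
    ∃ C' : ℂ,
      ((fun X : {i // i ∉ T} → ℝ =>
          MultiDirichlet.boundarySum b c x X - C' * ∏ i, (X i : ℂ))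
        =o[atTop] fun X => ∏ i, X i) ∧
      ((∀ p, 0 ≤ b p) → (∀ p i, 0 ≤ c p i) →
        0 ≤ C' ∧
        (C' = 0 → ∏ i, r i ≠ 0 →
          ∀ X : {i // i ∉ T} → ℝ, MultiDirichlet.boundarySum b c x X = 0)) := by
  classical
  open MultiDirichlet Topology in
  obtain ⟨B, hB⟩ := hc'_bdd
  choose r' hr' using hr'
  -- outside `S₀` all `b p` are `1`, and the local factors do not vanish on `re s = 1`
  set S₀ := (finite_primeNorm_le (K := K) E₀).toFinset with hS₀
  have hS₀mem : ∀ p, (primeNorm p : ℝ) ≤ E₀ → p ∈ S₀ := fun p hp => by simpa [hS₀] using hp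
  have hb1 : ∀ p ∉ S₀, b p = 1 := fun p hp =>
    (hE₀ p (lt_of_not_ge fun h => hp (hS₀mem p h))).1
  have hlim : ∀ U, S₀ ⊆ U → ∀ i, ∃ ρ : ℂ, (r i ≠ 0 → ρ ≠ 0) ∧ Tendsto
      (fun y : ℝ => windowSum False (fun p => kill U c p i) y / (y : ℂ)) atTop (𝓝 ρ) :=
    fun U hU i => exists_tendsto_windowSum_div (c := fun p => c p i) (fun p => hc' p i)
      (fun p => hB p i) (fun p hp => (hE₀ p hp).2 i) (hr i) (hr' i)
      fun p hp => hU (hS₀mem p hp)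
  choose Ci hCi using fun i => exists_windowSum_le (c' := fun p => c' p i)
    (fun p => (norm_nonneg _).trans (hc' p i)) (fun p => hB p i) (hr' i)
  have hC : ∀ i y, 0 ≤ y → windowSum False (fun p => c' p i) y ≤ (∑ i, |Ci i|) * y :=
    fun i y hy => (hCi i y hy).trans (mul_le_mul_of_nonneg_right ((le_abs_self _).trans
      (Finset.single_le_sum (f := fun i => |Ci i|) (fun i _ => abs_nonneg _)
        (Finset.mem_univ i))) hy)
  have hxpos : ∀ i ∈ T, 0 < corner (T := T) x 0 i := fun i hi => by
    rw [corner, dif_pos hi]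
    exact_mod_cast hx _
  obtain ⟨C₀, hC₀⟩ := exists_tendsto_fullSum_div hb1
    (fun U hU i => (hlim U hU i).imp fun ρ h => h.2) hc' hB
    (Finset.sum_nonneg fun i _ => abs_nonneg (Ci i)) hC T hxpos
  have hP : 0 < ∏ i, (x i : ℝ) := Finset.prod_pos fun i _ => by exact_mod_cast hx i
  have hmain : Tendsto (fun X => boundarySum b c x X / ((∏ i, (x i : ℝ)) * ∏ i, X i : ℝ)) atTop
      (𝓝 C₀) := by
    refine (hC₀.comp (tendsto_corner x)).congr fun X => ?_
    rw [Function.comp_apply, ← boundarySum_eq_fullSum hb1 c hx, ← Complex.ofReal_prod, prod_corner]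
  have hXpos : ∀ᶠ X : {i // i ∉ T} → ℝ in atTop, 0 < ∏ i, X i := by
    filter_upwards [eventually_ge_atTop (fun _ => (1 : ℝ))] with X hX
    exact Finset.prod_pos fun i _ => one_pos.trans_le (hX i)
  -- the limit `C₀` is normalized by the product of all coordinates, including the prescribed ones
  refine ⟨C₀ * ((∏ i, (x i : ℝ) : ℝ) : ℂ), ?_, fun hb0 hc0 => ⟨?_, fun h0 hr0 X => ?_⟩⟩
  · rw [isLittleO_iff]
    intro ε hε
    have h1 := Metric.tendsto_nhds.1 hmain (ε / ∏ i, (x i : ℝ)) (by positivity)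
    filter_upwards [h1, hXpos] with X hX hpos
    rw [dist_eq_norm] at hX
    have hne : (((∏ i, (x i : ℝ)) * ∏ i, X i : ℝ) : ℂ) ≠ 0 := by
      exact_mod_cast (mul_pos hP hpos).ne'
    have e : boundarySum b c x X - C₀ * ((∏ i, (x i : ℝ) : ℝ) : ℂ) * ∏ i, (X i : ℂ) =
        (boundarySum b c x X / ((∏ i, (x i : ℝ)) * ∏ i, X i : ℝ) - C₀) *
          (((∏ i, (x i : ℝ)) * ∏ i, X i : ℝ) : ℂ) := by
      rw [sub_mul, div_mul_cancel₀ _ hne]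
      push_cast
      ring
    rw [e, norm_mul, Complex.norm_real, Real.norm_of_nonneg (mul_pos hP hpos).le,
      Real.norm_of_nonneg hpos.le, ← mul_assoc]
    refine mul_le_mul_of_nonneg_right ?_ hpos.le
    rw [lt_div_iff₀ hP] at hX
    exact hX.le
  · refine mul_nonneg (ge_of_tendsto hmain ?_) (by exact_mod_cast hP.le)
    filter_upwards [hXpos] with X hpos
    rw [boundarySum_eq_fullSum hb1 c hx]
    have h1 := boxSum_nonneg T (S₀ ∪ primesUpTo K (corner x X)) hb0 hc0 (corner x X)
    have h2 : (0 : ℂ) ≤ (((∏ i, (x i : ℝ)) * ∏ i, X i : ℝ) : ℂ)⁻¹ := by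
      rw [← Complex.ofReal_inv]
      exact_mod_cast (inv_pos.2 (mul_pos hP hpos)).le
    rw [div_eq_mul_inv]
    exact mul_nonneg h1 h2
  · -- a nonzero sum contains a nonzero coefficient, to which some selection contributes
    have hC₀0 : C₀ = 0 := by
      rcases mul_eq_zero.1 h0 with h | h
      · exact h
      · exact absurd h (by exact_mod_cast hP.ne')
    by_contra hne
    obtain ⟨y, hy, hyne⟩ := Finset.exists_ne_zero_of_sum_ne_zero hne
    rw [Fintype.mem_piFinset] at hy
    have hz : ∀ i, 1 ≤ glue x y i := fun i => by
      unfold glue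
      split_ifs with h
      · exact hx _
      · exact (Finset.mem_Icc.1 (hy ⟨i, h⟩)).1
    have hsel : ∃ φ ∈ selections K (glue x y), ∏ᶠ p, (φ p).elim (b p) (c p) ≠ 0 := by
      by_contra! hall
      exact hyne (finsum_mem_eq_zero_of_forall_eq_zero hall)
    obtain ⟨φ, hφ, hφ0⟩ := hsel
    refine limit_ne_zero hb1 hb0 hc0 (fun U hU i _ => ?_) hc' hB hC hz hφ hφ0 (T := T)
      (v := corner x 0) (fun i hi => ?_) hC₀ hC₀0
    · obtain ⟨ρ, h1, h2⟩ := hlim U hU i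
      exact ⟨ρ, h1 (Finset.prod_ne_zero_iff.1 hr0 i (Finset.mem_univ i)), h2⟩
    · simp [corner, glue, hi]
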